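/- Let $G$ be a finite group and let $\phi\colon G\to\mathbb Z/2$ be a surjective homomorphism (a magnetic group $(G,\phi)$). For $g\in G$ let $\mathbb K^{\phi(g)}$ be the identity of $\mathbb C$ if $\phi(g)=0$ and complex conjugation if $\phi(g)=1$, and let $\mathbb C^*_\phi$ be the $G$-module $\mathbb C^*$ on which $g$ acts by $\mathbb K^{\phi(g)}$. A magnetic equivariant central simple graded algebra is a finite-dimensional $\mathbb Z/2$-graded $\mathbb C$-algebra $A=A_0\oplus A_1$ which is nonzero, has no two-sided graded ideals other than $0$ and $A$, and has graded center $\mathbb C$, together with an action of $G$ by degree-preserving ring automorphisms with $g(za)=\mathbb K^{\phi(g)}(z)\,g(a)$ for $z\in\mathbb C$, $a\in A$. The graded tensor product $A\hat\otimes B$ has the product $(a\otimes b)(a'\otimes b')=(-1)^{\partial a'\,\partial b}\,aa'\otimes bb'$ and the action $g(a\otimes b)=ga\otimes gb$. A graded magnetic representation is a finite-dimensional graded complex vector space $V=V_0\oplus V_1\neq 0$ with an action $\rho$ of $G$ that preserves $V_0$ and $V_1$ and in which $g$ acts $\mathbb C$-linearly if $\phi(g)=0$ and $\mathbb C$-antilinearly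 if $\phi(g)=1$; the graded algebra $\mathrm{End}(V_0,V_1)$ of all linear endomorphisms of $V$ carries the action $f\mapsto\rho(g)f\rho(g)^{-1}$. Two such algebras $A,B$ are similar if $A\hat\otimes\mathrm{End}(V_0,V_1)\cong B\hat\otimes\mathrm{End}(W_0,W_1)$, as graded algebras with $G$-action, for some graded magnetic representations $V,W$. Similarity is an equivalence relation, $\hat\otimes$ makes the set $\mathrm{GrBr}_{(G,\phi)}(\mathbb C)$ of similarity classes an abelian group, and the assignment $$\Big(H^2(G,\mathbb C^*_\phi)\overset{\bullet}{\times}\mathrm{Hom}(G,\mathbb Z/2)\Big)\overset{\bullet}{\times}\mathbb Z/2\longrightarrow\mathrm{GrBr}_{(G,\phi)}(\mathbb C),\qquad(\lambda,\psi,a)\longmapsto[\mathrm{End}(V_\lambda)\hat\otimes\sigma(\psi)\hat\otimes\alpha(a)]$$ is a well-defined isomorphism of groups. Here: * the left-hand side is the set $H^2(G,\mathbb C^*_\phi)\times\mathrm{Hom}(G,\mathbb Z/2)\times\mathbb Z/2$ with the product $$(\lambda_0,\psi_0,a_0)(\lambda_1,\psi_1,a_1)=\big((-1)^{\psi_0\cup\psi_1+\psi_0\cup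 a_0a_1\phi+\psi_1\cup a_0a_1\phi}\,\lambda_0\lambda_1,\ \psi_0+\psi_1+a_0a_1\phi,\ a_0+a_1\big),$$ where $(-1)^{\psi\cup\chi}\in H^2(G,\mathbb C^*_\phi)$ is the class of the 2-cocycle $(g,h)\mapsto(-1)^{\psi(g)\chi(h)}$; * if $\lambda$ is the class of a 2-cocycle $c$, then $V_\lambda$ is any nonzero finite-dimensional complex vector space (in degree $0$) with additive bijections $\rho(g)$, $g\in G$, linear if $\phi(g)=0$ and antilinear if $\phi(g)=1$, such that $\rho(g)\rho(h)=c(g,h)\rho(gh)$; such a $V_\lambda$ exists for every $c$, and $G$ acts on $\mathrm{End}(V_\lambda)$ by $f\mapsto\rho(g)f\rho(g)^{-1}$; * $\sigma(\psi)$ is the algebra $M_2(\mathbb C)$ (diagonal matrices even, antidiagonal matrices odd) on which $g$ acts by $M\mapsto J^{\psi(g)}\,\mathbb K^{\phi(g)}(M)\,J^{-\psi(g)}$, with $J=\left(\begin{smallmatrix}0&1\\1&0\end{smallmatrix}\right)$ and $\mathbb K^{\phi(g)}$ applied to the entries; * $\alpha(0)=\mathbb C$, with the action of $G$ by $\mathbb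 K^{\phi(g)}$, and $\alpha(1)=\mathbb C[e]/(e^2-1)$ with $e$ of degree $1$, on which $g$ acts by $x+ye\mapsto\mathbb K^{\phi(g)}(x)+\mathbb K^{\phi(g)}(y)\,e$. -/

import Mathlib

open scoped TensorProduct DirectSum
open groupCohomology

noncomputable section

namespace MagneticBrauer

/-! ### Signs and complex conjugation -/

/-- The sign `(-1)^s` of `s : ℤ/2`, as a nonzero complex number. -/
def sgn (s : ZMod 2) : ℂˣ := (-1) ^ s.val

lemma zmod_two_eq : ∀ s : ZMod 2, s = 0 ∨ s = 1 := by decide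

lemma zmod_two_one_add_one : (1 : ZMod 2) + 1 = 0 := rfl

lemma zmod_two_val_one : ZMod.val (1 : ZMod 2) = 1 := rfl

@[simp] lemma sgn_zero : sgn 0 = 1 := by simp [sgn]

@[simp] lemma sgn_one : sgn 1 = -1 := by simp [sgn, zmod_two_val_one]

lemma sgn_add (s t : ZMod 2) : sgn (s + t) = sgn s * sgn t := by
  rcases zmod_two_eq s with rfl | rfl <;> rcases zmod_two_eq t with rfl | rfl <;>
    simp [zmod_two_one_add_one]

variable {G : Type} [Group G]

/-- The field automorphism `𝕂^{φ(g)}` of `ℂ`: complex conjugation if `φ g` is the nontrivial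
element of `ℤ/2`, and the identity otherwise. -/
def conjPow (φ : G →* Multiplicative (ZMod 2)) (g : G) : ℂ →+* ℂ :=
  if (φ g).toAdd = 0 then RingHom.id ℂ else starRingEnd ℂ

section conjPow

variable (φ : G →* Multiplicative (ZMod 2))

@[simp] lemma conjPow_one (z : ℂ) : conjPow φ 1 z = z := by simp [conjPow]

lemma conjPow_mul (g h : G) (z : ℂ) : conjPow φ (g * h) z = conjPow φ g (conjPow φ h z) := by
  have key : ∀ s t : ZMod 2,
      (if s + t = 0 then RingHom.id ℂ else starRingEnd ℂ) z =
        (if s = 0 then RingHom.id ℂ else starRingEnd ℂ)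
          ((if t = 0 then RingHom.id ℂ else starRingEnd ℂ) z) := by
    intro s t
    rcases zmod_two_eq s with rfl | rfl <;> rcases zmod_two_eq t with rfl | rfl <;>
      simp [zmod_two_one_add_one]
  simpa [conjPow] using key (φ g).toAdd (φ h).toAdd

@[simp] lemma conjPow_conjPow (g : G) (z : ℂ) : conjPow φ g (conjPow φ g z) = z := by
  unfold conjPow; split_ifs <;> simp

lemma conjPow_sgn (g : G) (s : ZMod 2) : conjPow φ g (sgn s : ℂ) = (sgn s : ℂ) := by
  rcases zmod_two_eq s with rfl | rfl <;> simp

end conjPow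

/-! ### The coefficients `ℂ*_φ` and `H²(G, ℂ*_φ)` -/

/-- The `G`-module `ℂ*_φ`: the group `ℂ*`, on which `g` acts by `𝕂^{φ(g)}`. -/
def CUnits (_φ : G →* Multiplicative (ZMod 2)) : Type := ℂˣ

instance (φ : G →* Multiplicative (ZMod 2)) : CommGroup (CUnits φ) :=
  inferInstanceAs (CommGroup ℂˣ)

/-- The underlying complex number of an element of `ℂ*_φ`. -/
def CUnits.val {φ : G →* Multiplicative (ZMod 2)} (z : CUnits φ) : ℂ := Units.val (α := ℂ) z

instance (φ : G →* Multiplicative (ZMod 2)) : MulDistribMulAction G (CUnits φ) where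
  smul g z := Units.map (conjPow φ g : ℂ →* ℂ) (z : ℂˣ)
  one_smul _ := Units.ext (conjPow_one φ _)
  mul_smul g h _ := Units.ext (conjPow_mul φ g h _)
  smul_one g := map_one (Units.map (conjPow φ g : ℂ →* ℂ))
  smul_mul g z w := map_mul (Units.map (conjPow φ g : ℂ →* ℂ)) (z : ℂˣ) (w : ℂˣ)

/-- The cohomology group `H²(G, ℂ*_φ)` (written additively). -/
abbrev H2Phi (φ : G →* Multiplicative (ZMod 2)) : Type :=
  H2 (Rep.ofMulDistribMulAction G (CUnits φ))

/-- The class in `H²(G, ℂ*_φ)` of a multiplicative 2-cocycle `c : G × G → ℂ*_φ`. -/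
def H2Phi.mk (φ : G →* Multiplicative (ZMod 2)) {c : G × G → CUnits φ} (hc : IsMulCocycle₂ c) :
    H2Phi φ :=
  H2π _ (cocyclesOfIsMulCocycle₂ hc)

/-- The 2-cocycle `(-1)^{ψ ∪ χ}`, that is `(g, h) ↦ (-1)^{ψ(g) χ(h)}`, with values in `ℂ*_φ`. -/
def signCup (φ ψ χ : G →* Multiplicative (ZMod 2)) : G × G → CUnits φ :=
  fun p => sgn ((ψ p.1).toAdd * (χ p.2).toAdd)

lemma isMulCocycle₂_signCup (φ ψ χ : G →* Multiplicative (ZMod 2)) :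
    IsMulCocycle₂ (signCup φ ψ χ) := by
  intro g h j
  have h1 : g • signCup φ ψ χ (h, j) = signCup φ ψ χ (h, j) :=
    Units.ext (conjPow_sgn φ g _)
  rw [h1]
  change sgn _ * sgn _ = sgn _ * sgn _
  rw [← sgn_add, ← sgn_add]
  congr 1
  simp only [map_mul, toAdd_mul]
  ring

/-- The class `(-1)^{ψ ∪ χ}` in `H²(G, ℂ*_φ)`. -/
def cupClass (φ ψ χ : G →* Multiplicative (ZMod 2)) : H2Phi φ :=
  H2Phi.mk φ (isMulCocycle₂_signCup φ ψ χ)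

section cupClass

variable (φ : G →* Multiplicative (ZMod 2))

lemma H2Phi.mk_add {c d e : G × G → CUnits φ} (hc : IsMulCocycle₂ c) (hd : IsMulCocycle₂ d)
    (he : IsMulCocycle₂ e) (h : ∀ p, c p * d p = e p) :
    H2Phi.mk φ hc + H2Phi.mk φ hd = H2Phi.mk φ he := by
  unfold H2Phi.mk
  rw [← map_add]
  congr 1
  exact Subtype.ext (funext fun p => congrArg Additive.ofMul (h p))

lemma cupClass_mul_left (ψ₀ ψ₁ χ : G →* Multiplicative (ZMod 2)) :
    cupClass φ (ψ₀ * ψ₁) χ = cupClass φ ψ₀ χ + cupClass φ ψ₁ χ := by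
  refine (H2Phi.mk_add φ _ _ _ fun p => ?_).symm
  change sgn _ * sgn _ = sgn _
  rw [← sgn_add]
  congr 1
  simp only [MonoidHom.mul_apply, toAdd_mul]
  ring

lemma cupClass_mul_right (ψ χ₀ χ₁ : G →* Multiplicative (ZMod 2)) :
    cupClass φ ψ (χ₀ * χ₁) = cupClass φ ψ χ₀ + cupClass φ ψ χ₁ := by
  refine (H2Phi.mk_add φ _ _ _ fun p => ?_).symm
  change sgn _ * sgn _ = sgn _
  rw [← sgn_add]
  congr 1
  simp only [MonoidHom.mul_apply, toAdd_mul]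
  ring

@[simp] lemma cupClass_one_left (χ : G →* Multiplicative (ZMod 2)) : cupClass φ 1 χ = 0 := by
  simpa using cupClass_mul_left φ 1 1 χ

@[simp] lemma cupClass_one_right (ψ : G →* Multiplicative (ZMod 2)) : cupClass φ ψ 1 = 0 := by
  simpa using cupClass_mul_right φ ψ 1 1

lemma cupClass_comm (ψ χ : G →* Multiplicative (ZMod 2)) :
    cupClass φ ψ χ = cupClass φ χ ψ := by
  unfold cupClass H2Phi.mk
  rw [H2π_eq_iff]
  refine ⟨fun g => Additive.ofMul (show CUnits φ from sgn ((ψ g).toAdd * (χ g).toAdd)), ?_⟩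
  funext p
  have h1 : ∀ z : CUnits φ, (∃ s, z = sgn s) → p.1 • z = z := by
    rintro _ ⟨s, rfl⟩
    exact Units.ext (conjPow_sgn φ p.1 s)
  have key : ∀ a b c d : ZMod 2,
      sgn (b * d) / sgn ((a + b) * (c + d)) * sgn (a * c) = sgn (a * d) / sgn (c * b) := by
    intro a b c d
    rw [div_mul_eq_mul_div, div_eq_div_iff_mul_eq_mul, ← sgn_add, ← sgn_add, ← sgn_add]
    congr 1
    revert a b c d
    decide
  have h2 := key (ψ p.1).toAdd (ψ p.2).toAdd (χ p.1).toAdd (χ p.2).toAdd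
  have h3 : p.1 • (show CUnits φ from sgn ((ψ p.2).toAdd * (χ p.2).toAdd)) /
      (show CUnits φ from sgn ((ψ (p.1 * p.2)).toAdd * (χ (p.1 * p.2)).toAdd)) *
      (show CUnits φ from sgn ((ψ p.1).toAdd * (χ p.1).toAdd)) =
      signCup φ ψ χ p / signCup φ χ ψ p := by
    rw [h1 _ ⟨_, rfl⟩]
    simp only [map_mul, toAdd_mul]
    exact h2
  exact congrArg Additive.ofMul h3

lemma cupClass_add_self (ψ χ : G →* Multiplicative (ZMod 2)) :
    cupClass φ ψ χ + cupClass φ ψ χ = 0 := by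
  have : ψ * ψ = 1 := by
    ext g
    have : ∀ s : ZMod 2, s + s = 0 := by decide
    exact this (ψ g).toAdd
  rw [← cupClass_mul_left, this, cupClass_one_left]

end cupClass

/-! ### The twisted product -/

/-- The underlying set of `(H²(G, ℂ*_φ) •× Hom(G, ℤ/2)) •× ℤ/2`. The groups `H²(G, ℂ*_φ)` and
`ℤ/2` are written additively, the group `Hom(G, ℤ/2)` multiplicatively. -/
@[ext]
structure TwistedProduct (φ : G →* Multiplicative (ZMod 2)) where
  /-- the component in `H²(G, ℂ*_φ)` -/
  lam : H2Phi φ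
  /-- the component in `Hom(G, ℤ/2)` -/
  psi : G →* Multiplicative (ZMod 2)
  /-- the component in `ℤ/2` -/
  a : ZMod 2

namespace TwistedProduct

variable {φ : G →* Multiplicative (ZMod 2)}

/-- The product
`(λ₀,ψ₀,a₀)(λ₁,ψ₁,a₁) = ((-1)^{ψ₀∪ψ₁ + ψ₀∪φ^{a₀a₁} + ψ₁∪φ^{a₀a₁}} λ₀ λ₁, ψ₀+ψ₁+φ^{a₀a₁}, a₀+a₁)`. -/
instance : Mul (TwistedProduct φ) where
  mul x y :=
    { lam := cupClass φ x.psi y.psi + cupClass φ x.psi (φ ^ (x.a * y.a).val) +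
        cupClass φ y.psi (φ ^ (x.a * y.a).val) + x.lam + y.lam
      psi := x.psi * y.psi * φ ^ (x.a * y.a).val
      a := x.a + y.a }

instance : One (TwistedProduct φ) where
  one := { lam := 0, psi := 1, a := 0 }

@[simp] lemma one_lam : (1 : TwistedProduct φ).lam = 0 := rfl
@[simp] lemma one_psi : (1 : TwistedProduct φ).psi = 1 := rfl
@[simp] lemma one_a : (1 : TwistedProduct φ).a = 0 := rfl
@[simp] lemma mul_lam (x y : TwistedProduct φ) : (x * y).lam =
    cupClass φ x.psi y.psi + cupClass φ x.psi (φ ^ (x.a * y.a).val) +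
        cupClass φ y.psi (φ ^ (x.a * y.a).val) + x.lam + y.lam := rfl
@[simp] lemma mul_psi (x y : TwistedProduct φ) :
    (x * y).psi = x.psi * y.psi * φ ^ (x.a * y.a).val := rfl
@[simp] lemma mul_a (x y : TwistedProduct φ) : (x * y).a = x.a + y.a := rfl

protected lemma mul_comm (x y : TwistedProduct φ) : x * y = y * x := by
  ext1
  · simp only [mul_lam, cupClass_comm φ x.psi y.psi, mul_comm x.a y.a]
    abel
  · simp only [mul_psi, mul_comm x.a y.a, mul_comm x.psi y.psi]
  · simp only [mul_a, add_comm]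

protected lemma one_mul (x : TwistedProduct φ) : 1 * x = x := by
  ext1 <;> simp

protected lemma mul_assoc (x y z : TwistedProduct φ) : x * y * z = x * (y * z) := by
  obtain ⟨l, ψ, a⟩ := x
  obtain ⟨m, χ, b⟩ := y
  obtain ⟨n, θ, c⟩ := z
  ext1
  · simp only [mul_lam, mul_psi, mul_a]
    rcases zmod_two_eq a with rfl | rfl <;> rcases zmod_two_eq b with rfl | rfl <;>
      rcases zmod_two_eq c with rfl | rfl <;>
      simp only [mul_zero, mul_one, add_zero, zero_add, zmod_two_one_add_one,
        zmod_two_val_one, ZMod.val_zero, pow_zero, pow_one, cupClass_mul_left, cupClass_mul_right,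
        cupClass_one_right, cupClass_comm φ φ] <;> abel
  · simp only [mul_psi, mul_a]
    have key : ∀ a b c s t u v : ZMod 2,
        s + t + (a * b) * v + u + ((a + b) * c) * v =
          s + (t + u + (b * c) * v) + (a * (b + c)) * v := by decide
    have hp : ∀ (s : ZMod 2) (g : G), ((φ ^ s.val) g).toAdd = s * (φ g).toAdd := by
      intro s g
      rcases zmod_two_eq s with rfl | rfl <;> simp [zmod_two_val_one]
    ext g
    apply Multiplicative.toAdd.injective
    simp only [MonoidHom.mul_apply, toAdd_mul, hp]
    exact key _ _ _ _ _ _ _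
  · exact add_assoc _ _ _

instance : Inv (TwistedProduct φ) where
  inv x :=
    { lam := -(cupClass φ x.psi (x.psi * φ ^ (x.a * x.a).val) +
        cupClass φ x.psi (φ ^ (x.a * x.a).val) +
        cupClass φ (x.psi * φ ^ (x.a * x.a).val) (φ ^ (x.a * x.a).val) + x.lam)
      psi := x.psi * φ ^ (x.a * x.a).val
      a := x.a }

protected lemma inv_mul_cancel (x : TwistedProduct φ) : x⁻¹ * x = 1 := by
  rw [TwistedProduct.mul_comm]
  ext1
  · change _ + _ + _ + _ + -(_ + _ + _ + _) = (0 : H2Phi φ)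
    exact add_neg_cancel _
  · change x.psi * (x.psi * φ ^ (x.a * x.a).val) * φ ^ (x.a * x.a).val = 1
    have : ∀ s t : ZMod 2, s + (s + t) + t = 0 := by decide
    ext g
    exact this (x.psi g).toAdd ((φ ^ (x.a * x.a).val) g).toAdd
  · change x.a + x.a = 0
    have : ∀ s : ZMod 2, s + s = 0 := by decide
    exact this _

/-- The twisted product is an abelian group. -/
instance : CommGroup (TwistedProduct φ) where
  mul_assoc := TwistedProduct.mul_assoc
  one_mul := TwistedProduct.one_mul
  mul_one x := by rw [TwistedProduct.mul_comm, TwistedProduct.one_mul]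
  inv_mul_cancel := TwistedProduct.inv_mul_cancel
  mul_comm := TwistedProduct.mul_comm

end TwistedProduct

/-! ### Magnetic equivariant graded algebras -/

/-- A finite-dimensional `ℤ/2`-graded `ℂ`-algebra with an action of the magnetic group `(G, φ)`:
each `g` acts by a ring automorphism which preserves the grading and is `ℂ`-linear or
`ℂ`-antilinear according to `φ g`. -/
structure MagAlg (φ : G →* Multiplicative (ZMod 2)) where
  /-- the underlying type -/
  carrier : Type
  [ring : Ring carrier]
  [algebra : Algebra ℂ carrier]
  [finite : FiniteDimensional ℂ carrier]
  /-- the homogeneous components -/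
  grading : ZMod 2 → Submodule ℂ carrier
  [gradedAlgebra : GradedAlgebra grading]
  /-- the action of `G` -/
  act : G →* RingAut carrier
  act_smul : ∀ g (z : ℂ) a, act g (z • a) = conjPow φ g z • act g a
  act_mem : ∀ g i a, a ∈ grading i → act g a ∈ grading i

attribute [instance] MagAlg.ring MagAlg.algebra MagAlg.finite MagAlg.gradedAlgebra

/-- Two submodules indexed by `ℤ/2`, compatible with the multiplication, which together span `A`
and are contained in the two eigenspaces of a linear involution, make `A` a graded algebra. -/
@[reducible] def gradedAlgebraOfParity {A : Type} [Ring A] [Algebra ℂ A]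
    (𝒜 : ZMod 2 → Submodule ℂ A) [SetLike.GradedMonoid 𝒜] (γ : A →ₗ[ℂ] A)
    (h₀ : ∀ a ∈ 𝒜 0, γ a = a) (h₁ : ∀ a ∈ 𝒜 1, γ a = -a) (h : ∀ a, a ∈ 𝒜 0 ⊔ 𝒜 1) :
    GradedAlgebra 𝒜 :=
  have hint : DirectSum.IsInternal 𝒜 := by
    rw [DirectSum.isInternal_submodule_iff_isCompl 𝒜 (i := 0) (j := 1) (by decide)
      (by ext s; simpa using zmod_two_eq s)]
    refine ⟨?_, ?_⟩
    · rw [Submodule.disjoint_def]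
      intro a ha hb
      have h2 : a = -a := (h₀ a ha).symm.trans (h₁ a hb)
      have h3 : (2 : ℂ) • a = 0 := by rw [two_smul, ← sub_neg_eq_add, ← h2, sub_self]
      exact (smul_eq_zero.mp h3).resolve_left two_ne_zero
    · rw [codisjoint_iff, eq_top_iff]
      exact fun a _ => h a
  { hint.chooseDecomposition with }

/-! ### Graded projective representations and their endomorphism algebras -/

/-- A nonzero finite-dimensional `ℤ/2`-graded complex vector space `V = V₀ ⊕ V₁` with a magnetic
projective representation of `(G, φ)` with factor set `c` which preserves `V₀` and `V₁`:
each `g` acts by an additive bijection `ρ(g)` that is `ℂ`-linear or `ℂ`-antilinear according to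
`φ g`, and `ρ(g) ρ(h) = c(g, h) ρ(gh)`. Equivalently, this is a graded magnetic representation of
the extension of `G` by `ℂ*` defined by `c`, where `ℂ*` acts by scalar multiplication. -/
structure MagProjRep (φ : G →* Multiplicative (ZMod 2)) (c : G × G → CUnits φ) where
  /-- the underlying type -/
  carrier : Type
  [addCommGroup : AddCommGroup carrier]
  [module : Module ℂ carrier]
  [finite : FiniteDimensional ℂ carrier]
  [nontrivial : Nontrivial carrier]
  /-- the homogeneous components -/
  grading : ZMod 2 → Submodule ℂ carrier
  isInternal : DirectSum.IsInternal grading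
  /-- the maps `ρ(g)` -/
  act : G → carrier ≃+ carrier
  act_smul : ∀ g (z : ℂ) v, act g (z • v) = conjPow φ g z • act g v
  act_mem : ∀ g i v, v ∈ grading i → act g v ∈ grading i
  act_act : ∀ g h v, act g (act h v) = (c (g, h)).val • act (g * h) v

attribute [instance] MagProjRep.addCommGroup MagProjRep.module MagProjRep.finite
  MagProjRep.nontrivial

/-- A nonzero graded magnetic representation `V₀ ⊕ V₁` of `(G, φ)`: the case of the trivial
factor set, where `g ↦ ρ(g)` is a homomorphism. -/
abbrev MagRep (φ : G →* Multiplicative (ZMod 2)) := MagProjRep φ (fun _ => 1)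

namespace MagProjRep

variable {φ : G →* Multiplicative (ZMod 2)} {c : G × G → CUnits φ} (V : MagProjRep φ c)

/-- The representation is concentrated in degree `0`, i.e. it is just an ungraded magnetic
projective representation. -/
def IsUngraded : Prop := V.grading 0 = ⊤

lemma isCompl : IsCompl (V.grading 0) (V.grading 1) :=
  V.isInternal.isCompl (by decide) (by ext s; simpa using zmod_two_eq s)

lemma act_symm_smul (g : G) (z : ℂ) (v : V.carrier) :
    (V.act g).symm (z • v) = conjPow φ g z • (V.act g).symm v := by
  rw [AddEquiv.symm_apply_eq, V.act_smul]
  simp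

/-- The homogeneous endomorphisms of degree `i`: those that map `V_j` to `V_{i+j}`. -/
def endGrading (i : ZMod 2) : Submodule ℂ (Module.End ℂ V.carrier) where
  carrier := {f | ∀ j, ∀ v ∈ V.grading j, f v ∈ V.grading (i + j)}
  add_mem' hf hg j v hv := add_mem (hf j v hv) (hg j v hv)
  zero_mem' _ _ _ := zero_mem _
  smul_mem' z _ hf j v hv := Submodule.smul_mem _ z (hf j v hv)

instance : SetLike.GradedMonoid V.endGrading where
  one_mem j v hv := by simpa using hv
  mul_mem i k f g hf hg j v hv := by
    rw [add_assoc]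
    exact hf _ _ (hg _ _ hv)

/-- The linear map that is `1` on `V₀` and `-1` on `V₁`. -/
def parity : Module.End ℂ V.carrier :=
  (V.grading 0).subtype ∘ₗ Submodule.projectionOnto _ _ V.isCompl -
    (V.grading 1).subtype ∘ₗ Submodule.projectionOnto _ _ V.isCompl.symm

lemma parity_zero {v : V.carrier} (hv : v ∈ V.grading 0) : V.parity v = v := by
  have h1 := Submodule.projectionOnto_apply_left V.isCompl ⟨v, hv⟩
  have h2 := Submodule.projectionOnto_apply_right V.isCompl.symm ⟨v, hv⟩
  simp only at h1 h2
  simp [parity, h1, h2]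

lemma parity_one {v : V.carrier} (hv : v ∈ V.grading 1) : V.parity v = -v := by
  have h1 := Submodule.projectionOnto_apply_left V.isCompl.symm ⟨v, hv⟩
  have h2 := Submodule.projectionOnto_apply_right V.isCompl ⟨v, hv⟩
  simp only at h1 h2
  simp [parity, h1, h2]

lemma exists_add (v : V.carrier) : ∃ x ∈ V.grading 0, ∃ y ∈ V.grading 1, x + y = v :=
  Submodule.mem_sup.mp (V.isCompl.sup_eq_top ▸ Submodule.mem_top)

lemma add_parity_mem (v : V.carrier) : v + V.parity v ∈ V.grading 0 := by
  obtain ⟨x, hx, y, hy, rfl⟩ := V.exists_add v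
  rw [map_add, V.parity_zero hx, V.parity_one hy]
  have : x + y + (x + -y) = x + x := by abel
  rw [this]
  exact add_mem hx hx

lemma sub_parity_mem (v : V.carrier) : v - V.parity v ∈ V.grading 1 := by
  obtain ⟨x, hx, y, hy, rfl⟩ := V.exists_add v
  rw [map_add, V.parity_zero hx, V.parity_one hy]
  have : x + y - (x + -y) = y + y := by abel
  rw [this]
  exact add_mem hy hy

instance : GradedAlgebra V.endGrading :=
  gradedAlgebraOfParity V.endGrading
    (LinearMap.mulLeft ℂ V.parity ∘ₗ LinearMap.mulRight ℂ V.parity)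
    (by
      intro f hf
      ext v
      obtain ⟨x, hx, y, hy, rfl⟩ := V.exists_add v
      have h0 := hf 0 x hx
      have h1 := hf 1 y hy
      rw [zero_add] at h0 h1
      simp [V.parity_zero hx, V.parity_one hy, V.parity_zero h0, V.parity_one h1])
    (by
      intro f hf
      ext v
      obtain ⟨x, hx, y, hy, rfl⟩ := V.exists_add v
      have h0 := hf 0 x hx
      have h1 := hf 1 y hy
      rw [add_zero] at h0
      rw [zmod_two_one_add_one] at h1
      simp [V.parity_zero hx, V.parity_one hy, V.parity_one h0, V.parity_zero h1, add_comm])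
    (by
      intro f
      have hf : f = (1 / 2 : ℂ) • (f + V.parity * (f * V.parity)) +
          (1 / 2 : ℂ) • (f - V.parity * (f * V.parity)) := by
        module
      rw [hf]
      refine Submodule.add_mem_sup (Submodule.smul_mem _ _ ?_) (Submodule.smul_mem _ _ ?_)
      · intro j v hv
        rcases zmod_two_eq j with rfl | rfl
        · simpa [V.parity_zero hv] using V.add_parity_mem (f v)
        · simpa [V.parity_one hv, sub_eq_add_neg] using V.sub_parity_mem (f v)
      · intro j v hv
        rcases zmod_two_eq j with rfl | rfl
        · simpa [V.parity_zero hv] using V.sub_parity_mem (f v)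
        · simpa [V.parity_one hv, zmod_two_one_add_one] using V.add_parity_mem (f v))

/-- The conjugation `f ↦ ρ(g) f ρ(g)⁻¹`. -/
def conjEnd (g : G) : RingAut (Module.End ℂ V.carrier) where
  toFun f :=
    { toFun := fun v => V.act g (f ((V.act g).symm v))
      map_add' := fun v w => by simp
      map_smul' := fun z v => by simp [V.act_symm_smul, V.act_smul] }
  invFun f :=
    { toFun := fun v => (V.act g).symm (f (V.act g v))
      map_add' := fun v w => by simp
      map_smul' := fun z v => by simp [V.act_symm_smul, V.act_smul] }
  left_inv f := by ext v; simp
  right_inv f := by ext v; simp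
  map_mul' f f' := by ext v; simp
  map_add' f f' := by ext v; simp

@[simp] lemma conjEnd_apply (g : G) (f : Module.End ℂ V.carrier) (v : V.carrier) :
    V.conjEnd g f v = V.act g (f ((V.act g).symm v)) := rfl

lemma conjEnd_mul (g h : G) : V.conjEnd (g * h) = V.conjEnd g * V.conjEnd h := by
  ext f v
  obtain ⟨u, rfl⟩ := (V.act g).surjective v
  obtain ⟨w, rfl⟩ := (V.act h).surjective u
  change V.act (g * h) (f ((V.act (g * h)).symm (V.act g (V.act h w)))) =
    V.act g (V.act h (f ((V.act h).symm ((V.act g).symm (V.act g (V.act h w))))))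
  rw [AddEquiv.symm_apply_apply, AddEquiv.symm_apply_apply, V.act_act, V.act_act,
    V.act_symm_smul, AddEquiv.symm_apply_apply, map_smul, V.act_smul, conjPow_conjPow]

/-- The graded algebra `End(V) = End(V₀, V₁)` with the action of `(G, φ)` by conjugation. -/
def endAlg : MagAlg φ where
  carrier := Module.End ℂ V.carrier
  grading := V.endGrading
  act := MonoidHom.mk' V.conjEnd V.conjEnd_mul
  act_smul g z f := by
    ext v
    change V.act g ((z • f) _) = conjPow φ g z • V.act g (f _)
    rw [LinearMap.smul_apply, V.act_smul]
  act_mem g i f hf j v hv := by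
    have key : ∀ k w, w ∈ V.grading k → (V.act g).symm w ∈ V.grading k := by
      intro k w hw
      have h1 : V.act g⁻¹ (V.act g ((V.act g).symm w)) = V.act g⁻¹ w := by simp
      have h2 : V.act (1 : G) ((V.act 1).symm ((V.act g).symm w)) ∈ V.grading k := by
        have h3 := V.act_act 1 1 ((V.act 1).symm ((V.act g).symm w))
        rw [mul_one, AddEquiv.apply_symm_apply] at h3
        have h4 : V.act (1 : G) ((V.act g).symm w) ∈ V.grading k := by
          rw [V.act_act, inv_mul_cancel] at h1
          have h5 := V.act_mem g⁻¹ k w hw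
          rw [← h1] at h5
          exact (Submodule.smul_mem_iff _ (Units.ne_zero _)).mp h5
        rw [h3] at h4
        rw [AddEquiv.apply_symm_apply]
        exact (Submodule.smul_mem_iff _ (Units.ne_zero _)).mp h4
      rwa [AddEquiv.apply_symm_apply] at h2
    exact V.act_mem g _ _ (hf j _ (key j v hv))

end MagProjRep

/-! ### The graded tensor product -/

namespace MagAlg

variable {φ : G →* Multiplicative (ZMod 2)}

/-- The action of `g`, as a `𝕂^{φ(g)}`-semilinear map. -/
def actLin (A : MagAlg φ) (g : G) : A.carrier →ₛₗ[conjPow φ g] A.carrier where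
  toFun := A.act g
  map_add' := map_add (A.act g)
  map_smul' := A.act_smul g

/-- The linear map that is `1` on `A₀` and `-1` on `A₁`. -/
def parity (A : MagAlg φ) : A.carrier →ₗ[ℂ] A.carrier :=
  GradedAlgebra.proj A.grading 0 - GradedAlgebra.proj A.grading 1

lemma parity_of_mem (A : MagAlg φ) {i : ZMod 2} {a : A.carrier} (ha : a ∈ A.grading i) :
    A.parity a = (sgn i : ℂ) • a := by
  rcases zmod_two_eq i with rfl | rfl
  · simp [parity, GradedAlgebra.proj_apply, DirectSum.decompose_of_mem_same _ ha,
      DirectSum.decompose_of_mem_ne _ ha (zero_ne_one)]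
  · simp [parity, GradedAlgebra.proj_apply, DirectSum.decompose_of_mem_same _ ha,
      DirectSum.decompose_of_mem_ne _ ha (one_ne_zero)]

variable (A B : MagAlg φ)

/-- The underlying algebra of `A ⊗̂ B`: the tensor product over `ℂ` with the product
`(a ⊗ b)(a' ⊗ b') = (-1)^{∂a' ∂b} aa' ⊗ bb'`. -/
abbrev tensorCarrier : Type := A.grading ᵍ⊗[ℂ] B.grading

/-- The component of degree `k` of `A ⊗̂ B` is the sum of the `A_i ⊗ B_j` with `i + j = k`. -/
def tensorGrading (k : ZMod 2) : Submodule ℂ (tensorCarrier A B) :=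
  Submodule.span ℂ {x | ∃ i j, i + j = k ∧ ∃ a ∈ A.grading i, ∃ b ∈ B.grading j,
    x = GradedTensorProduct.tmul ℂ a b}

variable {A B} in
lemma tmul_mem {i j k : ZMod 2} (h : i + j = k) {a : A.carrier} {b : B.carrier}
    (ha : a ∈ A.grading i) (hb : b ∈ B.grading j) :
    (GradedTensorProduct.tmul ℂ a b : tensorCarrier A B) ∈ tensorGrading A B k :=
  Submodule.subset_span ⟨i, j, h, a, ha, b, hb, rfl⟩

variable {A B} in
lemma tmul_mul_tmul {j i : ZMod 2} (a : A.carrier) {b : B.carrier} (hb : b ∈ B.grading j)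
    {a' : A.carrier} (ha' : a' ∈ A.grading i) (b' : B.carrier) :
    (GradedTensorProduct.tmul ℂ a b * GradedTensorProduct.tmul ℂ a' b' : tensorCarrier A B) =
      (-1 : ℤˣ) ^ (j * i) • GradedTensorProduct.tmul ℂ (a * a') (b * b') :=
  GradedTensorProduct.tmul_coe_mul_coe_tmul A.grading B.grading a ⟨b, hb⟩ ⟨a', ha'⟩ b'

lemma units_smul_mem {M : Type} [AddCommGroup M] [Module ℂ M] (p : Submodule ℂ M) (u : ℤˣ)
    {x : M} (hx : x ∈ p) : u • x ∈ p := by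
  rcases Int.units_eq_one_or u with rfl | rfl
  · simpa using hx
  · simpa [Units.smul_def] using hx

instance : SetLike.GradedMonoid (tensorGrading A B) where
  one_mem := tmul_mem (add_zero 0) SetLike.GradedOne.one_mem SetLike.GradedOne.one_mem
  mul_mem k l x y hx hy := by
    induction hx using Submodule.span_induction with
    | zero => rw [zero_mul]; exact zero_mem _
    | add x₁ x₂ _ _ h₁ h₂ => rw [add_mul]; exact add_mem h₁ h₂
    | smul z x _ h => rw [smul_mul_assoc]; exact Submodule.smul_mem _ z h
    | mem x hx =>
      obtain ⟨i, j, hk, a, ha, b, hb, rfl⟩ := hx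
      induction hy using Submodule.span_induction with
      | zero => rw [mul_zero]; exact zero_mem _
      | add x₁ x₂ _ _ h₁ h₂ => rw [mul_add]; exact add_mem h₁ h₂
      | smul z x _ h => rw [mul_smul_comm]; exact Submodule.smul_mem _ z h
      | mem y hy =>
        obtain ⟨i', j', hl, a', ha', b', hb', rfl⟩ := hy
        rw [tmul_mul_tmul a hb ha' b']
        refine units_smul_mem _ _ (tmul_mem ?_ (SetLike.mul_mem_graded ha ha')
          (SetLike.mul_mem_graded hb hb'))
        rw [← hk, ← hl]
        ring

lemma exists_add (a : A.carrier) : ∃ x ∈ A.grading 0, ∃ y ∈ A.grading 1, x + y = a := by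
  have h := ((DirectSum.Decomposition.isInternal A.grading).isCompl (i := 0) (j := 1)
    (by decide) (by ext s; simpa using zmod_two_eq s)).sup_eq_top
  exact Submodule.mem_sup.mp (h ▸ Submodule.mem_top)

variable {A B} in
/-- An additive property that holds on the products of homogeneous elements holds on the whole
tensor product. -/
lemma tensor_induction {P : tensorCarrier A B → Prop}
    (hadd : ∀ x y, P x → P y → P (x + y))
    (hmul : ∀ i j, ∀ a ∈ A.grading i, ∀ b ∈ B.grading j, P (GradedTensorProduct.tmul ℂ a b))
    (x : tensorCarrier A B) : P x := by
  have key : ∀ y : A.carrier ⊗[ℂ] B.carrier, P (GradedTensorProduct.of ℂ A.grading B.grading y) := by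
    intro y
    induction y using TensorProduct.induction_on with
    | zero =>
      have := hmul 0 0 0 (zero_mem _) 0 (zero_mem _)
      simpa [GradedTensorProduct.tmul] using this
    | add y z hy hz => rw [map_add]; exact hadd _ _ hy hz
    | tmul a b =>
      obtain ⟨x, hx, y, hy, rfl⟩ := A.exists_add a
      obtain ⟨z, hz, w, hw, rfl⟩ := B.exists_add b
      rw [TensorProduct.add_tmul, TensorProduct.tmul_add, TensorProduct.tmul_add, map_add, map_add,
        map_add]
      exact hadd _ _ (hadd _ _ (hmul _ _ _ hx _ hz) (hmul _ _ _ hx _ hw))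
        (hadd _ _ (hmul _ _ _ hy _ hz) (hmul _ _ _ hy _ hw))
  exact key x

/-- The map `A ⊗̂ B → A ⊗̂ B` given by the parity maps of the factors. -/
def tensorParity : tensorCarrier A B →ₗ[ℂ] tensorCarrier A B :=
  (GradedTensorProduct.of ℂ A.grading B.grading).toLinearMap ∘ₗ
    TensorProduct.map A.parity B.parity ∘ₗ
      (GradedTensorProduct.of ℂ A.grading B.grading).symm.toLinearMap

lemma tensorParity_of_mem {k : ZMod 2} {x : tensorCarrier A B} (hx : x ∈ tensorGrading A B k) :
    tensorParity A B x = (sgn k : ℂ) • x := by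
  induction hx using Submodule.span_induction with
  | zero => simp
  | add x₁ x₂ _ _ h₁ h₂ => rw [map_add, h₁, h₂, smul_add]
  | smul z x _ h => rw [map_smul, h, smul_comm]
  | mem x hx =>
    obtain ⟨i, j, rfl, a, ha, b, hb, rfl⟩ := hx
    change GradedTensorProduct.of ℂ A.grading B.grading (A.parity a ⊗ₜ B.parity b) = _
    rw [A.parity_of_mem ha, B.parity_of_mem hb, TensorProduct.smul_tmul_smul, map_smul, sgn_add,
      Units.val_mul]

instance : GradedAlgebra (tensorGrading A B) :=
  gradedAlgebraOfParity (tensorGrading A B) (tensorParity A B)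
    (fun x hx => by simpa using tensorParity_of_mem A B hx)
    (fun x hx => by simpa using tensorParity_of_mem A B hx)
    (fun x => by
      refine tensor_induction (fun x y => add_mem) (fun i j a ha b hb => ?_) x
      have h := tmul_mem (k := i + j) rfl ha hb
      rcases zmod_two_eq (i + j) with h' | h' <;> rw [h'] at h
      · exact Submodule.mem_sup_left h
      · exact Submodule.mem_sup_right h)

/-- The map `a ⊗ b ↦ ga ⊗ gb`. -/
def tensorActFun (g : G) : tensorCarrier A B →+ tensorCarrier A B :=
  (GradedTensorProduct.of ℂ A.grading B.grading).toLinearMap.toAddMonoidHom.comp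
    ((TensorProduct.map (A.actLin g) (B.actLin g)).toAddMonoidHom.comp
      (GradedTensorProduct.of ℂ A.grading B.grading).symm.toLinearMap.toAddMonoidHom)

variable {A B} in
lemma tensorActFun_tmul (g : G) (a : A.carrier) (b : B.carrier) :
    tensorActFun A B g (GradedTensorProduct.tmul ℂ a b) =
      GradedTensorProduct.tmul ℂ (A.act g a) (B.act g b) := rfl

lemma tensorActFun_smul (g : G) (z : ℂ) (x : tensorCarrier A B) :
    tensorActFun A B g (z • x) = conjPow φ g z • tensorActFun A B g x :=
  (TensorProduct.map (A.actLin g) (B.actLin g)).map_smulₛₗ z x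

lemma tensorActFun_one : tensorActFun A B 1 = AddMonoidHom.id _ := by
  ext x
  refine tensor_induction (P := fun x => tensorActFun A B 1 x = x) (fun x y hx hy => ?_)
    (fun i j a _ b _ => ?_) x
  · rw [map_add, hx, hy]
  · simp [tensorActFun_tmul]

lemma tensorActFun_comp (g h : G) :
    tensorActFun A B (g * h) = (tensorActFun A B g).comp (tensorActFun A B h) := by
  ext x
  refine tensor_induction (P := fun x => tensorActFun A B (g * h) x =
    tensorActFun A B g (tensorActFun A B h x)) (fun x y hx hy => ?_) (fun i j a _ b _ => ?_) x
  · simp only [map_add, hx, hy]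
  · simp [tensorActFun_tmul]

lemma tensorActFun_mul (g : G) (x y : tensorCarrier A B) :
    tensorActFun A B g (x * y) = tensorActFun A B g x * tensorActFun A B g y := by
  refine tensor_induction (P := fun x => tensorActFun A B g (x * y) = _ * _)
    (fun x x' hx hx' => ?_) (fun i j a ha b hb => ?_) x
  · rw [add_mul, map_add, map_add, add_mul, hx, hx']
  · refine tensor_induction (P := fun y => tensorActFun A B g (_ * y) = _ * _)
      (fun y y' hy hy' => ?_) (fun i' j' a' ha' b' hb' => ?_) y
    · rw [mul_add, map_add, map_add, mul_add, hy, hy']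
    · rw [tmul_mul_tmul a hb ha' b', tensorActFun_tmul, tensorActFun_tmul,
        tmul_mul_tmul _ (B.act_mem g _ _ hb) (A.act_mem g _ _ ha') _, Units.smul_def, map_zsmul,
        tensorActFun_tmul, map_mul, map_mul, Units.smul_def]

/-- The action of `g` on `A ⊗̂ B`. -/
def tensorAct (g : G) : RingAut (tensorCarrier A B) where
  toFun := tensorActFun A B g
  invFun := tensorActFun A B g⁻¹
  left_inv x := by
    rw [← AddMonoidHom.comp_apply, ← tensorActFun_comp, inv_mul_cancel, tensorActFun_one]; rfl
  right_inv x := by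
    rw [← AddMonoidHom.comp_apply, ← tensorActFun_comp, mul_inv_cancel, tensorActFun_one]; rfl
  map_mul' := tensorActFun_mul A B g
  map_add' := map_add (tensorActFun A B g)

/-- The graded tensor product `A ⊗̂ B`, with the action `g(a ⊗ b) = ga ⊗ gb`. -/
def tensor : MagAlg φ where
  carrier := tensorCarrier A B
  finite := Module.Finite.equiv (GradedTensorProduct.of ℂ A.grading B.grading)
  grading := tensorGrading A B
  act := MonoidHom.mk' (tensorAct A B) fun g h => by
    ext x
    exact DFunLike.congr_fun (tensorActFun_comp A B g h) x
  act_smul := tensorActFun_smul A B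
  act_mem g k x hx := by
    change tensorActFun A B g x ∈ _
    induction hx using Submodule.span_induction with
    | zero => rw [map_zero]; exact zero_mem _
    | add x₁ x₂ _ _ h₁ h₂ => rw [map_add]; exact add_mem h₁ h₂
    | smul z x _ h => rw [tensorActFun_smul]; exact Submodule.smul_mem _ _ h
    | mem x hx =>
      obtain ⟨i, j, h, a, ha, b, hb, rfl⟩ := hx
      rw [tensorActFun_tmul]
      exact tmul_mem h (A.act_mem g i a ha) (B.act_mem g j b hb)

scoped infixl:70 " ⊗̂ " => MagAlg.tensor

/-! ### Isomorphisms, central simple graded algebras, similarity -/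

/-- An isomorphism of graded algebras which is `G`-equivariant. -/
structure Iso where
  /-- the underlying isomorphism of algebras -/
  toAlgEquiv : A.carrier ≃ₐ[ℂ] B.carrier
  map_mem : ∀ i a, a ∈ A.grading i → toAlgEquiv a ∈ B.grading i
  map_act : ∀ g a, toAlgEquiv (A.act g a) = B.act g (toAlgEquiv a)

/-- The graded center: the span of the homogeneous elements `a` such that `ab = (-1)^{∂a ∂b} ba` for
all homogeneous elements `b`. -/
def gradedCenter : Submodule ℂ A.carrier :=
  Submodule.span ℂ {a | ∃ i, a ∈ A.grading i ∧
    ∀ j, ∀ b ∈ A.grading j, a * b = (sgn (i * j) : ℂ) • (b * a)}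

/-- `A` is a central simple graded algebra over `ℂ`: it is nonzero, it has no two-sided graded
ideals besides `0` and `A`, and its graded center is `ℂ`. -/
structure IsCentralSimple : Prop where
  nontrivial : Nontrivial A.carrier
  simple : ∀ I : Ideal A.carrier, I.IsTwoSided → I.IsHomogeneous A.grading → I = ⊥ ∨ I = ⊤
  central : A.gradedCenter = LinearMap.range (Algebra.linearMap ℂ A.carrier)

end MagAlg

open MagAlg

/-- Magnetic `(G, φ)`-equivariant central simple graded algebras over `ℂ`. -/
def MECSGA (φ : G →* Multiplicative (ZMod 2)) := {A : MagAlg φ // A.IsCentralSimple}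

/-- `A` and `B` are similar if `A ⊗̂ End(V₀, V₁) ≅ B ⊗̂ End(W₀, W₁)` as graded algebras with action
of `(G, φ)`, for some nonzero graded magnetic representations `V` and `W`. -/
def Similar {φ : G →* Multiplicative (ZMod 2)} (A B : MECSGA φ) : Prop :=
  ∃ V W : MagRep φ, Nonempty (Iso (A.1 ⊗̂ V.endAlg) (B.1 ⊗̂ W.endAlg))

/-- The magnetic equivariant graded Brauer group `GrBr_{(G,φ)}(ℂ)`, as a set: the similarity
classes of magnetic equivariant central simple graded algebras. -/
def GrBr (φ : G →* Multiplicative (ZMod 2)) : Type 1 := Quot (Similar (φ := φ))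

/-- The similarity class of a magnetic equivariant central simple graded algebra. -/
def GrBr.mk {φ : G →* Multiplicative (ZMod 2)} (A : MagAlg φ) (hA : A.IsCentralSimple) : GrBr φ :=
  Quot.mk _ ⟨A, hA⟩

/-! ### The algebras `σ(ψ)` and `α(a)` -/

/-- The matrix `((0, 1), (1, 0))^s`, for `s : ℤ/2`. It is its own inverse. -/
def swapPow (s : ZMod 2) : Matrix (Fin 2) (Fin 2) ℂ := !![0, 1; 1, 0] ^ s.val

lemma swapPow_add (s t : ZMod 2) : swapPow (s + t) = swapPow s * swapPow t := by
  have h : (!![0, 1; 1, 0] : Matrix (Fin 2) (Fin 2) ℂ) * !![0, 1; 1, 0] = 1 := by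
    ext i j; fin_cases i <;> fin_cases j <;> simp
  rcases zmod_two_eq s with rfl | rfl <;> rcases zmod_two_eq t with rfl | rfl <;>
    simp [swapPow, zmod_two_one_add_one, zmod_two_val_one, h]

lemma swapPow_mul_self (s : ZMod 2) : swapPow s * swapPow s = 1 := by
  rw [← swapPow_add, show s + s = 0 by revert s; decide]
  simp [swapPow]

section sigma

variable (φ ψ : G →* Multiplicative (ZMod 2))

lemma swapPow_map (g : G) (s : ZMod 2) : (swapPow s).map (conjPow φ g) = swapPow s := by
  rcases zmod_two_eq s with rfl | rfl
  · simp [swapPow]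
  · ext i j
    fin_cases i <;> fin_cases j <;> simp [swapPow, zmod_two_val_one]

/-- The grading of `M_{1|1}(ℂ)`: diagonal matrices are even, antidiagonal matrices are odd. -/
def sigmaGrading (i : ZMod 2) : Submodule ℂ (Matrix (Fin 2) (Fin 2) ℂ) where
  carrier := {M | ∀ k l : Fin 2, ((k : ℕ) : ZMod 2) ≠ i + ((l : ℕ) : ZMod 2) → M k l = 0}
  add_mem' hM hN k l h := by simp [hM k l h, hN k l h]
  zero_mem' _ _ _ := rfl
  smul_mem' z _ hM k l h := by simp [hM k l h]

lemma mem_sigmaGrading_zero {M : Matrix (Fin 2) (Fin 2) ℂ} :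
    M ∈ sigmaGrading 0 ↔ M 0 1 = 0 ∧ M 1 0 = 0 := by
  refine ⟨fun h => ⟨h 0 1 (by simp), h 1 0 (by simp)⟩, fun h k l hkl => ?_⟩
  fin_cases k <;> fin_cases l <;> simp_all

lemma mem_sigmaGrading_one {M : Matrix (Fin 2) (Fin 2) ℂ} :
    M ∈ sigmaGrading 1 ↔ M 0 0 = 0 ∧ M 1 1 = 0 := by
  refine ⟨fun h => ⟨h 0 0 (by simp), h 1 1 (by simp)⟩, fun h k l hkl => ?_⟩
  fin_cases k <;> fin_cases l <;> simp_all [zmod_two_one_add_one]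

instance : SetLike.GradedMonoid sigmaGrading where
  one_mem := by rw [mem_sigmaGrading_zero]; simp
  mul_mem i j M N hM hN := by
    intro k l hkl
    rw [Matrix.mul_apply]
    refine Finset.sum_eq_zero fun m _ => ?_
    by_cases h1 : ((k : ℕ) : ZMod 2) = i + ((m : ℕ) : ZMod 2)
    · by_cases h2 : ((m : ℕ) : ZMod 2) = j + ((l : ℕ) : ZMod 2)
      · exact absurd (by rw [h1, h2, add_assoc]) hkl
      · rw [hN m l h2, mul_zero]
    · rw [hM k m h1, zero_mul]

instance : GradedAlgebra sigmaGrading :=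
  gradedAlgebraOfParity sigmaGrading
    (LinearMap.mulLeft ℂ !![1, 0; 0, -1] ∘ₗ LinearMap.mulRight ℂ !![1, 0; 0, -1])
    (by
      intro M hM
      rw [mem_sigmaGrading_zero] at hM
      ext i j
      fin_cases i <;> fin_cases j <;> simp [Matrix.mul_apply, hM])
    (by
      intro M hM
      rw [mem_sigmaGrading_one] at hM
      ext i j
      fin_cases i <;> fin_cases j <;> simp [Matrix.mul_apply, hM])
    (by
      intro M
      refine Submodule.mem_sup.mpr ⟨!![M 0 0, 0; 0, M 1 1], by simp [mem_sigmaGrading_zero],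
        !![0, M 0 1; M 1 0, 0], by simp [mem_sigmaGrading_one], ?_⟩
      ext i j
      fin_cases i <;> fin_cases j <;> simp)

/-- The map `M ↦ J^{ψ(g)} (𝕂^{φ(g)} M) J^{-ψ(g)}`, where `J = ((0, 1), (1, 0)) = J⁻¹` and `𝕂` is the
entrywise complex conjugation. -/
def sigmaActFun (g : G) (M : Matrix (Fin 2) (Fin 2) ℂ) : Matrix (Fin 2) (Fin 2) ℂ :=
  swapPow (ψ g).toAdd * M.map (conjPow φ g) * swapPow (ψ g).toAdd

lemma sigmaActFun_mul (g h : G) (M : Matrix (Fin 2) (Fin 2) ℂ) :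
    sigmaActFun φ ψ (g * h) M = sigmaActFun φ ψ g (sigmaActFun φ ψ h M) := by
  have h1 : M.map (conjPow φ (g * h)) = (M.map (conjPow φ h)).map (conjPow φ g) := by
    ext i j
    exact conjPow_mul φ g h _
  simp only [sigmaActFun, Matrix.map_mul, swapPow_map, h1, map_mul, toAdd_mul]
  rw [swapPow_add]
  nth_rewrite 2 [← swapPow_add]
  rw [add_comm, swapPow_add]
  simp only [Matrix.mul_assoc]

lemma sigmaActFun_one (M : Matrix (Fin 2) (Fin 2) ℂ) : sigmaActFun φ ψ 1 M = M := by
  have h1 : M.map (conjPow φ 1) = M := by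
    ext i j
    exact conjPow_one φ _
  simp [sigmaActFun, h1, swapPow]

/-- The automorphism `Ad_{J^{ψ(g)} 𝕂^{φ(g)}}` of `M_{1|1}(ℂ)`. -/
def sigmaAct (g : G) : RingAut (Matrix (Fin 2) (Fin 2) ℂ) where
  toFun := sigmaActFun φ ψ g
  invFun := sigmaActFun φ ψ g⁻¹
  left_inv M := by rw [← sigmaActFun_mul, inv_mul_cancel, sigmaActFun_one]
  right_inv M := by rw [← sigmaActFun_mul, mul_inv_cancel, sigmaActFun_one]
  map_mul' M N := by
    have h : ∀ X Y : Matrix (Fin 2) (Fin 2) ℂ, swapPow (ψ g).toAdd * (X * Y) * swapPow (ψ g).toAdd =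
        swapPow (ψ g).toAdd * X * (swapPow (ψ g).toAdd * swapPow (ψ g).toAdd) * Y *
          swapPow (ψ g).toAdd := by
      intro X Y
      rw [swapPow_mul_self, Matrix.mul_one, Matrix.mul_assoc (swapPow (ψ g).toAdd) X Y]
    simp only [sigmaActFun, Matrix.map_mul]
    rw [h]
    simp only [Matrix.mul_assoc]
  map_add' M N := by
    have h : (M + N).map (conjPow φ g) = M.map (conjPow φ g) + N.map (conjPow φ g) := by
      ext i j
      exact map_add (conjPow φ g) (M i j) (N i j)
    simp only [sigmaActFun, h, Matrix.mul_add, Matrix.add_mul]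

/-- The algebra `σ(ψ)`: the graded algebra `M_{1|1}(ℂ)`, where `g` acts by
`Ad_{J^{ψ(g)} 𝕂^{φ(g)}}`. -/
def sigma : MagAlg φ where
  carrier := Matrix (Fin 2) (Fin 2) ℂ
  grading := sigmaGrading
  act := MonoidHom.mk' (sigmaAct φ ψ) fun g h => RingEquiv.ext (sigmaActFun_mul φ ψ g h)
  act_smul g z M := by
    change sigmaActFun φ ψ g (z • M) = conjPow φ g z • sigmaActFun φ ψ g M
    have h : (z • M).map (conjPow φ g) = conjPow φ g z • M.map (conjPow φ g) := by
      ext i j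
      exact map_mul (conjPow φ g) z (M i j)
    simp only [sigmaActFun, h, Matrix.mul_smul, Matrix.smul_mul]
  act_mem g i M hM := by
    change sigmaActFun φ ψ g M ∈ sigmaGrading i
    unfold sigmaActFun
    rcases zmod_two_eq i with rfl | rfl <;>
      rcases zmod_two_eq (ψ g).toAdd with h | h <;>
      simp only [mem_sigmaGrading_zero, mem_sigmaGrading_one] at hM ⊢ <;>
      simp [h, swapPow, zmod_two_val_one, hM, Matrix.mul_apply, Matrix.vecMul, dotProduct]

end sigma

section alpha

variable (φ : G →* Multiplicative (ZMod 2))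

/-- The grading of `ℂ` concentrated in degree `0`. -/
def trivialGrading (i : ZMod 2) : Submodule ℂ ℂ := if i = 0 then ⊤ else ⊥

instance : SetLike.GradedMonoid trivialGrading where
  one_mem := by simp [trivialGrading]
  mul_mem i j x y hx hy := by
    rcases zmod_two_eq i with rfl | rfl <;> rcases zmod_two_eq j with rfl | rfl <;>
      simp_all [trivialGrading]

instance : GradedAlgebra trivialGrading :=
  gradedAlgebraOfParity trivialGrading LinearMap.id (by simp) (by simp [trivialGrading])
    (by simp [trivialGrading])

/-- The algebra `ℂ` in degree `0`, where `g` acts by `𝕂^{φ(g)}`. -/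
def alphaZero : MagAlg φ where
  carrier := ℂ
  grading := trivialGrading
  act := MonoidHom.mk'
    (fun g => RingEquiv.ofRingHom (conjPow φ g) (conjPow φ g)
      (RingHom.ext fun z => conjPow_conjPow φ g z) (RingHom.ext fun z => conjPow_conjPow φ g z))
    fun g h => RingEquiv.ext (conjPow_mul φ g h)
  act_smul g z w := map_mul (conjPow φ g) z w
  act_mem g i z hz := by
    rcases zmod_two_eq i with rfl | rfl
    · simp [trivialGrading]
    · have : z = 0 := by simpa [trivialGrading] using hz
      rw [this, map_zero]
      exact zero_mem _

/-- The map `x + y e ↦ 𝕂^{φ(g)} x + (𝕂^{φ(g)} y) e` of `ℂ[e]/(e² - 1)`, which is the group algebra of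
`ℤ/2`. -/
def alphaActFun (g : G) : AddMonoidAlgebra ℂ (ZMod 2) →+* AddMonoidAlgebra ℂ (ZMod 2) :=
  AddMonoidAlgebra.mapRingHom (ZMod 2) (conjPow φ g)

lemma alphaActFun_conj (g : G) (x : AddMonoidAlgebra ℂ (ZMod 2)) :
    alphaActFun φ g (alphaActFun φ g x) = x := by
  ext m
  simp [alphaActFun]

/-- The graded algebra `ℂ[e]/(e² - 1)` with `e` of degree `1` (the group algebra of `ℤ/2`, with `e`
the nontrivial element of `ℤ/2`), where `g` acts by `𝕂^{φ(g)}` on the coefficients and fixes `e`. -/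
def alphaOne : MagAlg φ where
  carrier := AddMonoidAlgebra ℂ (ZMod 2)
  finite := Module.Finite.equiv (AddMonoidAlgebra.coeffLinearEquiv (M := ZMod 2) ℂ).symm
  grading := AddMonoidAlgebra.grade ℂ
  act := MonoidHom.mk'
    (fun g => RingEquiv.ofRingHom (alphaActFun φ g) (alphaActFun φ g)
      (RingHom.ext (alphaActFun_conj φ g)) (RingHom.ext (alphaActFun_conj φ g)))
    fun g h => by
      refine RingEquiv.ext fun x => ?_
      change alphaActFun φ (g * h) x = alphaActFun φ g (alphaActFun φ h x)
      ext m
      simp [alphaActFun, conjPow_mul]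
  act_smul g z x := by
    change alphaActFun φ g (z • x) = conjPow φ g z • alphaActFun φ g x
    ext m
    simp [alphaActFun]
  act_mem g i x hx := by
    change alphaActFun φ g x ∈ _
    rw [AddMonoidAlgebra.mem_grade_iff] at hx ⊢
    intro m hm
    apply hx
    rw [Finsupp.mem_support_iff] at hm ⊢
    intro h
    apply hm
    simp [alphaActFun, h]

/-- The algebra `α(a)`, for `a : ℤ/2`: `α(0) = ℂ` and `α(1) = ℂ[e]/(e² - 1)`. -/
def alpha (a : ZMod 2) : MagAlg φ := if a = 0 then alphaZero φ else alphaOne φ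

end alpha

end MagneticBrauer

end

open MagneticBrauer

noncomputable section

namespace MagneticBrauer

/-! ### Signs -/

/-! Every magnetic equivariant central simple graded algebra receives a type, an element of the
twisted product. Types exist, are unique, multiply under `⊗̂`, and are all realised by the standard
algebras; an algebra of type `1` is `End(V)` for a graded magnetic representation `V`. The theorem
follows formally from these facts.

Suppose first that the underlying algebra is a full matrix algebra. By Skolem–Noether the parity is
conjugation by an involution `Γ`, and each `g` acts by conjugation by a semilinear map `M_g
𝕂^{φ(g)}`; these are unique up to scalars. Since `M_g M_h` and `M_{gh}` (with `𝕂` understood)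
implement the same automorphism, they differ by a scalar `c(g,h)`, and `M_g Γ = ± Γ M_g` for the
same reason. The factor set gives the component in `H²`, the signs give `ψ` (`exists_matrixModel`,
`MatrixModel.unique`). The map `a ⊗ b ↦ θ(a) ⊗ Γ^{∂a} η(b)` absorbs the Koszul sign and makes `A ⊗̂
B` a matrix algebra (`MatrixModel.tensor`). The action matrices of the first factor must then be
corrected by `Γ^{χ(g)}`, and moving `M_g` past `Γ^{χ(h)}` creates the cocycle `(-1)^{ψ∪χ}`.

If the underlying ring is not simple, `A` has a central odd involution (`exists_odd_central`), and
`A ⊗̂ α(1)` is again a matrix algebra (`isSimpleRing_tensor_alphaOne`). Its type divided by `τ = (0,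
1, 1)` is the type of `A`. This is consistent with the product because `α(1) ⊗̂ α(1)` is `M₂(ℂ)`
with a purely imaginary grading matrix, hence of type `(0, φ, 0) = τ²` (`hasEvenType_clifford`). The
two cases cannot overlap: a dimension cannot be both a square and half a square.

For similarity (`similar_iff`), let `A` and `B` have type `x` and let `N` have type `x⁻¹`. Then `N
⊗̂ B` and `A ⊗̂ N` have type `1`, hence are endomorphism algebras, and `A ⊗̂ (N ⊗̂ B) ≅ B ⊗̂ (A ⊗̂
N)` is a similarity. Twisted regular representations supply algebras of every type, so `GrBr` is in
bijection with the twisted product, and its group structure is transported along that bijection. -/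

lemma sgn_mul_self (s : ZMod 2) : (sgn s : ℂ) * sgn s = 1 := by
  rcases zmod_two_eq s with rfl | rfl <;> simp

lemma neg_one_uzpow_smul {M : Type*} [AddCommGroup M] [Module ℂ M] (s : ZMod 2) (x : M) :
    (-1 : ℤˣ) ^ s • x = (sgn s : ℂ) • x := by
  rcases zmod_two_eq s with rfl | rfl
  · simp
  · have : (-1 : ℤˣ) ^ (1 : ZMod 2) = -1 := rfl
    rw [this, sgn_one]
    simp [Units.smul_def]

lemma sgn_injective : Function.Injective (fun s : ZMod 2 => (sgn s : ℂ)) := by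
  intro s t h
  rcases zmod_two_eq s with rfl | rfl <;> rcases zmod_two_eq t with rfl | rfl <;>
    simp at h ⊢ <;> norm_num [Complex.ext_iff] at h

variable {G : Type} [Group G] {φ : G →* Multiplicative (ZMod 2)}

namespace MagAlg

/-! ### Homogeneous elements and parity -/

section parity

variable (A : MagAlg φ)

lemma homogeneous_induction {P : A.carrier → Prop} (hadd : ∀ x y, P x → P y → P (x + y))
    (hom : ∀ i, ∀ a ∈ A.grading i, P a) (a : A.carrier) : P a := by
  obtain ⟨x, hx, y, hy, rfl⟩ := A.exists_add a
  exact hadd _ _ (hom _ _ hx) (hom _ _ hy)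

lemma parity_parity (a : A.carrier) : A.parity (A.parity a) = a := by
  refine A.homogeneous_induction (P := fun a => A.parity (A.parity a) = a)
    (fun x y hx hy => ?_) (fun i a ha => ?_) a
  · rw [map_add, map_add, hx, hy]
  · rw [A.parity_of_mem ha, map_smul, A.parity_of_mem ha, smul_smul, sgn_mul_self, one_smul]

/-- Since `2` is invertible, the components are exactly the eigenspaces of the parity. Hence
compatibility with gradings can be checked as commutation with the parity. -/
lemma mem_grading_iff {i : ZMod 2} {a : A.carrier} :
    a ∈ A.grading i ↔ A.parity a = (sgn i : ℂ) • a := by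
  refine ⟨A.parity_of_mem, fun h => ?_⟩
  obtain ⟨x, hx, y, hy, rfl⟩ := A.exists_add a
  rw [map_add, A.parity_of_mem hx, A.parity_of_mem hy] at h
  rcases zmod_two_eq i with rfl | rfl
  · simp only [sgn_zero, sgn_one, Units.val_one, Units.val_neg, one_smul, neg_smul,
      add_right_inj] at h
    have h2 : (2 : ℂ) • y = 0 := by rw [two_smul]; nth_rw 1 [← h]; simp
    rw [(smul_eq_zero.mp h2).resolve_left two_ne_zero, add_zero]
    exact hx
  · simp only [sgn_zero, sgn_one, Units.val_one, Units.val_neg, one_smul, neg_smul, neg_add,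
      add_left_inj] at h
    have h2 : (2 : ℂ) • x = 0 := by rw [two_smul]; nth_rw 1 [h]; simp
    rw [(smul_eq_zero.mp h2).resolve_left two_ne_zero, zero_add]
    exact hy

lemma one_mem_zero : (1 : A.carrier) ∈ A.grading 0 := SetLike.GradedOne.one_mem

lemma mul_mem_add {i j : ZMod 2} {a b : A.carrier} (ha : a ∈ A.grading i) (hb : b ∈ A.grading j) :
    a * b ∈ A.grading (i + j) := SetLike.mul_mem_graded ha hb

lemma parity_mul (a b : A.carrier) : A.parity (a * b) = A.parity a * A.parity b := by
  refine A.homogeneous_induction (P := fun a => A.parity (a * b) = A.parity a * A.parity b)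
    (fun x y hx hy => ?_) (fun i a ha => ?_) a
  · rw [add_mul, map_add, map_add, add_mul, hx, hy]
  refine A.homogeneous_induction (P := fun b => A.parity (a * b) = A.parity a * A.parity b)
    (fun x y hx hy => ?_) (fun j b hb => ?_) b
  · rw [mul_add, map_add, map_add, mul_add, hx, hy]
  · rw [A.parity_of_mem ha, A.parity_of_mem hb, A.parity_of_mem (A.mul_mem_add ha hb), sgn_add,
      smul_mul_smul_comm, Units.val_mul]

lemma parity_map_one : A.parity 1 = 1 := by simpa using A.parity_of_mem A.one_mem_zero

/-- The parity involution of a graded algebra, as an algebra automorphism. -/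
def parityEquiv : A.carrier ≃ₐ[ℂ] A.carrier :=
  AlgEquiv.ofLinearEquiv (LinearEquiv.ofInvolutive A.parity A.parity_parity) A.parity_map_one
    A.parity_mul

@[simp] lemma parityEquiv_apply (a : A.carrier) : A.parityEquiv a = A.parity a := rfl

lemma act_parity (g : G) (a : A.carrier) : A.act g (A.parity a) = A.parity (A.act g a) := by
  refine A.homogeneous_induction (P := fun a => A.act g (A.parity a) = A.parity (A.act g a))
    (fun x y hx hy => ?_) (fun i a ha => ?_) a
  · simp only [map_add, hx, hy]
  · rw [A.parity_of_mem ha, A.act_smul, A.parity_of_mem (A.act_mem g i a ha), conjPow_sgn]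

end parity

/-! ### Isomorphisms -/

namespace Iso

variable {A B C : MagAlg φ}

lemma map_parity (e : Iso A B) (a : A.carrier) :
    e.toAlgEquiv (A.parity a) = B.parity (e.toAlgEquiv a) := by
  refine A.homogeneous_induction (P := fun a => e.toAlgEquiv (A.parity a) =
    B.parity (e.toAlgEquiv a)) (fun x y hx hy => ?_) (fun i a ha => ?_) a
  · simp only [map_add, hx, hy]
  · rw [A.parity_of_mem ha, map_smul, B.parity_of_mem (e.map_mem i a ha)]

/-- An algebra isomorphism that commutes with the parity and with `G`. -/
def ofAlgEquiv (e : A.carrier ≃ₐ[ℂ] B.carrier) (hpar : ∀ a, e (A.parity a) = B.parity (e a))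
    (hact : ∀ g a, e (A.act g a) = B.act g (e a)) : Iso A B where
  toAlgEquiv := e
  map_mem i a ha := by
    rw [mem_grading_iff] at ha ⊢
    rw [← hpar, ha, map_smul]
  map_act := hact

/-- The identity isomorphism. -/
def refl (A : MagAlg φ) : Iso A A := ofAlgEquiv AlgEquiv.refl (fun _ => rfl) fun _ _ => rfl

/-- The inverse isomorphism. -/
def symm (e : Iso A B) : Iso B A :=
  ofAlgEquiv e.toAlgEquiv.symm
    (fun b => by rw [AlgEquiv.symm_apply_eq, e.map_parity, AlgEquiv.apply_symm_apply])
    (fun g b => by rw [AlgEquiv.symm_apply_eq, e.map_act, AlgEquiv.apply_symm_apply])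

/-- The composition of isomorphisms. -/
def trans (e : Iso A B) (f : Iso B C) : Iso A C :=
  ofAlgEquiv (e.toAlgEquiv.trans f.toAlgEquiv)
    (fun a => by simp only [AlgEquiv.trans_apply, map_parity])
    (fun g a => by simp only [AlgEquiv.trans_apply, map_act])

end Iso

/-! ### The graded tensor product -/

section tm

variable {A B C D : MagAlg φ}

/-- The element `a ⊗ b` of `A ⊗̂ B`. -/
def tm (a : A.carrier) (b : B.carrier) : (A.tensor B).carrier :=
  (GradedTensorProduct.tmul ℂ a b : tensorCarrier A B)

/-- The linear equivalence between `A ⊗ B` and `A ⊗̂ B`. -/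
def tmEquiv (A B : MagAlg φ) : A.carrier ⊗[ℂ] B.carrier ≃ₗ[ℂ] (A.tensor B).carrier :=
  GradedTensorProduct.of ℂ A.grading B.grading

@[simp] lemma tmEquiv_tmul (a : A.carrier) (b : B.carrier) : tmEquiv A B (a ⊗ₜ b) = tm a b := rfl

@[simp] lemma tmEquiv_symm_tm (a : A.carrier) (b : B.carrier) :
    (tmEquiv A B).symm (tm a b) = a ⊗ₜ b := rfl

lemma tm_add (a : A.carrier) (b b' : B.carrier) : tm a (b + b') = tm a b + tm a b' := by
  simp only [← tmEquiv_tmul, TensorProduct.tmul_add, map_add]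

lemma add_tm (a a' : A.carrier) (b : B.carrier) : tm (a + a') b = tm a b + tm a' b := by
  simp only [← tmEquiv_tmul, TensorProduct.add_tmul, map_add]

lemma tm_smul (z : ℂ) (a : A.carrier) (b : B.carrier) : tm a (z • b) = z • tm a b := by
  simp only [← tmEquiv_tmul, TensorProduct.tmul_smul, map_smul]

lemma smul_tm (z : ℂ) (a : A.carrier) (b : B.carrier) : tm (z • a) b = z • tm a b := by
  simp only [← tmEquiv_tmul, ← TensorProduct.smul_tmul', map_smul]

lemma zero_tm (b : B.carrier) : tm (0 : A.carrier) b = 0 := by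
  simp only [← tmEquiv_tmul, TensorProduct.zero_tmul, map_zero]

lemma one_def : (1 : (A.tensor B).carrier) = tm 1 1 := rfl

lemma tm_mul_tm {i j : ZMod 2} (a : A.carrier) {b : B.carrier} (hb : b ∈ B.grading j)
    {a' : A.carrier} (ha' : a' ∈ A.grading i) (b' : B.carrier) :
    tm a b * tm a' b' = (sgn (j * i) : ℂ) • tm (a * a') (b * b') := by
  rw [← neg_one_uzpow_smul]
  exact tmul_mul_tmul a hb ha' b'

lemma tm_one_mul_tm (a a' : A.carrier) (b' : B.carrier) :
    tm a (1 : B.carrier) * tm a' b' = tm (a * a') b' := by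
  refine A.homogeneous_induction (P := fun a' => tm a (1 : B.carrier) * tm a' b' = tm (a * a') b')
    (fun x y hx hy => ?_) (fun i a' ha' => ?_) a'
  · rw [add_tm, mul_add, hx, hy, mul_add, add_tm]
  · simp [tm_mul_tm a B.one_mem_zero ha' b']

lemma tm_mul_one_tm (a : A.carrier) (b b' : B.carrier) :
    tm a b * tm (1 : A.carrier) b' = tm a (b * b') := by
  refine B.homogeneous_induction (P := fun b => tm a b * tm (1 : A.carrier) b' = tm a (b * b'))
    (fun x y hx hy => ?_) (fun i b hb => ?_) b
  · rw [tm_add, add_mul, hx, hy, add_mul, tm_add]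
  · simp [tm_mul_tm a hb A.one_mem_zero b']

lemma act_tm (g : G) (a : A.carrier) (b : B.carrier) :
    (A.tensor B).act g (tm a b) = tm (A.act g a) (B.act g b) := rfl

lemma tm_mem {i j : ZMod 2} {a : A.carrier} {b : B.carrier}
    (ha : a ∈ A.grading i) (hb : b ∈ B.grading j) : tm a b ∈ (A.tensor B).grading (i + j) :=
  tmul_mem rfl ha hb

lemma tm_induction {P : (A.tensor B).carrier → Prop} (hadd : ∀ x y, P x → P y → P (x + y))
    (htm : ∀ i j, ∀ a ∈ A.grading i, ∀ b ∈ B.grading j, P (tm a b))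
    (x : (A.tensor B).carrier) : P x :=
  tensor_induction hadd htm x

lemma parity_tm (a : A.carrier) (b : B.carrier) :
    (A.tensor B).parity (tm a b) = tm (A.parity a) (B.parity b) := by
  refine A.homogeneous_induction (P := fun a => (A.tensor B).parity (tm a b) =
    tm (A.parity a) (B.parity b)) (fun x y hx hy => ?_) (fun i a ha => ?_) a
  · rw [add_tm, map_add, map_add, hx, hy, add_tm]
  refine B.homogeneous_induction (P := fun b => (A.tensor B).parity (tm a b) =
    tm (A.parity a) (B.parity b)) (fun x y hx hy => ?_) (fun j b hb => ?_) b
  · rw [tm_add, map_add, map_add, hx, hy, tm_add]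
  · rw [A.parity_of_mem ha, B.parity_of_mem hb, parity_of_mem _ (tm_mem ha hb), sgn_add, smul_tm,
      tm_smul, smul_smul, Units.val_mul]

lemma tm_induction₃ {P : ((A.tensor B).tensor C).carrier → Prop}
    (hadd : ∀ x y, P x → P y → P (x + y))
    (htm : ∀ i j k, ∀ a ∈ A.grading i, ∀ b ∈ B.grading j, ∀ c ∈ C.grading k, P (tm (tm a b) c))
    (x : ((A.tensor B).tensor C).carrier) : P x := by
  refine tm_induction hadd (fun _ k u _ c hc => ?_) x
  refine tm_induction (P := fun u => P (tm u c)) (fun x y hx hy => ?_)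
    (fun i j a ha b hb => htm i j k a ha b hb c hc) u
  rw [add_tm]
  exact hadd _ _ hx hy

lemma finrank_tensor (A B : MagAlg φ) : Module.finrank ℂ (A.tensor B).carrier =
    Module.finrank ℂ A.carrier * Module.finrank ℂ B.carrier := by
  rw [← (tmEquiv A B).finrank_eq, Module.finrank_tensorProduct]

namespace Iso

/-- The tensor product of two isomorphisms. -/
def tensorCongr (e : Iso A B) (f : Iso C D) : Iso (A.tensor C) (B.tensor D) :=
  let L : (A.tensor C).carrier ≃ₗ[ℂ] (B.tensor D).carrier :=
    (tmEquiv A C).symm ≪≫ₗ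
      TensorProduct.congr e.toAlgEquiv.toLinearEquiv f.toAlgEquiv.toLinearEquiv ≪≫ₗ tmEquiv B D
  have hL : ∀ a c, L (tm a c) = tm (e.toAlgEquiv a) (f.toAlgEquiv c) := fun _ _ => rfl
  ofAlgEquiv
    (AlgEquiv.ofLinearEquiv L (by rw [one_def, hL, map_one, map_one]; rfl) (fun x y => by
      refine tm_induction (P := fun x => L (x * y) = L x * L y) (fun x x' hx hx' => ?_)
        (fun i j a ha c hc => ?_) x
      · rw [add_mul, map_add, map_add, add_mul, hx, hx']
      refine tm_induction (P := fun y => L (_ * y) = _ * L y) (fun y y' hy hy' => ?_)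
        (fun i' j' a' ha' c' hc' => ?_) y
      · rw [mul_add, map_add, map_add, mul_add, hy, hy']
      · rw [tm_mul_tm _ hc ha', map_smul, hL, hL, hL,
          tm_mul_tm _ (f.map_mem _ _ hc) (e.map_mem _ _ ha'), map_mul, map_mul]))
    (fun x => by
      change L (parity _ x) = parity _ (L x)
      refine tm_induction (P := fun x => L (parity _ x) = parity _ (L x)) (fun x x' hx hx' => ?_)
        (fun i j a ha c hc => ?_) x
      · simp only [map_add, hx, hx']
      · rw [parity_tm, hL, hL, parity_tm, e.map_parity, f.map_parity])
    (fun g x => by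
      change L (act _ g x) = act _ g (L x)
      refine tm_induction (P := fun x => L (act _ g x) = act _ g (L x)) (fun x x' hx hx' => ?_)
        (fun i j a ha c hc => ?_) x
      · simp only [map_add, hx, hx']
      · rw [act_tm, hL, hL, act_tm, e.map_act, f.map_act])

/-- The associativity of the graded tensor product. -/
def tensorAssoc (A B C : MagAlg φ) :
    Iso ((A.tensor B).tensor C) (A.tensor (B.tensor C)) :=
  let L : ((A.tensor B).tensor C).carrier ≃ₗ[ℂ] (A.tensor (B.tensor C)).carrier :=
    (tmEquiv _ C).symm ≪≫ₗ TensorProduct.congr (tmEquiv A B).symm (LinearEquiv.refl ℂ _) ≪≫ₗ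
      TensorProduct.assoc ℂ _ _ _ ≪≫ₗ TensorProduct.congr (LinearEquiv.refl ℂ _) (tmEquiv B C) ≪≫ₗ
        tmEquiv A _
  have hL : ∀ a b c, L (tm (tm a b) c) = tm a (tm b c) := fun _ _ _ => rfl
  ofAlgEquiv
    (AlgEquiv.ofLinearEquiv L (by rw [one_def, one_def, hL]; rfl) (fun x y => by
      refine tm_induction₃ (P := fun x => L (x * y) = L x * L y) (fun x x' hx hx' => ?_)
        (fun i j k a ha b hb c hc => ?_) x
      · rw [add_mul, map_add, map_add, add_mul, hx, hx']
      refine tm_induction₃ (P := fun y => L (_ * y) = _ * L y) (fun y y' hy hy' => ?_)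
        (fun i' j' k' a' ha' b' hb' c' hc' => ?_) y
      · rw [mul_add, map_add, map_add, mul_add, hy, hy']
      · rw [tm_mul_tm _ hc (tm_mem ha' hb'), map_smul, tm_mul_tm _ hb ha', smul_tm, map_smul,
          hL, hL, hL, tm_mul_tm _ (tm_mem hb hc) ha', tm_mul_tm _ hc hb', tm_smul, smul_smul,
          smul_smul, ← Units.val_mul, ← Units.val_mul, ← sgn_add, ← sgn_add]
        congr 3
        ring))
    (fun x => by
      change L (parity _ x) = parity _ (L x)
      refine tm_induction₃ (P := fun x => L (parity _ x) = parity _ (L x)) (fun x x' hx hx' => ?_)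
        (fun i j k a ha b hb c hc => ?_) x
      · simp only [map_add, hx, hx']
      · simp only [parity_tm, hL])
    (fun g x => by
      change L (act _ g x) = act _ g (L x)
      refine tm_induction₃ (P := fun x => L (act _ g x) = act _ g (L x)) (fun x x' hx hx' => ?_)
        (fun i j k a ha b hb c hc => ?_) x
      · simp only [map_add, hx, hx']
      · simp only [act_tm, hL])

/-- The commutativity of the graded tensor product: `a ⊗ b ↦ (-1)^{∂a ∂b} b ⊗ a`. -/
def tensorComm (A B : MagAlg φ) : Iso (A.tensor B) (B.tensor A) :=
  let L : (A.tensor B).carrier ≃ₐ[ℂ] (B.tensor A).carrier :=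
    GradedTensorProduct.comm A.grading B.grading
  have hL : ∀ i j, ∀ a ∈ A.grading i, ∀ b ∈ B.grading j, L (tm a b) = (sgn (j * i) : ℂ) • tm b a :=
    fun i j a ha b hb => by
      rw [← neg_one_uzpow_smul]
      exact GradedTensorProduct.comm_coe_tmul_coe A.grading B.grading ⟨a, ha⟩ ⟨b, hb⟩
  ofAlgEquiv L
    (fun x => by
      refine tm_induction (P := fun x => L (parity _ x) = parity _ (L x)) (fun x x' hx hx' => ?_)
        (fun i j a ha b hb => ?_) x
      · simp only [map_add, hx, hx']
      · rw [hL i j a ha b hb, parity_of_mem _ (tm_mem ha hb), map_smul, map_smul,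
          hL i j a ha b hb, parity_of_mem _ (tm_mem hb ha), smul_comm, add_comm])
    (fun g x => by
      refine tm_induction (P := fun x => L (act _ g x) = act _ g (L x)) (fun x x' hx hx' => ?_)
        (fun i j a ha b hb => ?_) x
      · simp only [map_add, hx, hx']
      · rw [hL i j a ha b hb, act_tm, hL i j _ (A.act_mem g i a ha) _ (B.act_mem g j b hb),
          act_smul, conjPow_sgn, act_tm])

end Iso

end tm

/-! ### Isomorphism classes -/

/-- Being isomorphic, as a setoid. -/
instance isoSetoid (φ : G →* Multiplicative (ZMod 2)) : Setoid (MagAlg φ) where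
  r A B := Nonempty (Iso A B)
  iseqv := ⟨fun A => ⟨Iso.refl A⟩, fun ⟨e⟩ => ⟨e.symm⟩, fun ⟨e⟩ ⟨f⟩ => ⟨e.trans f⟩⟩

/-- Isomorphism classes of graded algebras with action of `(G, φ)`. -/
def IsoClass (φ : G →* Multiplicative (ZMod 2)) : Type 1 := Quotient (isoSetoid φ)

/-- The isomorphism class of an algebra. -/
def cls (A : MagAlg φ) : IsoClass φ := Quotient.mk _ A

lemma cls_eq_iff {A B : MagAlg φ} : cls A = cls B ↔ Nonempty (Iso A B) := Quotient.eq

/-- Rearrangements of tensor factors, with all their Koszul signs, become identities in a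
commutative semigroup. -/
instance : CommSemigroup (IsoClass φ) where
  mul := Quotient.map₂ tensor fun _ _ ⟨e⟩ _ _ ⟨f⟩ => ⟨e.tensorCongr f⟩
  mul_assoc := by
    rintro ⟨A⟩ ⟨B⟩ ⟨C⟩
    exact cls_eq_iff.2 ⟨Iso.tensorAssoc A B C⟩
  mul_comm := by
    rintro ⟨A⟩ ⟨B⟩
    exact cls_eq_iff.2 ⟨Iso.tensorComm A B⟩

lemma cls_tensor (A B : MagAlg φ) : cls (A.tensor B) = cls A * cls B := rfl

end MagAlg

open MagAlg
open scoped Kronecker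

/-! ### Cocycles -/

namespace CUnits

lemma val_ne_zero (z : CUnits φ) : z.val ≠ 0 := Units.ne_zero (M₀ := ℂ) z

lemma val_injective : Function.Injective (CUnits.val (φ := φ)) :=
  fun _ _ h => Units.ext (α := ℂ) h

lemma val_mul (z w : CUnits φ) : (z * w).val = z.val * w.val := rfl

lemma val_one : (1 : CUnits φ).val = 1 := rfl

lemma val_smul (g : G) (z : CUnits φ) : (g • z).val = conjPow φ g z.val := rfl

/-- A nonzero complex number as an element of `ℂ*_φ`. -/
def mk0 (z : ℂ) (hz : z ≠ 0) : CUnits φ := Units.mk0 z hz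

lemma val_mk0 (z : ℂ) (hz : z ≠ 0) : (mk0 z hz : CUnits φ).val = z := rfl

end CUnits

lemma isMulCocycle₂_iff_val {c : G × G → CUnits φ} : IsMulCocycle₂ c ↔ ∀ g h j : G,
    (c (g * h, j)).val * (c (g, h)).val = conjPow φ g (c (h, j)).val * (c (g, h * j)).val :=
  forall₃_congr fun _ _ _ => CUnits.val_injective.eq_iff.symm

/-- The coboundary relation without division: it is the form in which rescaling the maps `ρ(g)` by
scalars `x g` changes a factor set. -/
lemma H2Phi.mk_eq_mk_iff {c d : G × G → CUnits φ} (hc : IsMulCocycle₂ c) (hd : IsMulCocycle₂ d) :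
    H2Phi.mk φ hc = H2Phi.mk φ hd ↔
      ∃ x : G → CUnits φ, ∀ g h, c (g, h) * x (g * h) = d (g, h) * (g • x h * x g) := by
  have key : ∀ (x : G → CUnits φ) (g h : G),
      g • x h / x (g * h) * x g = c (g, h) / d (g, h) ↔
        c (g, h) * x (g * h) = d (g, h) * (g • x h * x g) := by
    intro x g h
    rw [div_mul_eq_mul_div, div_eq_div_iff_mul_eq_mul, mul_comm _ (d (g, h)), eq_comm]
  unfold H2Phi.mk
  rw [H2π_eq_iff]
  constructor
  · rintro ⟨x, hx⟩
    exact ⟨x, fun g h => (key x g h).1 (congrFun hx (g, h))⟩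
  · rintro ⟨x, hx⟩
    exact ⟨x, funext fun p => (key x p.1 p.2).2 (hx p.1 p.2)⟩

lemma H2Phi.exists_mk_eq (l : H2Phi φ) :
    ∃ (c : G × G → CUnits φ) (hc : IsMulCocycle₂ c), H2Phi.mk φ hc = l := by
  induction l using H2_induction_on with
  | h x => exact ⟨_, isMulCocycle₂_of_mem_cocycles₂ (G := G) (M := CUnits φ) x.1 x.2, rfl⟩

lemma isMulCocycle₂_one : IsMulCocycle₂ (fun _ : G × G => (1 : CUnits φ)) := by
  intro g h j
  simp

lemma H2Phi.mk_one : H2Phi.mk φ isMulCocycle₂_one = 0 := by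
  have := H2Phi.mk_add φ (isMulCocycle₂_one (φ := φ)) isMulCocycle₂_one isMulCocycle₂_one
    (fun _ => one_mul _)
  simpa using this

/-! ### Matrices -/

section matrix

variable {l m n : Type}

lemma map_conj_smul (g : G) (z : ℂ) (X : Matrix m n ℂ) :
    (z • X).map (conjPow φ g) = conjPow φ g z • X.map (conjPow φ g) := by
  ext i j
  exact map_mul (conjPow φ g) z (X i j)

lemma map_conj_add (g : G) (X Y : Matrix m n ℂ) :
    (X + Y).map (conjPow φ g) = X.map (conjPow φ g) + Y.map (conjPow φ g) := by
  ext i j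
  exact map_add (conjPow φ g) (X i j) (Y i j)

lemma map_conj_one (g : G) [DecidableEq n] :
    (1 : Matrix n n ℂ).map (conjPow φ g) = 1 :=
  Matrix.map_one _ (map_zero _) (map_one _)

@[simp] lemma map_conj_conj (g : G) (X : Matrix m n ℂ) :
    (X.map (conjPow φ g)).map (conjPow φ g) = X := by
  ext i j
  exact conjPow_conjPow φ g _

lemma map_conj_mul (g h : G) (X : Matrix m n ℂ) :
    X.map (conjPow φ (g * h)) = (X.map (conjPow φ h)).map (conjPow φ g) := by
  ext i j
  exact conjPow_mul φ g h _

lemma map_conj_kronecker {k : Type} (g : G) (X : Matrix m n ℂ) (Y : Matrix k l ℂ) :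
    (X ⊗ₖ Y).map (conjPow φ g) = X.map (conjPow φ g) ⊗ₖ Y.map (conjPow φ g) := by
  ext i j
  exact map_mul (conjPow φ g) _ _

variable [Fintype n] [DecidableEq n] [Fintype m] [DecidableEq m]

/-- An isomorphism between matrix algebras is a conjugation. -/
lemma exists_matrix_conj (e : Matrix n n ℂ ≃ₐ[ℂ] Matrix m m ℂ) :
    ∃ (T : Matrix m n ℂ) (T' : Matrix n m ℂ), T * T' = 1 ∧ T' * T = 1 ∧
      ∀ X, e X = T * X * T' := by
  obtain ⟨T, hT⟩ := AlgEquiv.eq_linearEquivConjAlgEquiv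
    ((Matrix.toLinAlgEquiv' (R := ℂ) (n := n)).symm.trans (e.trans Matrix.toLinAlgEquiv'))
  refine ⟨LinearMap.toMatrix' T.toLinearMap, LinearMap.toMatrix' T.symm.toLinearMap, ?_, ?_,
    fun X => ?_⟩
  · rw [← LinearMap.toMatrix'_comp]; simp
  · rw [← LinearMap.toMatrix'_comp]; simp
  · have h := DFunLike.congr_fun hT (Matrix.toLinAlgEquiv' X)
    simp only [AlgEquiv.trans_apply, AlgEquiv.symm_apply_apply,
      LinearEquiv.conjAlgEquiv_apply] at h
    apply_fun LinearMap.toMatrix' at h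
    rw [LinearMap.toMatrix'_comp, LinearMap.toMatrix'_comp] at h
    have h1 : ∀ {k : Type} [Fintype k] [DecidableEq k] (Y : Matrix k k ℂ),
        LinearMap.toMatrix' (Matrix.toLinAlgEquiv' Y) = Y :=
      fun Y => LinearMap.toMatrix'_toLin' Y
    rw [h1, h1, ← Matrix.mul_assoc] at h
    exact h

lemma eq_smul_one_of_commute {X : Matrix n n ℂ} (h : ∀ Z, X * Z = Z * X) :
    ∃ s : ℂ, X = s • 1 := by
  have hX : X ∈ Set.center (Matrix n n ℂ) := Semigroup.mem_center_iff.2 fun Z => (h Z).symm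
  rw [Matrix.center_eq_range] at hX
  obtain ⟨s, rfl⟩ := hX
  exact ⟨s, by rw [Matrix.scalar_apply, Matrix.smul_one_eq_diagonal]⟩

/-- Two matrices that intertwine the identity with the same map are proportional. -/
lemma eq_smul_of_intertwine {σ : Matrix n n ℂ → Matrix n n ℂ} {X Y : Matrix n n ℂ}
    (hX : ∀ Z, X * Z = σ Z * X) (hY : ∀ Z, Y * Z = σ Z * Y) (hu : IsUnit Y) :
    ∃ s : ℂ, X = s • Y := by
  obtain ⟨u, rfl⟩ := hu
  have h1 : ∀ Z, (↑u⁻¹ : Matrix n n ℂ) * σ Z = Z * (↑u⁻¹ : Matrix n n ℂ) := fun Z => by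
    rw [Units.inv_mul_eq_iff_eq_mul, ← mul_assoc, hY Z, mul_assoc, Units.mul_inv, mul_one]
  -- `Y⁻¹ X` is central because `σ` cancels, and the center consists of scalars.
  obtain ⟨s, hs⟩ := eq_smul_one_of_commute (X := (↑u⁻¹ : Matrix n n ℂ) * X) fun Z => by
    rw [mul_assoc, hX, ← mul_assoc, h1, mul_assoc]
  refine ⟨s, ?_⟩
  rw [Units.inv_mul_eq_iff_eq_mul] at hs
  rw [hs, Matrix.mul_smul, mul_one]

lemma isUnit_map_conj (g : G) {X : Matrix n n ℂ} (h : IsUnit X) :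
    IsUnit (X.map (conjPow φ g)) :=
  h.map (conjPow φ g).mapMatrix

end matrix

/-! ### Matrix models -/

/-- A description of the grading and of the action of `G` on an algebra `A` that is identified with
a full matrix algebra by `θ`: the parity is the conjugation by an involution `Γ`, and `g ∈ G` acts by
the conjugation by the semilinear map `v ↦ M g (𝕂^{φ(g)} v)`. Here `c` is the factor set of these
maps, and `ψ` tells which of them commute with `Γ`. -/
structure MatrixModel (A : MagAlg φ) {n : Type} [Fintype n] [DecidableEq n]
    (θ : A.carrier ≃ₐ[ℂ] Matrix n n ℂ) (c : G × G → CUnits φ)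
    (ψ : G →* Multiplicative (ZMod 2)) where
  /-- the involution that defines the grading -/
  Γ : Matrix n n ℂ
  /-- the matrices that define the action -/
  M : G → Matrix n n ℂ
  isUnit : ∀ g, IsUnit (M g)
  Γ_mul_self : Γ * Γ = 1
  θ_parity : ∀ a, θ (A.parity a) * Γ = Γ * θ a
  θ_act : ∀ g a, θ (A.act g a) * M g = M g * (θ a).map (conjPow φ g)
  M_mul : ∀ g h, M g * (M h).map (conjPow φ g) = (c (g, h)).val • M (g * h)
  M_Γ : ∀ g, M g * Γ.map (conjPow φ g) = (sgn (ψ g).toAdd : ℂ) • (Γ * M g)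

namespace MatrixModel

variable {A B : MagAlg φ} {n m : Type} [Fintype n] [DecidableEq n] [Fintype m] [DecidableEq m]
  {θ : A.carrier ≃ₐ[ℂ] Matrix n n ℂ} {c d : G × G → CUnits φ}
  {ψ χ : G →* Multiplicative (ZMod 2)}

section

variable (K : MatrixModel A θ c ψ)

lemma isUnit_Γ : IsUnit K.Γ := ⟨⟨K.Γ, K.Γ, K.Γ_mul_self, K.Γ_mul_self⟩, rfl⟩

lemma ne_zero [Nonempty n] (g : G) : K.M g ≠ 0 := (K.isUnit g).ne_zero

lemma Γ_mul_ne_zero [Nonempty n] (g : G) : K.Γ * K.M g ≠ 0 :=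
  (K.isUnit_Γ.mul (K.isUnit g)).ne_zero

lemma Γ_intertwine (Z : Matrix n n ℂ) : K.Γ * Z = θ (A.parity (θ.symm Z)) * K.Γ := by
  rw [K.θ_parity, AlgEquiv.apply_symm_apply]

/-- Conjugating the entries of `Z` beforehand makes the relation linear. The map applied to `Z` on
the right depends on `A`, `θ` and `g` but not on the model, so the matrices of two models can be
compared by `eq_smul_of_intertwine`. -/
lemma M_intertwine (g : G) (Z : Matrix n n ℂ) :
    K.M g * Z = θ (A.act g (θ.symm (Z.map (conjPow φ g)))) * K.M g := by
  rw [K.θ_act, AlgEquiv.apply_symm_apply, map_conj_conj]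

include K in
-- Associativity of the composite of the three semilinear maps for `g`, `h`, `j`, after cancelling
-- the nonzero matrix of `ghj`.
lemma isMulCocycle₂ [Nonempty n] : IsMulCocycle₂ c := by
  rw [isMulCocycle₂_iff_val]
  intro g h j
  have h1 : K.M g * (K.M h * (K.M j).map (conjPow φ h)).map (conjPow φ g) =
      (K.M g * (K.M h).map (conjPow φ g)) * (K.M j).map (conjPow φ (g * h)) := by
    rw [Matrix.map_mul, map_conj_mul, Matrix.mul_assoc]
  rw [K.M_mul, K.M_mul, map_conj_smul, Matrix.mul_smul, Matrix.smul_mul, K.M_mul, K.M_mul,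
    smul_smul, smul_smul, mul_assoc g h j] at h1
  have h2 := smul_left_injective ℂ (K.ne_zero (g * (h * j))) h1
  rw [h2, mul_comm]

/-- The transport of a matrix model along a conjugation. -/
def conj {θ' : A.carrier ≃ₐ[ℂ] Matrix m m ℂ} (T : Matrix m n ℂ) (T' : Matrix n m ℂ)
    (h₁ : T * T' = 1) (h₂ : T' * T = 1) (hθ : ∀ a, θ' a = T * θ a * T') :
    MatrixModel A θ' c ψ where
  Γ := T * K.Γ * T'
  -- This is `T (M_g 𝕂) T⁻¹`: moving `𝕂` to the right past `T⁻¹` conjugates its entries.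
  M g := T * K.M g * T'.map (conjPow φ g)
  isUnit g := by
    obtain ⟨u, hu⟩ := K.isUnit g
    have h₃ : T'.map (conjPow φ g) * T.map (conjPow φ g) = 1 := by
      rw [← Matrix.map_mul, h₂, map_conj_one]
    refine IsUnit.of_mul_eq_one (T.map (conjPow φ g) * (↑u⁻¹ : Matrix n n ℂ) * T') ?_
    have h : T * K.M g * T'.map (conjPow φ g) * (T.map (conjPow φ g) * (↑u⁻¹ : Matrix n n ℂ) * T') =
        T * (K.M g * (T'.map (conjPow φ g) * T.map (conjPow φ g)) * (↑u⁻¹ : Matrix n n ℂ)) * T' := by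
      simp only [Matrix.mul_assoc]
    rw [h, h₃, Matrix.mul_one, ← hu, Units.mul_inv, Matrix.mul_one, h₁]
  Γ_mul_self := by
    have h : T * K.Γ * T' * (T * K.Γ * T') = T * (K.Γ * (T' * T) * K.Γ) * T' := by
      simp only [Matrix.mul_assoc]
    rw [h, h₂, Matrix.mul_one, K.Γ_mul_self, Matrix.mul_one, h₁]
  θ_parity a := by
    have h : ∀ X Y : Matrix n n ℂ, T * X * T' * (T * Y * T') = T * (X * (T' * T) * Y) * T' := by
      intro X Y
      simp only [Matrix.mul_assoc]
    rw [hθ, hθ, h, h, h₂, Matrix.mul_one, Matrix.mul_one, K.θ_parity]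
  θ_act g a := by
    have h₃ : T'.map (conjPow φ g) * T.map (conjPow φ g) = 1 := by
      rw [← Matrix.map_mul, h₂, map_conj_one]
    have h : T * θ (A.act g a) * T' * (T * K.M g * T'.map (conjPow φ g)) =
        T * (θ (A.act g a) * (T' * T) * K.M g) * T'.map (conjPow φ g) := by
      simp only [Matrix.mul_assoc]
    have h' : ∀ X : Matrix n n ℂ, T * K.M g * T'.map (conjPow φ g) *
        (T.map (conjPow φ g) * X * T'.map (conjPow φ g)) =
        T * (K.M g * (T'.map (conjPow φ g) * T.map (conjPow φ g)) * X) * T'.map (conjPow φ g) := by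
      intro X
      simp only [Matrix.mul_assoc]
    rw [hθ, hθ, h, h₂, Matrix.mul_one, K.θ_act, Matrix.map_mul, Matrix.map_mul, h', h₃,
      Matrix.mul_one]
  M_mul g k := by
    have h₃ : T'.map (conjPow φ g) * T.map (conjPow φ g) = 1 := by
      rw [← Matrix.map_mul, h₂, map_conj_one]
    have h' : ∀ (X : Matrix n n ℂ) (S : Matrix n m ℂ), T * K.M g * T'.map (conjPow φ g) *
        (T.map (conjPow φ g) * X * S) =
        T * (K.M g * (T'.map (conjPow φ g) * T.map (conjPow φ g)) * X) * S := by
      intro X S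
      simp only [Matrix.mul_assoc]
    rw [Matrix.map_mul, Matrix.map_mul, h', h₃, Matrix.mul_one, K.M_mul, map_conj_mul,
      Matrix.mul_smul, Matrix.smul_mul]
  M_Γ g := by
    have h₃ : T'.map (conjPow φ g) * T.map (conjPow φ g) = 1 := by
      rw [← Matrix.map_mul, h₂, map_conj_one]
    have h' : ∀ X : Matrix n n ℂ, T * K.M g * T'.map (conjPow φ g) *
        (T.map (conjPow φ g) * X * T'.map (conjPow φ g)) =
        T * (K.M g * (T'.map (conjPow φ g) * T.map (conjPow φ g)) * X) * T'.map (conjPow φ g) := by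
      intro X
      simp only [Matrix.mul_assoc]
    have h : T * K.Γ * T' * (T * K.M g * T'.map (conjPow φ g)) =
        T * (K.Γ * (T' * T) * K.M g) * T'.map (conjPow φ g) := by
      simp only [Matrix.mul_assoc]
    rw [Matrix.map_mul, Matrix.map_mul, h', h₃, h, h₂, Matrix.mul_one, Matrix.mul_one, K.M_Γ,
      Matrix.mul_smul, Matrix.smul_mul]

/-- The transport of a matrix model along an isomorphism of algebras. -/
def ofIso (e : Iso B A) : MatrixModel B (e.toAlgEquiv.trans θ) c ψ where
  Γ := K.Γ
  M := K.M
  isUnit := K.isUnit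
  Γ_mul_self := K.Γ_mul_self
  θ_parity b := by simp only [AlgEquiv.trans_apply, e.map_parity, K.θ_parity]
  θ_act g b := by simp only [AlgEquiv.trans_apply, e.map_act, K.θ_act]
  M_mul := K.M_mul
  M_Γ := K.M_Γ

end

/-- Two matrix models with the same identification with a matrix algebra have the same `ψ`, and
cohomologous factor sets. -/
lemma unique_of_same [Nonempty n] (K : MatrixModel A θ c ψ) (K' : MatrixModel A θ d χ) :
    ψ = χ ∧ H2Phi.mk φ K.isMulCocycle₂ = H2Phi.mk φ K'.isMulCocycle₂ := by
  obtain ⟨s, hs⟩ := eq_smul_of_intertwine K'.Γ_intertwine K.Γ_intertwine K.isUnit_Γ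
  -- The scalars `x g` comparing the action matrices form the cochain whose coboundary relates `c`
  -- and `d`.
  choose x hx using fun g =>
    eq_smul_of_intertwine (K'.M_intertwine g) (K.M_intertwine g) (K.isUnit g)
  have hx0 : ∀ g, x g ≠ 0 := by
    intro g h
    apply K'.ne_zero g
    rw [hx, h, zero_smul]
  have hs2 : s * s = 1 := by
    have h := K'.Γ_mul_self
    rw [hs, Matrix.smul_mul, Matrix.mul_smul, K.Γ_mul_self, smul_smul] at h
    nth_rw 2 [← one_smul ℂ (1 : Matrix n n ℂ)] at h
    exact smul_left_injective ℂ one_ne_zero h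
  have hs0 : s ≠ 0 := left_ne_zero_of_mul_eq_one hs2
  constructor
  · ext g
    have h := K'.M_Γ g
    -- As `s = ±1` is real, replacing `Γ` by `s Γ` does not change its commutation sign with the
    -- semilinear maps.
    have hsc : conjPow φ g s = s := by
      rcases mul_self_eq_one_iff.1 hs2 with rfl | rfl <;> simp
    rw [hx, hs, map_conj_smul, hsc, Matrix.smul_mul, Matrix.smul_mul, Matrix.mul_smul,
      Matrix.mul_smul, K.M_Γ, smul_smul, smul_smul, smul_smul, smul_smul] at h
    have h1 := smul_left_injective ℂ (K.Γ_mul_ne_zero g) h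
    apply Multiplicative.toAdd.injective
    apply sgn_injective
    have h2 : (x g * s) * (sgn (ψ g).toAdd : ℂ) = (x g * s) * (sgn (χ g).toAdd : ℂ) := by
      linear_combination h1
    exact mul_left_cancel₀ (mul_ne_zero (hx0 g) hs0) h2
  · refine Eq.symm ((H2Phi.mk_eq_mk_iff _ _).2 ⟨fun g => CUnits.mk0 (x g) (hx0 g), fun g h => ?_⟩)
    have h1 := K'.M_mul g h
    rw [hx, hx, hx, map_conj_smul, Matrix.smul_mul, Matrix.mul_smul, K.M_mul, smul_smul,
      smul_smul, smul_smul] at h1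
    have h2 := smul_left_injective ℂ (K.ne_zero (g * h)) h1
    apply CUnits.val_injective
    simp only [CUnits.val_mul, CUnits.val_smul, CUnits.val_mk0]
    linear_combination -h2

/-- The homomorphism `ψ` and the class of `c` are determined by the algebra. -/
lemma unique [Nonempty n] [Nonempty m] {θ' : A.carrier ≃ₐ[ℂ] Matrix m m ℂ}
    (K : MatrixModel A θ c ψ) (K' : MatrixModel A θ' d χ) :
    ψ = χ ∧ H2Phi.mk φ K.isMulCocycle₂ = H2Phi.mk φ K'.isMulCocycle₂ := by
  obtain ⟨T, T', h₁, h₂, h⟩ := exists_matrix_conj (θ.symm.trans θ')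
  exact (K.conj T T' h₁ h₂ fun a => by simpa using h (θ a)).unique_of_same K'

end MatrixModel

/-! ### Existence of matrix models (Skolem–Noether) -/

section existence

variable {A : MagAlg φ} {n : Type} [Fintype n] [DecidableEq n]
  (θ : A.carrier ≃ₐ[ℂ] Matrix n n ℂ)

/-- Skolem–Noether gives an invertible `T` implementing the parity. As the parity is an involution,
`T²` is central, hence a nonzero scalar, and dividing `T` by a square root of it gives `Γ`. -/
lemma exists_parity_matrix [Nonempty n] :
    ∃ Γ : Matrix n n ℂ, Γ * Γ = 1 ∧ ∀ a, θ (A.parity a) * Γ = Γ * θ a := by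
  obtain ⟨T, T', h₁, h₂, h⟩ := exists_matrix_conj ((θ.symm.trans A.parityEquiv).trans θ)
  have hT : ∀ a, θ (A.parity a) * T = T * θ a := by
    intro a
    have := h (θ a)
    simp only [AlgEquiv.trans_apply, AlgEquiv.symm_apply_apply, parityEquiv_apply] at this
    rw [this, Matrix.mul_assoc, h₂, Matrix.mul_one]
  obtain ⟨s, hs⟩ := eq_smul_one_of_commute (X := T * T) fun Z => by
    obtain ⟨a, rfl⟩ := θ.surjective Z
    rw [Matrix.mul_assoc, ← hT, ← Matrix.mul_assoc, ← hT, parity_parity, Matrix.mul_assoc]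
  have hs0 : s ≠ 0 := by
    rintro rfl
    have h3 : T' * T' * (T * T) = 0 := by rw [hs, zero_smul, Matrix.mul_zero]
    have h4 : T' * T' * (T * T) = T' * (T' * T) * T := by simp only [Matrix.mul_assoc]
    rw [h4, h₂, Matrix.mul_one, h₂] at h3
    exact one_ne_zero h3
  obtain ⟨r, hr⟩ := IsAlgClosed.exists_pow_nat_eq s two_pos
  have hr0 : r ≠ 0 := by
    rintro rfl
    exact hs0 (by rw [← hr]; simp)
  refine ⟨r⁻¹ • T, ?_, fun a => by rw [Matrix.mul_smul, Matrix.smul_mul, hT]⟩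
  rw [Matrix.mul_smul, Matrix.smul_mul, hs, smul_smul, smul_smul, ← hr]
  have : r⁻¹ * r⁻¹ * r ^ 2 = 1 := by field_simp
  rw [this, one_smul]

/-- Precomposing the action of `g` with entrywise `𝕂^{φ(g)}` gives a `ℂ`-linear automorphism, to
which Skolem–Noether applies. -/
lemma exists_action_matrix (g : G) :
    ∃ M : Matrix n n ℂ, IsUnit M ∧ ∀ a, θ (A.act g a) * M = M * (θ a).map (conjPow φ g) := by
  let L : Matrix n n ℂ ≃+* Matrix n n ℂ :=
    (RingEquiv.ofRingHom (conjPow φ g).mapMatrix (conjPow φ g).mapMatrix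
      (RingHom.ext fun X => map_conj_conj g X) (RingHom.ext fun X => map_conj_conj g X)).trans
      ((θ.symm.toRingEquiv.trans (A.act g)).trans θ.toRingEquiv)
  have hL : ∀ X, L X = θ (A.act g (θ.symm (X.map (conjPow φ g)))) := fun _ => rfl
  have hsmul : ∀ (z : ℂ) X, L (z • X) = z • L X := fun z X => by
    rw [hL, hL, map_conj_smul, map_smul, A.act_smul, conjPow_conjPow, map_smul]
  obtain ⟨T, T', h₁, h₂, h⟩ := exists_matrix_conj
    (AlgEquiv.ofLinearEquiv { L with map_smul' := hsmul } (map_one L) (map_mul L))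
  refine ⟨T, ⟨⟨T, T', h₁, h₂⟩, rfl⟩, fun a => ?_⟩
  have h3 : L ((θ a).map (conjPow φ g)) = T * (θ a).map (conjPow φ g) * T' := h _
  rw [hL, map_conj_conj, AlgEquiv.symm_apply_apply] at h3
  rw [h3, Matrix.mul_assoc, h₂, Matrix.mul_one]

/-- Every identification of an algebra with a matrix algebra comes from a matrix model. -/
lemma exists_matrixModel [Nonempty n] : ∃ c ψ, Nonempty (MatrixModel A θ c ψ) := by
  obtain ⟨Γ, hΓ, hΓθ⟩ := exists_parity_matrix θ
  choose M hM hMθ using exists_action_matrix θ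
  have hΓu : IsUnit Γ := ⟨⟨Γ, Γ, hΓ, hΓ⟩, rfl⟩
  have hM0 : ∀ g, M g ≠ 0 := fun g => (hM g).ne_zero
  -- Both matrices implement the action of `gh`, so they are proportional.
  have hMM : ∀ g h, ∃ s : ℂ, M g * (M h).map (conjPow φ g) = s • M (g * h) := by
    intro g h
    refine eq_smul_of_intertwine
      (σ := fun Z => θ (A.act (g * h) (θ.symm (Z.map (conjPow φ (g * h))))))
      (fun Z => ?_) (fun Z => ?_) (hM _) <;>
    obtain ⟨a, rfl⟩ : ∃ a, (θ a).map (conjPow φ (g * h)) = Z :=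
      ⟨θ.symm (Z.map (conjPow φ (g * h))), by rw [AlgEquiv.apply_symm_apply, map_conj_conj]⟩ <;>
    simp only [map_conj_conj, AlgEquiv.symm_apply_apply]
    · rw [map_mul A.act g h, RingAut.mul_apply, ← Matrix.mul_assoc, hMθ, map_conj_mul,
        Matrix.mul_assoc, Matrix.mul_assoc, ← Matrix.map_mul, ← Matrix.map_mul, hMθ]
    · rw [hMθ]
  -- The action preserves degrees, hence commutes with the parity, so both products implement the
  -- same map.
  have hMΓ : ∀ g, ∃ s : ℂ, M g * Γ.map (conjPow φ g) = s • (Γ * M g) := by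
    intro g
    refine eq_smul_of_intertwine
      (σ := fun Z => θ (A.parity (A.act g (θ.symm (Z.map (conjPow φ g))))))
      (fun Z => ?_) (fun Z => ?_) (hΓu.mul (hM g)) <;>
    obtain ⟨a, rfl⟩ : ∃ a, (θ a).map (conjPow φ g) = Z :=
      ⟨θ.symm (Z.map (conjPow φ g)), by rw [AlgEquiv.apply_symm_apply, map_conj_conj]⟩ <;>
    simp only [map_conj_conj, AlgEquiv.symm_apply_apply]
    · rw [← act_parity, ← Matrix.mul_assoc, hMθ, Matrix.mul_assoc, Matrix.mul_assoc,
        ← Matrix.map_mul, ← Matrix.map_mul, hΓθ]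
    · rw [← Matrix.mul_assoc, hΓθ, Matrix.mul_assoc, Matrix.mul_assoc, hMθ]
  choose c hc using hMM
  choose s hs using hMΓ
  have hc0 : ∀ g h, c g h ≠ 0 := by
    intro g h h0
    apply ((hM g).mul (isUnit_map_conj (φ := φ) g (hM h))).ne_zero
    rw [hc, h0, zero_smul]
  have hΓM : ∀ g, Γ * M g ≠ 0 := fun g => (hΓu.mul (hM g)).ne_zero
  -- Passing `M g` across `Γ` twice uses `Γ² = 1`; so the scalar is a sign.
  have hs2 : ∀ g, s g * s g = 1 := by
    intro g
    have h : M g * Γ.map (conjPow φ g) * Γ.map (conjPow φ g) = M g := by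
      rw [Matrix.mul_assoc, ← Matrix.map_mul, hΓ, map_conj_one, Matrix.mul_one]
    rw [hs, Matrix.smul_mul, Matrix.mul_assoc, hs, Matrix.mul_smul, ← Matrix.mul_assoc, hΓ,
      Matrix.one_mul, smul_smul] at h
    nth_rw 2 [← one_smul ℂ (M g)] at h
    exact smul_left_injective ℂ (hM0 g) h
  have hsgn : ∀ g, ∃ t : ZMod 2, s g = (sgn t : ℂ) := by
    intro g
    rcases mul_self_eq_one_iff.1 (hs2 g) with h | h
    · exact ⟨0, by simp [h]⟩
    · exact ⟨1, by simp [h]⟩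
  choose t ht using hsgn
  -- Move `Γ` across `M_g M_h` one factor at a time and, alternatively, across `c(g,h) M_{gh}`. The
  -- signs are fixed by conjugation and therefore multiply.
  have hmul : ∀ g h, t (g * h) = t g + t h := by
    intro g h
    have h1 : M g * (M h * Γ.map (conjPow φ h)).map (conjPow φ g) =
        (M g * (M h).map (conjPow φ g)) * Γ.map (conjPow φ (g * h)) := by
      rw [Matrix.map_mul, map_conj_mul, Matrix.mul_assoc]
    rw [hs, hc, map_conj_smul, Matrix.map_mul, Matrix.mul_smul, ← Matrix.mul_assoc, hs,
      Matrix.smul_mul, Matrix.mul_assoc, hc, Matrix.smul_mul, hs, Matrix.mul_smul, smul_smul,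
      smul_smul, smul_smul, ht, ht, ht, conjPow_sgn] at h1
    have h2 := smul_left_injective ℂ (hΓM (g * h)) h1
    apply sgn_injective
    simp only [sgn_add, Units.val_mul]
    apply mul_left_cancel₀ (hc0 g h)
    linear_combination -h2
  exact ⟨fun p => CUnits.mk0 (c p.1 p.2) (hc0 _ _),
    MonoidHom.mk' (fun g => Multiplicative.ofAdd (t g)) fun g h => congrArg _ (hmul g h),
    ⟨{ Γ := Γ, M := M, isUnit := hM, Γ_mul_self := hΓ, θ_parity := hΓθ, θ_act := hMθ
       M_mul := hc
       M_Γ := fun g => by rw [hs, ht]; rfl }⟩⟩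

end existence

/-! ### The matrix model of a graded tensor product -/

namespace MatrixModel

variable {A B : MagAlg φ} {n m : Type} [Fintype n] [DecidableEq n] [Fintype m] [DecidableEq m]
  {θ : A.carrier ≃ₐ[ℂ] Matrix n n ℂ} {η : B.carrier ≃ₐ[ℂ] Matrix m m ℂ}
  {c d : G × G → CUnits φ} {ψ χ : G →* Multiplicative (ZMod 2)}

section

variable (K : MatrixModel A θ c ψ)

/-- The power `Γ^s` for `s : ℤ/2`. -/
def Γpow (s : ZMod 2) : Matrix n n ℂ := K.Γ ^ s.val

@[simp] lemma Γpow_zero : K.Γpow 0 = 1 := pow_zero _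

@[simp] lemma Γpow_one : K.Γpow 1 = K.Γ := pow_one _

lemma Γpow_add (s t : ZMod 2) : K.Γpow (s + t) = K.Γpow s * K.Γpow t := by
  rcases zmod_two_eq s with rfl | rfl <;> rcases zmod_two_eq t with rfl | rfl <;>
    simp [zmod_two_one_add_one, K.Γ_mul_self]

lemma Γpow_mul_self (s : ZMod 2) : K.Γpow s * K.Γpow s = 1 := by
  rw [← Γpow_add, show s + s = 0 by revert s; decide, Γpow_zero]

lemma Γ_mul_Γpow (s : ZMod 2) : K.Γ * K.Γpow s = K.Γpow s * K.Γ := by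
  rw [← Γpow_one, ← Γpow_add, ← Γpow_add, add_comm]

lemma Γpow_mul_θ (s : ZMod 2) {i : ZMod 2} {a : A.carrier} (ha : a ∈ A.grading i) :
    K.Γpow s * θ a = (sgn (s * i) : ℂ) • (θ a * K.Γpow s) := by
  rcases zmod_two_eq s with rfl | rfl
  · simp
  · rw [one_mul, Γpow_one, ← K.θ_parity, A.parity_of_mem ha, map_smul, Matrix.smul_mul]

lemma M_mul_map_Γpow (g : G) (s : ZMod 2) :
    K.M g * (K.Γpow s).map (conjPow φ g) =
      (sgn (s * (ψ g).toAdd) : ℂ) • (K.Γpow s * K.M g) := by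
  rcases zmod_two_eq s with rfl | rfl
  · simp
  · rw [one_mul, Γpow_one, K.M_Γ]

/-- The involution `a ⊗ Y ↦ a ⊗ Γ^{∂a} Y`. -/
def twist (A : MagAlg φ) (L : MatrixModel B η d χ) :
    A.carrier ⊗[ℂ] Matrix m m ℂ →ₗ[ℂ] A.carrier ⊗[ℂ] Matrix m m ℂ :=
  TensorProduct.map ((1 / 2 : ℂ) • (LinearMap.id + A.parity)) LinearMap.id +
    TensorProduct.map ((1 / 2 : ℂ) • (LinearMap.id - A.parity)) (LinearMap.mulLeft ℂ L.Γ)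

lemma twist_tmul (L : MatrixModel B η d χ) {i : ZMod 2} {a : A.carrier} (ha : a ∈ A.grading i)
    (Y : Matrix m m ℂ) : twist A L (a ⊗ₜ Y) = a ⊗ₜ (L.Γpow i * Y) := by
  have h : (2⁻¹ : ℂ) • a + (2⁻¹ : ℂ) • a = a := by module
  rcases zmod_two_eq i with rfl | rfl <;> simp [twist, A.parity_of_mem ha, h]

lemma twist_involutive (A : MagAlg φ) (L : MatrixModel B η d χ) :
    Function.Involutive (twist A L) := by
  intro x
  induction x using TensorProduct.induction_on with
  | zero => simp
  | add x y hx hy => rw [map_add, map_add, hx, hy]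
  | tmul a Y =>
    refine A.homogeneous_induction (P := fun a => twist A L (twist A L (a ⊗ₜ Y)) = a ⊗ₜ Y)
      (fun x y hx hy => ?_) (fun i a ha => ?_) a
    · rw [TensorProduct.add_tmul, map_add, map_add, hx, hy]
    · rw [twist_tmul L ha, twist_tmul L ha, ← Matrix.mul_assoc, Γpow_mul_self, Matrix.one_mul]

/-- The linear equivalence `a ⊗ b ↦ θ(a) ⊗ Γ^{∂a} η(b)`. -/
def tensorLinearEquiv (θ : A.carrier ≃ₐ[ℂ] Matrix n n ℂ) (L : MatrixModel B η d χ) :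
    (A.tensor B).carrier ≃ₗ[ℂ] Matrix (n × m) (n × m) ℂ :=
  (tmEquiv A B).symm ≪≫ₗ
    TensorProduct.congr (LinearEquiv.refl ℂ A.carrier) η.toLinearEquiv ≪≫ₗ
    LinearEquiv.ofInvolutive (twist A L) (twist_involutive A L) ≪≫ₗ
    TensorProduct.congr θ.toLinearEquiv (LinearEquiv.refl ℂ (Matrix m m ℂ)) ≪≫ₗ
    kroneckerLinearEquiv n n m m ℂ

lemma tensorLinearEquiv_tm (θ : A.carrier ≃ₐ[ℂ] Matrix n n ℂ) (L : MatrixModel B η d χ)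
    {i : ZMod 2} {a : A.carrier} (ha : a ∈ A.grading i) (b : B.carrier) :
    tensorLinearEquiv θ L (tm a b) = θ a ⊗ₖ (L.Γpow i * η b) := by
  have h : tensorLinearEquiv θ L (tm a b) = kroneckerLinearEquiv n n m m ℂ
    (TensorProduct.congr θ.toLinearEquiv (LinearEquiv.refl ℂ (Matrix m m ℂ))
      (twist A L (a ⊗ₜ η b))) := rfl
  rw [h, twist_tmul L ha]
  exact kroneckerLinearEquiv_tmul _ _

lemma tensorLinearEquiv_mul (θ : A.carrier ≃ₐ[ℂ] Matrix n n ℂ) (L : MatrixModel B η d χ)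
    (x y : (A.tensor B).carrier) : tensorLinearEquiv θ L (x * y) =
      tensorLinearEquiv θ L x * tensorLinearEquiv θ L y := by
  refine tm_induction (P := fun x => tensorLinearEquiv θ L (x * y) = tensorLinearEquiv θ L x * _)
    (fun x x' hx hx' => ?_) (fun i j a ha b hb => ?_) x
  · rw [add_mul, map_add, map_add, add_mul, hx, hx']
  refine tm_induction (P := fun y => tensorLinearEquiv θ L (_ * y) = _ * tensorLinearEquiv θ L y)
    (fun y y' hy hy' => ?_) (fun i' j' a' ha' b' hb' => ?_) y
  · rw [mul_add, map_add, map_add, mul_add, hy, hy']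
  -- Moving `Γ^{∂a'}` past `η b` produces exactly the sign `(-1)^{∂a' ∂b}` of the graded product.
  · have h : η b * L.Γpow i' = (sgn (j * i') : ℂ) • (L.Γpow i' * η b) := by
      rw [L.Γpow_mul_θ i' hb, smul_smul, mul_comm j, sgn_mul_self, one_smul]
    rw [tm_mul_tm a hb ha' b', map_smul, tensorLinearEquiv_tm θ L ha,
      tensorLinearEquiv_tm θ L ha', tensorLinearEquiv_tm θ L (A.mul_mem_add ha ha'),
      ← Matrix.mul_kronecker_mul, map_mul, map_mul, Matrix.mul_assoc (L.Γpow i),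
      ← Matrix.mul_assoc (η b), h, Matrix.smul_mul, Matrix.mul_smul, Matrix.kronecker_smul,
      Γpow_add, Matrix.mul_assoc, Matrix.mul_assoc]

/-- The identification of `A ⊗̂ B` with a matrix algebra. -/
def tensorθ (θ : A.carrier ≃ₐ[ℂ] Matrix n n ℂ) (L : MatrixModel B η d χ) :
    (A.tensor B).carrier ≃ₐ[ℂ] Matrix (n × m) (n × m) ℂ :=
  AlgEquiv.ofLinearEquiv (tensorLinearEquiv θ L)
    (by rw [one_def, tensorLinearEquiv_tm θ L A.one_mem_zero, map_one, map_one, Γpow_zero,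
          Matrix.one_mul, Matrix.one_kronecker_one])
    (tensorLinearEquiv_mul θ L)

lemma tensorθ_tm (θ : A.carrier ≃ₐ[ℂ] Matrix n n ℂ) (L : MatrixModel B η d χ)
    {i : ZMod 2} {a : A.carrier} (ha : a ∈ A.grading i) (b : B.carrier) :
    tensorθ θ L (tm a b) = θ a ⊗ₖ (L.Γpow i * η b) :=
  tensorLinearEquiv_tm θ L ha b

lemma isUnit_kronecker {X : Matrix n n ℂ} {Y : Matrix m m ℂ} (hX : IsUnit X) (hY : IsUnit Y) :
    IsUnit (X ⊗ₖ Y) := by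
  obtain ⟨u, rfl⟩ := hX
  obtain ⟨v, rfl⟩ := hY
  refine IsUnit.of_mul_eq_one ((↑u⁻¹ : Matrix n n ℂ) ⊗ₖ (↑v⁻¹ : Matrix m m ℂ)) ?_
  rw [← Matrix.mul_kronecker_mul, Units.mul_inv, Units.mul_inv, Matrix.one_kronecker_one]

/-- The matrix model of a graded tensor product. -/
def tensor (K : MatrixModel A θ c ψ) (L : MatrixModel B η d χ) :
    MatrixModel (A.tensor B) (tensorθ θ L) (signCup φ ψ χ * c * d) (ψ * χ) where
  Γ := K.Γ ⊗ₖ L.Γ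
  -- The second action matrix commutes with the factor `Γ^{∂a}` in `θ(a) ⊗ Γ^{∂a} η(b)` only up to
  -- `(-1)^{χ(g) ∂a}`. Conjugation by the involution of the first model raised to `χ(g)` cancels
  -- this sign.
  M g := (K.Γpow (χ g).toAdd * K.M g) ⊗ₖ L.M g
  isUnit g := isUnit_kronecker ((K.isUnit_Γ.pow _).mul (K.isUnit g)) (L.isUnit g)
  Γ_mul_self := by
    rw [← Matrix.mul_kronecker_mul, K.Γ_mul_self, L.Γ_mul_self, Matrix.one_kronecker_one]
  θ_parity x := by
    refine tm_induction (P := fun x => tensorθ θ L (parity _ x) * _ = _ * tensorθ θ L x)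
      (fun x x' hx hx' => ?_) (fun i j a ha b hb => ?_) x
    · rw [map_add, map_add, map_add, add_mul, mul_add, hx, hx']
    · have h : η (B.parity b) * L.Γ = L.Γ * η b := L.θ_parity b
      have ha' : A.parity a ∈ A.grading i := by
        rw [A.parity_of_mem ha]; exact Submodule.smul_mem _ _ ha
      rw [parity_tm, tensorθ_tm θ L ha', tensorθ_tm θ L ha, ← Matrix.mul_kronecker_mul,
        ← Matrix.mul_kronecker_mul, K.θ_parity, Matrix.mul_assoc, h, ← Matrix.mul_assoc,
        ← Matrix.mul_assoc, L.Γ_mul_Γpow]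
  θ_act g x := by
    refine tm_induction (P := fun x => tensorθ θ L (act _ g x) * _ =
        _ * (tensorθ θ L x).map (conjPow φ g))
      (fun x x' hx hx' => ?_) (fun i j a ha b hb => ?_) x
    · rw [map_add, map_add, map_add, add_mul, map_conj_add, mul_add, hx, hx']
    · have h1 : θ (A.act g a) * K.Γpow (χ g).toAdd =
          (sgn (i * (χ g).toAdd) : ℂ) • (K.Γpow (χ g).toAdd * θ (A.act g a)) := by
        rw [K.Γpow_mul_θ _ (A.act_mem g i a ha), smul_smul, mul_comm i, sgn_mul_self, one_smul]
      rw [act_tm, tensorθ_tm θ L ha, tensorθ_tm θ L (A.act_mem g i a ha), map_conj_kronecker,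
        ← Matrix.mul_kronecker_mul, ← Matrix.mul_kronecker_mul, Matrix.map_mul,
        ← Matrix.mul_assoc (L.M g), L.M_mul_map_Γpow, Matrix.smul_mul, Matrix.kronecker_smul,
        Matrix.mul_assoc (L.Γpow i), L.θ_act, ← Matrix.mul_assoc (θ _), h1, Matrix.smul_mul,
        Matrix.smul_kronecker, Matrix.mul_assoc (K.Γpow _), K.θ_act]
      simp only [Matrix.mul_assoc]
  M_mul g h := by
    -- The cup product sign arises here, from moving `M_g` past `Γ^{χ(h)}`.
    have h1 : (K.Γpow (χ g).toAdd * K.M g) *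
        ((K.Γpow (χ h).toAdd * K.M h).map (conjPow φ g)) =
        ((sgn ((ψ g).toAdd * (χ h).toAdd) : ℂ) * (c (g, h)).val) •
          (K.Γpow (χ (g * h)).toAdd * K.M (g * h)) := by
      rw [Matrix.map_mul, Matrix.mul_assoc, ← Matrix.mul_assoc (K.M g), K.M_mul_map_Γpow,
        Matrix.smul_mul, Matrix.mul_smul, Matrix.mul_assoc (K.Γpow _) (K.M g), K.M_mul,
        Matrix.mul_smul, Matrix.mul_smul, smul_smul, ← Matrix.mul_assoc, map_mul, toAdd_mul,
        Γpow_add, mul_comm (χ h).toAdd]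
    rw [map_conj_kronecker, ← Matrix.mul_kronecker_mul, h1, L.M_mul, Matrix.smul_kronecker,
      Matrix.kronecker_smul, smul_smul]
    rfl
  M_Γ g := by
    have h1 : K.Γpow (χ g).toAdd * K.M g * K.Γ.map (conjPow φ g) =
        (sgn (ψ g).toAdd : ℂ) • (K.Γ * (K.Γpow (χ g).toAdd * K.M g)) := by
      rw [Matrix.mul_assoc, K.M_Γ, Matrix.mul_smul, ← Matrix.mul_assoc, ← Matrix.mul_assoc,
        Γ_mul_Γpow]
    rw [map_conj_kronecker, ← Matrix.mul_kronecker_mul, ← Matrix.mul_kronecker_mul, h1, L.M_Γ,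
      Matrix.smul_kronecker, Matrix.kronecker_smul, smul_smul, MonoidHom.mul_apply, toAdd_mul,
      sgn_add, Units.val_mul]

end

end MatrixModel

/-! ### The type of an algebra whose underlying algebra is a matrix algebra -/

/-- The algebra `A` is a full matrix algebra, and `x` consists of the class of the factor set of the
action of `G`, of the homomorphism that describes the action on the grading operator, and of `0`. -/
def HasEvenType (A : MagAlg φ) (x : TwistedProduct φ) : Prop :=
  x.a = 0 ∧ ∃ (c : G × G → CUnits φ) (hc : IsMulCocycle₂ c), H2Phi.mk φ hc = x.lam ∧
    ∃ (n : Type) (_ : Fintype n) (_ : DecidableEq n) (_ : Nonempty n)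
      (θ : A.carrier ≃ₐ[ℂ] Matrix n n ℂ), Nonempty (MatrixModel A θ c x.psi)

lemma MatrixModel.hasEvenType {A : MagAlg φ} {n : Type} [Fintype n] [DecidableEq n] [Nonempty n]
    {θ : A.carrier ≃ₐ[ℂ] Matrix n n ℂ} {c : G × G → CUnits φ}
    {ψ : G →* Multiplicative (ZMod 2)} (K : MatrixModel A θ c ψ) :
    HasEvenType A ⟨H2Phi.mk φ K.isMulCocycle₂, ψ, 0⟩ :=
  ⟨rfl, c, K.isMulCocycle₂, rfl, n, inferInstance, inferInstance, inferInstance, θ, ⟨K⟩⟩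

namespace HasEvenType

variable {A B : MagAlg φ} {x y : TwistedProduct φ}

lemma of_iso (h : HasEvenType A x) (e : Iso B A) : HasEvenType B x := by
  obtain ⟨ha, c, hc, hl, n, _, _, _, θ, ⟨K⟩⟩ := h
  exact ⟨ha, c, hc, hl, n, inferInstance, inferInstance, inferInstance, _, ⟨K.ofIso e⟩⟩

lemma unique (h : HasEvenType A x) (h' : HasEvenType A y) : x = y := by
  obtain ⟨ha, c, hc, hl, n, _, _, _, θ, ⟨K⟩⟩ := h
  obtain ⟨ha', d, hd, hl', m, _, _, _, η, ⟨L⟩⟩ := h'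
  obtain ⟨h1, h2⟩ := K.unique L
  exact TwistedProduct.ext (hl ▸ hl' ▸ h2) h1 (ha.trans ha'.symm)

lemma tensor (h : HasEvenType A x) (h' : HasEvenType B y) :
    HasEvenType (A.tensor B) (x * y) := by
  obtain ⟨ha, c, hc, hl, n, _, _, _, θ, ⟨K⟩⟩ := h
  obtain ⟨ha', d, hd, hl', m, _, _, _, η, ⟨L⟩⟩ := h'
  have hx : x * y = ⟨H2Phi.mk φ (K.tensor L).isMulCocycle₂, x.psi * y.psi, 0⟩ := by
    ext1
    · rw [TwistedProduct.mul_lam, ha, ha', ← hl, ← hl']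
      have hs : IsMulCocycle₂ (signCup φ x.psi y.psi * c) := fun g h j => by
        have h1 := isMulCocycle₂_signCup φ x.psi y.psi g h j
        have h2 := hc g h j
        simp only [Pi.mul_apply, smul_mul']
        rw [mul_mul_mul_comm, h1, h2, mul_mul_mul_comm]
      have e₁ := H2Phi.mk_add φ hs hd (K.tensor L).isMulCocycle₂ fun p => rfl
      have e₂ := H2Phi.mk_add φ (isMulCocycle₂_signCup φ x.psi y.psi) hc hs fun p => rfl
      -- Both last components are `0`, so the terms involving `φ^{a₀a₁}` disappear.
      simp only [mul_zero, ZMod.val_zero, pow_zero, cupClass_one_right, add_zero]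
      exact (congrArg (· + H2Phi.mk φ hd) e₂).trans e₁
    · simp [ha, ha']
    · simp [ha, ha']
  rw [hx]
  exact (K.tensor L).hasEvenType

lemma isSimpleRing (h : HasEvenType A x) : IsSimpleRing A.carrier := by
  obtain ⟨ha, c, hc, hl, n, _, _, _, θ, ⟨K⟩⟩ := h
  exact IsSimpleRing.of_ringEquiv θ.symm.toRingEquiv inferInstance

/-- The dimension is a nonzero square; this later keeps matrix algebras apart from those that need a
factor `α(1)`. -/
lemma finrank_eq (h : HasEvenType A x) :
    ∃ k : ℕ, k ≠ 0 ∧ Module.finrank ℂ A.carrier = k * k := by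
  obtain ⟨ha, c, hc, hl, n, _, _, _, θ, ⟨K⟩⟩ := h
  refine ⟨Fintype.card n, Fintype.card_ne_zero, ?_⟩
  rw [θ.toLinearEquiv.finrank_eq, Module.finrank_matrix, Module.finrank_self, mul_one]

/-- Wedderburn's theorem over an algebraically closed field, followed by `exists_matrixModel`. -/
lemma exists_of_isSimpleRing (A : MagAlg φ) [IsSimpleRing A.carrier] : ∃ x, HasEvenType A x := by
  obtain ⟨n, hn, ⟨θ⟩⟩ := IsSimpleRing.exists_algEquiv_matrix_of_isAlgClosed ℂ A.carrier
  obtain ⟨c, ψ, ⟨K⟩⟩ := exists_matrixModel θ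
  exact ⟨_, K.hasEvenType⟩

end HasEvenType

/-! ### Central simple graded algebras -/

namespace MagAlg

variable {A B : MagAlg φ}

lemma IsCentralSimple.of_supercentral [Nontrivial A.carrier]
    (hs : ∀ I : Ideal A.carrier, I.IsTwoSided → I.IsHomogeneous A.grading → I = ⊥ ∨ I = ⊤)
    (hc : ∀ i, ∀ a ∈ A.grading i,
      (∀ j, ∀ b ∈ A.grading j, a * b = (sgn (i * j) : ℂ) • (b * a)) → ∃ z : ℂ, a = z • 1) :
    A.IsCentralSimple where
  nontrivial := inferInstance
  simple := hs
  central := by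
    apply le_antisymm
    · refine Submodule.span_le.2 ?_
      rintro a ⟨i, ha, h⟩
      obtain ⟨z, rfl⟩ := hc i a ha h
      exact ⟨z, by simp [Algebra.algebraMap_eq_smul_one]⟩
    · rintro _ ⟨z, rfl⟩
      rw [Algebra.linearMap_apply, Algebra.algebraMap_eq_smul_one]
      refine Submodule.smul_mem _ z (Submodule.subset_span ⟨0, A.one_mem_zero, ?_⟩)
      intro j b hb
      simp

lemma IsCentralSimple.exists_eq_smul_one (hA : A.IsCentralSimple) {i : ZMod 2} {a : A.carrier}
    (ha : a ∈ A.grading i) (h : ∀ j, ∀ b ∈ A.grading j, a * b = (sgn (i * j) : ℂ) • (b * a)) :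
    ∃ z : ℂ, a = z • 1 := by
  have h1 : a ∈ A.gradedCenter := Submodule.subset_span ⟨i, ha, h⟩
  rw [hA.central] at h1
  obtain ⟨z, rfl⟩ := h1
  exact ⟨z, by simp [Algebra.algebraMap_eq_smul_one]⟩

/-- The homogeneous components of `a` are half the sum and half the difference of `a` and its parity
image. -/
lemma isHomogeneous_of_parity {I : Ideal A.carrier} (h : ∀ a ∈ I, A.parity a ∈ I) :
    I.IsHomogeneous A.grading := by
  intro i a ha
  obtain ⟨x, hx, y, hy, hxy⟩ : ∃ x ∈ A.grading 0, ∃ y ∈ A.grading 1, x + y = a := A.exists_add a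
  have hpar := h a ha
  have h1 : x = (1 / 2 : ℂ) • (a + A.parity a) := by
    rw [← hxy, map_add, A.parity_of_mem hx, A.parity_of_mem hy, sgn_zero, sgn_one, Units.val_neg,
      Units.val_one]
    module
  have h2 : y = (1 / 2 : ℂ) • (a - A.parity a) := by
    rw [← hxy, map_add, A.parity_of_mem hx, A.parity_of_mem hy, sgn_zero, sgn_one, Units.val_neg,
      Units.val_one]
    module
  rcases zmod_two_eq i with rfl | rfl
  · rw [← hxy, DirectSum.decompose_add, DirectSum.add_apply, Submodule.coe_add,
      DirectSum.decompose_of_mem_same _ hx, DirectSum.decompose_of_mem_ne _ hy one_ne_zero,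
      add_zero, h1]
    exact Submodule.smul_of_tower_mem I _ (I.add_mem ha hpar)
  · rw [← hxy, DirectSum.decompose_add, DirectSum.add_apply, Submodule.coe_add,
      DirectSum.decompose_of_mem_same _ hy, DirectSum.decompose_of_mem_ne _ hx zero_ne_one,
      zero_add, h2]
    exact Submodule.smul_of_tower_mem I _ (I.sub_mem ha hpar)

end MagAlg

/-- A matrix algebra has no proper nonzero two-sided ideals at all, so only the graded center
matters. An even supercentral element is central, hence scalar. If `a` is odd and supercentral, then
`Γ a` is central, so `a` is a multiple of `Γ`; but `Γ` commutes with itself while it must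
anticommute with `a`, so `a = 0`. -/
lemma HasEvenType.isCentralSimple {A : MagAlg φ} {x : TwistedProduct φ} (h : HasEvenType A x) :
    A.IsCentralSimple := by
  obtain ⟨hn, hs⟩ := isSimpleRing_iff_isTwoSided_imp.1 h.isSimpleRing
  refine IsCentralSimple.of_supercentral (fun I hI _ => hs I hI) fun i a ha h' => ?_
  obtain ⟨-, c, hc, hl, n, _, _, _, θ, ⟨K⟩⟩ := h
  have hcen : ∀ Y : Matrix n n ℂ, (∀ j, ∀ b ∈ A.grading j, Y * θ b = θ b * Y) →
      ∃ s : ℂ, Y = s • 1 := by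
    intro Y hY
    refine eq_smul_one_of_commute fun Z => ?_
    obtain ⟨b, rfl⟩ := θ.surjective Z
    refine A.homogeneous_induction (P := fun b => Y * θ b = θ b * Y) (fun u v hu hv => ?_)
      (fun j b hb => hY j b hb) b
    rw [map_add, mul_add, add_mul, hu, hv]
  rcases zmod_two_eq i with rfl | rfl
  · obtain ⟨s, hs⟩ := hcen (θ a) fun j b hb => by
      rw [← map_mul, h' j b hb, zero_mul, sgn_zero, Units.val_one, one_smul, map_mul]
    exact ⟨s, θ.injective (by rw [hs, map_smul, map_one])⟩
  · obtain ⟨s, hs⟩ := hcen (K.Γ * θ a) fun j b hb => by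
      have h1 := K.Γpow_mul_θ 1 hb
      rw [K.Γpow_one, one_mul] at h1
      rw [mul_assoc, ← map_mul, h' j b hb, one_mul, map_smul, map_mul, Matrix.mul_smul,
        ← mul_assoc, h1, Matrix.smul_mul, smul_smul, sgn_mul_self, one_smul, mul_assoc]
    have h2 : θ a = s • K.Γ := by
      have h3 : K.Γ * (K.Γ * θ a) = θ a := by rw [← mul_assoc, K.Γ_mul_self, one_mul]
      rw [← h3, hs, Matrix.mul_smul, mul_one]
    have h4 := K.Γpow_mul_θ 1 ha
    rw [K.Γpow_one, one_mul, hs, h2, Matrix.smul_mul, K.Γ_mul_self, smul_smul, sgn_one] at h4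
    have h5 := smul_left_injective ℂ (one_ne_zero (α := Matrix n n ℂ)) h4
    have h6 : s = 0 := by
      simp only [Units.val_neg, Units.val_one] at h5
      linear_combination (1 / 2 : ℂ) * h5
    refine ⟨0, θ.injective ?_⟩
    rw [h2, h6, zero_smul, zero_smul, map_zero]

/-! ### Central simplicity of a tensor factor, and algebras whose ring is not simple -/

namespace MagAlg

variable {A C : MagAlg φ}

/-- The inclusion `a ↦ a ⊗ 1`. -/
def inclLeft (A C : MagAlg φ) : A.carrier →+* (A.tensor C).carrier :=
  GradedTensorProduct.includeLeftRingHom A.grading C.grading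

/-- Evaluating the second factor by a functional with value `1` at `1` gives a linear left inverse
of `a ↦ a ⊗ 1`. -/
lemma exists_retraction (A C : MagAlg φ) [Nontrivial C.carrier] :
    ∃ (L : C.carrier →ₗ[ℂ] ℂ) (R : (A.tensor C).carrier →ₗ[ℂ] A.carrier), L 1 = 1 ∧
      ∀ a c, R (tm a c) = L c • a := by
  obtain ⟨L, hL⟩ := Module.Projective.exists_dual_eq_one ℂ (one_ne_zero (α := C.carrier))
  refine ⟨L, (TensorProduct.rid ℂ A.carrier).toLinearMap ∘ₗ TensorProduct.map LinearMap.id L ∘ₗ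
    (tmEquiv A C).symm.toLinearMap, hL, fun a c => ?_⟩
  simp

lemma tm_mem_induction {k : ZMod 2} {P : (A.tensor C).carrier → Prop} (h0 : P 0)
    (hadd : ∀ x y, P x → P y → P (x + y)) (hsmul : ∀ (z : ℂ) x, P x → P (z • x))
    (htm : ∀ i j, i + j = k → ∀ a ∈ A.grading i, ∀ b ∈ C.grading j, P (tm a b))
    {x : (A.tensor C).carrier} (hx : x ∈ (A.tensor C).grading k) : P x := by
  change x ∈ tensorGrading A C k at hx
  induction hx using Submodule.span_induction with
  | zero => exact h0
  | add x y _ _ hx hy => exact hadd x y hx hy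
  | smul z x _ hx => exact hsmul z x hx
  | mem x hx =>
    obtain ⟨i, j, h, a, ha, b, hb, rfl⟩ := hx
    exact htm i j h a ha b hb

/-- If `A ⊗̂ C` is central simple and has a simple underlying ring, then `A` is central simple. -/
lemma IsCentralSimple.of_tensor [Nontrivial C.carrier] (hs : IsSimpleRing (A.tensor C).carrier)
    (hc : (A.tensor C).IsCentralSimple) : A.IsCentralSimple := by
  obtain ⟨L, R, hL, hR⟩ := exists_retraction A C
  have hR1 : ∀ a, R (tm a 1) = a := fun a => by rw [hR, hL, one_smul]
  have hinj : ∀ a b : A.carrier, tm a (1 : C.carrier) = tm b 1 → a = b := fun a b h => by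
    rw [← hR1 a, h, hR1]
  obtain ⟨hn, hs⟩ := isSimpleRing_iff_isTwoSided_imp.1 hs
  have : Nontrivial A.carrier := by
    refine ⟨⟨1, 0, fun h => one_ne_zero (α := (A.tensor C).carrier) ?_⟩⟩
    rw [one_def, h, zero_tm]
  refine IsCentralSimple.of_supercentral (fun I hI hI' => ?_) (fun i a ha h => ?_)
  -- The span of these elements is the ideal `I ⊗ C`. Homogeneous generators are used because the
  -- product formula needs degrees.
  · let gens : Set (A.tensor C).carrier := {x | ∃ i j, ∃ u ∈ A.grading i, ∃ c ∈ C.grading j,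
      u ∈ I ∧ x = tm u c}
    have hl : ∀ y x, x ∈ Submodule.span ℂ gens → y * x ∈ Submodule.span ℂ gens := by
      intro y x hx
      induction hx using Submodule.span_induction with
      | zero => rw [mul_zero]; exact zero_mem _
      | add x₁ x₂ _ _ h₁ h₂ => rw [mul_add]; exact add_mem h₁ h₂
      | smul z x _ h => rw [mul_smul_comm]; exact Submodule.smul_mem _ z h
      | mem x hx =>
        obtain ⟨i, j, u, hu, c, hc, huI, rfl⟩ := hx
        refine tm_induction (P := fun y => y * _ ∈ Submodule.span ℂ gens) (fun y y' hy hy' => ?_)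
          (fun i' j' a ha b hb => ?_) y
        · rw [add_mul]; exact add_mem hy hy'
        · rw [tm_mul_tm a hb hu]
          exact Submodule.smul_mem _ _ (Submodule.subset_span ⟨_, _, _, A.mul_mem_add ha hu, _,
            C.mul_mem_add hb hc, I.mul_mem_left a huI, rfl⟩)
    have hr : ∀ y x, x ∈ Submodule.span ℂ gens → x * y ∈ Submodule.span ℂ gens := by
      intro y x hx
      induction hx using Submodule.span_induction with
      | zero => rw [zero_mul]; exact zero_mem _
      | add x₁ x₂ _ _ h₁ h₂ => rw [add_mul]; exact add_mem h₁ h₂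
      | smul z x _ h => rw [smul_mul_assoc]; exact Submodule.smul_mem _ z h
      | mem x hx =>
        obtain ⟨i, j, u, hu, c, hc, huI, rfl⟩ := hx
        refine tm_induction (P := fun y => _ * y ∈ Submodule.span ℂ gens) (fun y y' hy hy' => ?_)
          (fun i' j' a ha b hb => ?_) y
        · rw [mul_add]; exact add_mem hy hy'
        · rw [tm_mul_tm u hc ha]
          exact Submodule.smul_mem _ _ (Submodule.subset_span ⟨_, _, _, A.mul_mem_add hu ha, _,
            C.mul_mem_add hc hb, I.mul_mem_right a huI, rfl⟩)
    let S : Ideal (A.tensor C).carrier :=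
      { carrier := Submodule.span ℂ gens
        add_mem' := fun h h' => add_mem h h'
        zero_mem' := zero_mem _
        smul_mem' := hl }
    rcases hs S ⟨fun {x} y hx => hr y x hx⟩ with hS | hS
    · left
      rw [eq_bot_iff]
      intro u hu
      have hhom : ∀ i, ∀ v ∈ A.grading i, v ∈ I → v = 0 := by
        intro i v hv hvI
        have h1 : tm v 1 ∈ S := Submodule.subset_span ⟨i, 0, v, hv, 1, C.one_mem_zero, hvI, rfl⟩
        rw [hS, Ideal.mem_bot] at h1
        exact hinj v 0 (by rw [h1, zero_tm])
      classical
      rw [Ideal.mem_bot, ← DirectSum.sum_support_decompose A.grading u]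
      exact Finset.sum_eq_zero fun i _ => hhom i _ (Subtype.prop _) (hI' i hu)
    · right
      rw [Ideal.eq_top_iff_one, ← hR1 1]
      have h1 : (1 : (A.tensor C).carrier) ∈ Submodule.span ℂ gens := by
        have : (1 : (A.tensor C).carrier) ∈ S := hS ▸ Submodule.mem_top
        exact this
      -- The retraction maps `I ⊗ C` into `I`, so `1 ∈ I ⊗ C` gives `1 ∈ I`.
      have h2 : ∀ x ∈ Submodule.span ℂ gens, R x ∈ I := by
        intro x hx
        induction hx using Submodule.span_induction with
        | zero => rw [map_zero]; exact zero_mem _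
        | add x₁ x₂ _ _ h₁ h₂ => rw [map_add]; exact add_mem h₁ h₂
        | smul z x _ h => rw [map_smul]; exact Submodule.smul_of_tower_mem I z h
        | mem x hx =>
          obtain ⟨i, j, u, hu, c, hc, huI, rfl⟩ := hx
          rw [hR]
          exact Submodule.smul_of_tower_mem I _ huI
      exact h2 _ h1
  · have h1 : tm a (1 : C.carrier) ∈ (A.tensor C).grading i := by
      simpa using tm_mem ha C.one_mem_zero
    -- Supercentrality of `a` passes to `a ⊗ 1`: the part of the sign coming from the second factor
    -- is the Koszul sign of moving `c` past `a`.
    obtain ⟨z, hz⟩ := hc.exists_eq_smul_one h1 fun k y hy => by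
      refine tm_mem_induction (P := fun y => tm a 1 * y = (sgn (i * k) : ℂ) • (y * tm a 1))
        (by simp) (fun y y' hy hy' => ?_) (fun z y hy => ?_) (fun j l hjl b hb c hc => ?_) hy
      · rw [mul_add, add_mul, smul_add, hy, hy']
      · rw [mul_smul_comm, hy, smul_mul_assoc, smul_comm]
      · rw [tm_one_mul_tm, h j b hb, tm_mul_tm b hc ha, smul_tm, smul_smul, mul_one, ← hjl,
          mul_add, sgn_add, mul_comm l, Units.val_mul, mul_assoc, sgn_mul_self, mul_one]
    exact ⟨z, hinj _ _ (by rw [hz, one_def, smul_tm])⟩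

/-- A central simple graded algebra whose underlying ring is not simple contains a central odd
involution. -/
lemma IsCentralSimple.exists_odd_central (hA : A.IsCentralSimple)
    (hns : ¬ IsSimpleRing A.carrier) :
    ∃ ω ∈ A.grading 1, ω * ω = 1 ∧ ∀ a, ω * a = a * ω := by
  have := hA.nontrivial
  rw [isSimpleRing_iff_isTwoSided_imp] at hns
  push Not at hns
  obtain ⟨I, hI, hbot, htop⟩ := hns inferInstance
  -- As `P` is an involution, `I.comap P` is the image of `I` under the parity. Its intersection and
  -- sum with `I` are graded ideals, so graded simplicity makes `A` the direct sum of `I` and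
  -- `P(I)`.
  let P : A.carrier →+* A.carrier := A.parityEquiv.toRingEquiv.toRingHom
  have hP : ∀ a, P a = A.parity a := fun _ => rfl
  have hI₁ : (I ⊓ I.comap P).IsTwoSided :=
    ⟨fun {x} b hx => ⟨I.mul_mem_right b hx.1, by
      rw [SetLike.mem_coe, Ideal.mem_comap, map_mul]; exact I.mul_mem_right _ hx.2⟩⟩
  have h₁ : I ⊓ I.comap P = ⊥ := by
    refine (hA.simple _ hI₁ (isHomogeneous_of_parity fun a ha => ⟨ha.2, ?_⟩)).resolve_right ?_
    · rw [SetLike.mem_coe, Ideal.mem_comap, hP, parity_parity]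
      exact ha.1
    · intro h
      exact htop (eq_top_iff.2 (h ▸ inf_le_left))
  have hI₂ : (I ⊔ I.comap P).IsTwoSided :=
    ⟨fun {x} b hx => by
      obtain ⟨u, hu, v, hv, rfl⟩ := Submodule.mem_sup.1 hx
      rw [add_mul]
      refine Submodule.add_mem_sup (I.mul_mem_right b hu) ?_
      rw [Ideal.mem_comap, map_mul]
      exact I.mul_mem_right _ hv⟩
  have h₂ : I ⊔ I.comap P = ⊤ := by
    refine (hA.simple _ hI₂ (isHomogeneous_of_parity fun a ha => ?_)).resolve_left ?_
    · obtain ⟨u, hu, v, hv, rfl⟩ := Submodule.mem_sup.1 ha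
      rw [map_add, add_comm]
      refine Submodule.add_mem_sup hv ?_
      rw [Ideal.mem_comap, hP, parity_parity]
      exact hu
    · intro h
      exact hbot (eq_bot_iff.2 (h ▸ le_sup_left))
  have hzero : ∀ a, a ∈ I → A.parity a ∈ I → a = 0 := fun a ha ha' => by
    have : a ∈ I ⊓ I.comap P := ⟨ha, ha'⟩
    rwa [h₁] at this
  obtain ⟨u, hu, v, hv, huv⟩ := Submodule.mem_sup.1
    (show (1 : A.carrier) ∈ I ⊔ I.comap P from h₂ ▸ Submodule.mem_top)
  rw [Ideal.mem_comap, hP] at hv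
  -- Applying the parity to `1 = u + v` and using uniqueness of the decomposition along `I ⊕ P(I)`.
  have hv' : v = A.parity u := by
    have h1 : A.parity u + A.parity v = u + v := by rw [← map_add, huv, parity_map_one]
    have h2 : v - A.parity u = 0 := by
      have h3 : v - A.parity u = A.parity v - u := by
        rw [sub_eq_sub_iff_add_eq_add, add_comm v, ← h1, add_comm]
      apply hzero
      · rw [h3]; exact I.sub_mem hv hu
      · rw [map_sub, parity_parity]; exact I.sub_mem hv hu
    exact sub_eq_zero.1 h2
  subst hv'
  have huPu : u * A.parity u = 0 := by
    apply hzero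
    · exact I.mul_mem_right _ hu
    · rw [parity_mul, parity_parity]; exact I.mul_mem_left _ hu
  have hPuu : A.parity u * u = 0 := by
    apply hzero
    · exact I.mul_mem_left _ hu
    · rw [parity_mul, parity_parity]; exact I.mul_mem_right _ hu
  have hcen : ∀ a, u * a = a * u := by
    intro a
    have h1 : u * a - a * u = a * A.parity u - A.parity u * a := by
      have h2 : (u + A.parity u) * a = a * (u + A.parity u) := by rw [huv, one_mul, mul_one]
      rw [add_mul, mul_add] at h2
      rw [sub_eq_sub_iff_add_eq_add, h2, add_comm]
    apply sub_eq_zero.1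
    apply hzero
    · exact I.sub_mem (I.mul_mem_right _ hu) (I.mul_mem_left _ hu)
    · rw [h1, map_sub, parity_mul, parity_mul, parity_parity]
      exact I.sub_mem (I.mul_mem_left _ hu) (I.mul_mem_right _ hu)
  have hcen' : ∀ a, A.parity u * a = a * A.parity u := by
    intro a
    have h := congrArg A.parity (hcen (A.parity a))
    rwa [parity_mul, parity_mul, parity_parity] at h
  -- `u` and `P u` are orthogonal central elements with sum `1`. Their difference is odd, central,
  -- and has the same square as their sum.
  refine ⟨u - A.parity u, ?_, ?_, fun a => ?_⟩
  · rw [mem_grading_iff, map_sub, parity_parity, sgn_one, Units.val_neg, Units.val_one]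
    module
  · have h1 : (u + A.parity u) * (u + A.parity u) = 1 := by rw [huv, one_mul]
    rw [← h1]
    simp only [sub_mul, mul_sub, add_mul, mul_add, huPu, hPuu]
    simp
  · rw [sub_mul, mul_sub, hcen, hcen']

end MagAlg

/-! ### The algebra `α(1)` -/

namespace alphaOne

/-- The basis element `e^s` of `α(1)`. -/
def eps (φ : G →* Multiplicative (ZMod 2)) (s : ZMod 2) : (alphaOne φ).carrier :=
  (AddMonoidAlgebra.single s 1 : AddMonoidAlgebra ℂ (ZMod 2))

lemma eps_zero : eps φ 0 = 1 := rfl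

lemma eps_mul (s t : ZMod 2) : eps φ s * eps φ t = eps φ (s + t) := by
  refine (AddMonoidAlgebra.single_mul_single (R := ℂ) s t 1 1).trans ?_
  rw [one_mul]
  rfl

lemma smul_eps (z : ℂ) (s : ZMod 2) :
    z • eps φ s = (AddMonoidAlgebra.single s z : AddMonoidAlgebra ℂ (ZMod 2)) := by
  refine (AddMonoidAlgebra.smul_single z s (1 : ℂ)).trans ?_
  rw [smul_eq_mul, mul_one]

lemma act_eps (g : G) (s : ZMod 2) : (alphaOne φ).act g (eps φ s) = eps φ s := by
  refine (AddMonoidAlgebra.mapRingHom_single (conjPow φ g) s 1).trans ?_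
  rw [map_one]
  rfl

lemma mem_grading {i : ZMod 2} {a : (alphaOne φ).carrier} (ha : a ∈ (alphaOne φ).grading i) :
    ∃ z : ℂ, a = z • eps φ i := by
  obtain ⟨z, hz⟩ := (AddMonoidAlgebra.mem_grade_iff' ℂ i a).1 ha
  exact ⟨z, by rw [smul_eps]; exact hz.symm⟩

lemma eps_mem (s : ZMod 2) : eps φ s ∈ (alphaOne φ).grading s :=
  AddMonoidAlgebra.single_mem_grade (R := ℂ) s 1

lemma finrank_eq : Module.finrank ℂ (alphaOne φ).carrier = 2 := by
  refine (AddMonoidAlgebra.coeffLinearEquiv (M := ZMod 2) (S := ℂ) ℂ).finrank_eq.trans ?_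
  rw [Module.finrank_finsupp_self]
  rfl

instance : Nontrivial (alphaOne φ).carrier :=
  Module.nontrivial_of_finrank_pos (R := ℂ) (by rw [finrank_eq]; exact two_pos)

lemma exists_tm_add_tm {A : MagAlg φ} (x : (A.tensor (alphaOne φ)).carrier) :
    ∃ a b, x = tm a 1 + tm b (eps φ 1) := by
  refine tm_induction (P := fun x => ∃ a b, x = tm a 1 + tm b (eps φ 1)) ?_
    (fun i j a ha c hc => ?_) x
  · rintro _ _ ⟨a, b, rfl⟩ ⟨a', b', rfl⟩
    exact ⟨a + a', b + b', by rw [add_tm, add_tm]; abel⟩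
  · obtain ⟨z, rfl⟩ := mem_grading hc
    rcases zmod_two_eq j with rfl | rfl
    · exact ⟨z • a, 0, by rw [smul_tm, tm_smul, zero_tm, add_zero, eps_zero]⟩
    · exact ⟨0, z • a, by rw [smul_tm, tm_smul, zero_tm, zero_add]⟩

end alphaOne

open alphaOne in
/-- If `A` is central simple graded and has a central odd involution, then the ring
`A ⊗̂ α(1)` is simple. -/
lemma MagAlg.IsCentralSimple.isSimpleRing_tensor_alphaOne {A : MagAlg φ} (hA : A.IsCentralSimple)
    {ω : A.carrier} (hω : ω ∈ A.grading 1) (hωω : ω * ω = 1) (hcen : ∀ a, ω * a = a * ω) :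
    IsSimpleRing (A.tensor (alphaOne φ)).carrier := by
  have := hA.nontrivial
  obtain ⟨L, R, hL, hR⟩ := exists_retraction A (alphaOne φ)
  have hR1 : ∀ a, R (tm a 1) = a := fun a => by rw [hR, hL, one_smul]
  have hee : eps φ 1 * eps φ 1 = 1 := by rw [eps_mul]; rfl
  have htwo : ∀ a : A.carrier, a + a = 0 → a = 0 := fun a h => by
    rw [← two_smul ℂ] at h
    exact (smul_eq_zero.1 h).resolve_left two_ne_zero
  refine isSimpleRing_iff_isTwoSided_imp.2 ⟨⟨⟨1, 0, fun h => one_ne_zero (α := A.carrier) ?_⟩⟩,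
    fun J hJ => ?_⟩
  · rw [← hR1 1, ← one_def, h, map_zero]
  -- `K` is the intersection of `J` with `A ⊗ 1`. Conjugation by `1 ⊗ e` implements the parity of
  -- `A` on it, so `K` is graded and hence `0` or `A`.
  let K : Ideal A.carrier := J.comap (inclLeft A (alphaOne φ))
  have hK : K.IsTwoSided := ⟨fun {x} b hx => by
    rw [Ideal.mem_comap, map_mul]
    exact J.mul_mem_right _ hx⟩
  have hKpar : ∀ a ∈ K, A.parity a ∈ K := by
    intro a ha
    have h1 : tm (A.parity a) 1 = tm 1 (eps φ 1) * tm a 1 * tm 1 (eps φ 1) := by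
      refine A.homogeneous_induction (P := fun a => tm (A.parity a) 1 =
        tm 1 (eps φ 1) * tm a 1 * tm 1 (eps φ 1)) (fun x y hx hy => ?_) (fun i a ha => ?_) a
      · rw [map_add, add_tm, hx, hy, add_tm, mul_add, add_mul]
      · rw [tm_mul_tm 1 (eps_mem 1) ha, smul_mul_assoc, tm_mul_one_tm, mul_one, one_mul, one_mul,
          hee, A.parity_of_mem ha, smul_tm]
    change tm (A.parity a) 1 ∈ J
    rw [h1]
    exact J.mul_mem_right _ (J.mul_mem_left _ ha)
  rcases hA.simple K hK (isHomogeneous_of_parity hKpar) with h | h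
  · left
    rw [eq_bot_iff]
    intro x hx
    have hK0 : ∀ a : A.carrier, tm a 1 ∈ J → a = 0 := fun a ha => by
      have : a ∈ K := ha
      rwa [h] at this
    obtain ⟨a, b, rfl⟩ := exists_tm_add_tm x
    -- Conjugation by `ω ⊗ 1` fixes `a ⊗ 1` and negates `b ⊗ e`, because `ω` is central in `A` but
    -- odd. Adding the conjugate to the element isolates `2a ⊗ 1` inside `J`.
    have h1 : tm ω 1 * (tm a 1 + tm b (eps φ 1)) * tm ω 1 = tm a 1 - tm b (eps φ 1) := by
      rw [mul_add, tm_one_mul_tm, tm_one_mul_tm, add_mul, tm_one_mul_tm,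
        tm_mul_tm _ (eps_mem 1) hω, hcen, mul_assoc, hωω, hcen, mul_assoc, hωω]
      simp [sub_eq_add_neg]
    have h2 : tm (a + a) 1 ∈ J := by
      have h3 := J.add_mem hx (J.mul_mem_right (tm ω 1) (J.mul_mem_left (tm ω 1) hx))
      rw [h1, add_add_sub_cancel, ← add_tm] at h3
      exact h3
    have ha := htwo _ (hK0 _ h2)
    subst ha
    rw [zero_tm, zero_add] at hx ⊢
    have hb : b = 0 := by
      -- Multiplication by `1 ⊗ e` carries `b ⊗ e` to `b ⊗ 1`.
      apply hK0
      have h3 := J.mul_mem_right (tm 1 (eps φ 1)) hx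
      rwa [tm_mul_one_tm, hee] at h3
    rw [hb, zero_tm]
    exact zero_mem _
  · right
    rw [Ideal.eq_top_iff_one, one_def]
    have : (1 : A.carrier) ∈ K := h ▸ Submodule.mem_top
    exact this

/-! ### Matrix models of the standard algebras -/

/-- The matrix `diag(1, -1)^s`, for `s : ℤ/2`. -/
def signPow (s : ZMod 2) : Matrix (Fin 2) (Fin 2) ℂ := !![1, 0; 0, sgn s]

lemma signPow_add (s t : ZMod 2) : signPow (s + t) = signPow s * signPow t := by
  rw [signPow, signPow, signPow, Matrix.mul_fin_two, sgn_add]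
  simp

lemma swapPow_mul_signPow (s t : ZMod 2) :
    swapPow s * signPow t = (sgn (t * s) : ℂ) • (signPow t * swapPow s) := by
  rcases zmod_two_eq s with rfl | rfl <;> rcases zmod_two_eq t with rfl | rfl <;>
    simp [swapPow, signPow, zmod_two_val_one, Matrix.one_fin_two]

lemma signPow_map (g : G) (s : ZMod 2) : (signPow s).map (conjPow φ g) = signPow s := by
  ext i j
  fin_cases i <;> fin_cases j <;> simp [signPow, conjPow_sgn]

/-- The underlying algebra of `σ(ψ)`. -/
def sigmaEquiv (φ ψ : G →* Multiplicative (ZMod 2)) :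
    (sigma φ ψ).carrier ≃ₐ[ℂ] Matrix (Fin 2) (Fin 2) ℂ :=
  (AlgEquiv.refl : Matrix (Fin 2) (Fin 2) ℂ ≃ₐ[ℂ] _)

/-- The matrix model of `σ(ψ)`. -/
def sigmaModel (φ ψ : G →* Multiplicative (ZMod 2)) :
    MatrixModel (sigma φ ψ) (sigmaEquiv φ ψ) (fun _ => 1) ψ where
  Γ := signPow 1
  M g := swapPow (ψ g).toAdd
  isUnit g := ⟨⟨_, _, swapPow_mul_self _, swapPow_mul_self _⟩, rfl⟩
  Γ_mul_self := by
    rw [← signPow_add, zmod_two_one_add_one]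
    simp [signPow, Matrix.one_fin_two]
  θ_parity a := by
    refine (sigma φ ψ).homogeneous_induction (P := fun a => sigmaEquiv φ ψ
        ((sigma φ ψ).parity a) * signPow 1 = signPow 1 * sigmaEquiv φ ψ a)
      (fun x y hx hy => ?_) (fun i a ha => ?_) a
    · rw [map_add, map_add, map_add, add_mul, mul_add, hx, hy]
    · rw [(sigma φ ψ).parity_of_mem ha, map_smul]
      have hX : sigmaEquiv φ ψ a ∈ sigmaGrading i := ha
      generalize sigmaEquiv φ ψ a = X at hX
      rcases zmod_two_eq i with rfl | rfl
      · rw [mem_sigmaGrading_zero] at hX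
        ext k l
        fin_cases k <;> fin_cases l <;> simp [signPow, Matrix.mul_apply, hX]
      · rw [mem_sigmaGrading_one] at hX
        ext k l
        fin_cases k <;> fin_cases l <;> simp [signPow, Matrix.mul_apply, hX]
  θ_act g a := by
    change swapPow (ψ g).toAdd * Matrix.map a (conjPow φ g) * swapPow (ψ g).toAdd *
      swapPow (ψ g).toAdd = swapPow (ψ g).toAdd * Matrix.map a (conjPow φ g)
    rw [Matrix.mul_assoc, swapPow_mul_self, Matrix.mul_one]
  M_mul g h := by
    rw [swapPow_map, ← swapPow_add, map_mul, toAdd_mul, CUnits.val_one, one_smul]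
  M_Γ g := by
    rw [signPow_map, swapPow_mul_signPow, one_mul]

lemma hasEvenType_sigma (φ ψ : G →* Multiplicative (ZMod 2)) :
    HasEvenType (sigma φ ψ) ⟨0, ψ, 0⟩ := by
  have h := (sigmaModel φ ψ).hasEvenType
  rwa [H2Phi.mk_one] at h

/-- The matrix model of `α(0)`. -/
def alphaZeroModel (φ : G →* Multiplicative (ZMod 2)) :
    MatrixModel (alphaZero φ) (Matrix.uniqueAlgEquiv (m := Unit) (R := ℂ) (A := ℂ)).symm
      (fun _ => 1) 1 where
  Γ := 1
  M g := 1
  isUnit g := isUnit_one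
  Γ_mul_self := one_mul 1
  θ_parity a := by
    have h0 : ∀ z : ℂ, z ∈ trivialGrading 0 := by simp [trivialGrading]
    have h : a ∈ (alphaZero φ).grading 0 := h0 a
    have h : (alphaZero φ).parity a = a := by simpa using (alphaZero φ).parity_of_mem h
    rw [h, Matrix.mul_one, Matrix.one_mul]
  θ_act g a := by
    rw [Matrix.mul_one, Matrix.one_mul]
    rfl
  M_mul g h := by simp [CUnits.val_one]
  M_Γ g := by simp

lemma hasEvenType_alphaZero (φ : G →* Multiplicative (ZMod 2)) :
    HasEvenType (alphaZero φ) 1 := by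
  have h := (alphaZeroModel φ).hasEvenType
  rwa [H2Phi.mk_one] at h

/-! ### The Clifford algebra `α(1) ⊗̂ α(1)` -/

/-- The homomorphism from `α(1)` to matrices defined by an involution. -/
def alphaOneHom (φ : G →* Multiplicative (ZMod 2)) (f : ZMod 2 → Matrix (Fin 2) (Fin 2) ℂ)
    (h0 : f 0 = 1) (hadd : ∀ s t, f (s + t) = f s * f t) :
    (alphaOne φ).carrier →ₐ[ℂ] Matrix (Fin 2) (Fin 2) ℂ :=
  AddMonoidAlgebra.lift ℂ _ (ZMod 2)
    { toFun := fun s => f s.toAdd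
      map_one' := h0
      map_mul' := fun _ _ => hadd _ _ }

lemma alphaOneHom_eps {f : ZMod 2 → Matrix (Fin 2) (Fin 2) ℂ}
    (h0 : f 0 = 1) (hadd : ∀ s t, f (s + t) = f s * f t) (s : ZMod 2) :
    alphaOneHom φ f h0 hadd (alphaOne.eps φ s) = f s :=
  (AddMonoidAlgebra.lift_single _ s 1).trans (one_smul ℂ _)

lemma swapPow_zero : swapPow 0 = 1 := pow_zero _

lemma signPow_zero : signPow 0 = 1 := by simp [signPow, Matrix.one_fin_two]

open alphaOne

/-- The homomorphism `α(1) ⊗̂ α(1) → M₂(ℂ)`. -/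
def cliffordHom (φ : G →* Multiplicative (ZMod 2)) :
    ((alphaOne φ).tensor (alphaOne φ)).carrier →ₐ[ℂ] Matrix (Fin 2) (Fin 2) ℂ :=
  GradedTensorProduct.lift (alphaOne φ).grading (alphaOne φ).grading
    (alphaOneHom φ swapPow swapPow_zero swapPow_add)
    (alphaOneHom φ signPow signPow_zero signPow_add)
    (fun i j a b => by
      obtain ⟨x, hx⟩ := mem_grading a.2
      obtain ⟨y, hy⟩ := mem_grading b.2
      rw [neg_one_uzpow_smul, hx, hy, map_smul, map_smul, alphaOneHom_eps, alphaOneHom_eps,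
        smul_mul_smul_comm, smul_mul_smul_comm, swapPow_mul_signPow, smul_comm (x * y),
        mul_comm y])

lemma cliffordHom_tm (s t : ZMod 2) :
    cliffordHom φ (tm (eps φ s) (eps φ t)) = swapPow s * signPow t := by
  refine (GradedTensorProduct.lift_tmul _ _ _ _ _ _ _).trans ?_
  rw [alphaOneHom_eps, alphaOneHom_eps]

lemma clifford_induction {P : ((alphaOne φ).tensor (alphaOne φ)).carrier → Prop}
    (hadd : ∀ x y, P x → P y → P (x + y))
    (htm : ∀ (z : ℂ) s t, P (z • tm (eps φ s) (eps φ t))) (x) : P x := by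
  refine tm_induction hadd (fun i j a ha b hb => ?_) x
  obtain ⟨x, rfl⟩ := mem_grading ha
  obtain ⟨y, rfl⟩ := mem_grading hb
  rw [smul_tm, tm_smul, smul_smul]
  exact htm _ _ _

/-- The four products of powers of `J` and `diag(1, -1)` span `M₂(ℂ)`, and both sides have dimension
four. -/
lemma cliffordHom_bijective : Function.Bijective (cliffordHom φ) := by
  have hs : Function.Surjective (cliffordHom φ).toLinearMap := by
    intro X
    refine ⟨((X 0 0 + X 1 1) / 2) • tm (eps φ 0) (eps φ 0) +
      ((X 0 0 - X 1 1) / 2) • tm (eps φ 0) (eps φ 1) +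
      ((X 0 1 + X 1 0) / 2) • tm (eps φ 1) (eps φ 0) +
      ((X 1 0 - X 0 1) / 2) • tm (eps φ 1) (eps φ 1), ?_⟩
    rw [AlgHom.toLinearMap_apply, map_add, map_add, map_add, map_smul, map_smul, map_smul,
      map_smul, cliffordHom_tm, cliffordHom_tm, cliffordHom_tm, cliffordHom_tm]
    ext k l
    fin_cases k <;> fin_cases l <;>
      simp [swapPow, signPow, zmod_two_val_one, Matrix.one_fin_two] <;> ring
  refine ⟨(LinearMap.injective_iff_surjective_of_finrank_eq_finrank ?_).2 hs, hs⟩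
  rw [finrank_tensor, alphaOne.finrank_eq, Module.finrank_matrix]
  simp

/-- The matrix `((0, -i), (i, 0))`. -/
def pauliY : Matrix (Fin 2) (Fin 2) ℂ := !![0, -Complex.I; Complex.I, 0]

/-- The matrix model of `α(1) ⊗̂ α(1)`. -/
def cliffordModel (φ : G →* Multiplicative (ZMod 2)) :
    MatrixModel ((alphaOne φ).tensor (alphaOne φ))
      (AlgEquiv.ofBijective (cliffordHom φ) cliffordHom_bijective) (fun _ => 1) φ where
  -- `Γ = i J diag(1, -1)` anticommutes with the images of both generators. The action matrices are
  -- trivial since these images are real. Conjugation negates the imaginary matrix `Γ`, which is why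
  -- the resulting homomorphism is `φ`.
  Γ := pauliY
  M g := 1
  isUnit g := isUnit_one
  Γ_mul_self := by
    simp [pauliY, Matrix.one_fin_two]
  θ_parity a := by
    simp only [AlgEquiv.coe_ofBijective]
    refine clifford_induction (P := fun a => cliffordHom φ (parity _ a) * pauliY =
      pauliY * cliffordHom φ a) (fun x y hx hy => ?_) (fun z s t => ?_) a
    · rw [map_add, map_add, map_add, add_mul, mul_add, hx, hy]
    · rw [map_smul, parity_of_mem _ (tm_mem (eps_mem s) (eps_mem t)), map_smul, map_smul, map_smul,
        cliffordHom_tm]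
      rcases zmod_two_eq s with rfl | rfl <;> rcases zmod_two_eq t with rfl | rfl <;>
        simp [swapPow, signPow, zmod_two_val_one, zmod_two_one_add_one, pauliY,
          Matrix.one_fin_two, mul_comm]
  θ_act g a := by
    rw [Matrix.mul_one, Matrix.one_mul]
    simp only [AlgEquiv.coe_ofBijective]
    refine clifford_induction (P := fun a => cliffordHom φ (act _ g a) =
      (cliffordHom φ a).map (conjPow φ g)) (fun x y hx hy => ?_) (fun z s t => ?_) a
    · rw [map_add, map_add, map_add, map_conj_add, hx, hy]
    · rw [act_smul, map_smul, map_smul, act_tm, act_eps, act_eps, cliffordHom_tm, map_conj_smul,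
        Matrix.map_mul, swapPow_map, signPow_map]
  M_mul g h := by simp [CUnits.val_one]
  M_Γ g := by
    rw [Matrix.one_mul, Matrix.mul_one]
    unfold conjPow
    rcases zmod_two_eq (φ g).toAdd with h | h
    · simp [h]
    · ext k l
      fin_cases k <;> fin_cases l <;> simp [h, pauliY]

/-- The type of `α(1)`. -/
def tau (φ : G →* Multiplicative (ZMod 2)) : TwistedProduct φ := ⟨0, 1, 1⟩

/-- The source of the twist `φ^{a₀a₁}` in the group law: the square of `τ` is `(0, φ, 0)`, and this
is the type found from `cliffordModel`. -/
lemma hasEvenType_clifford (φ : G →* Multiplicative (ZMod 2)) :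
    HasEvenType ((alphaOne φ).tensor (alphaOne φ)) (tau φ * tau φ) := by
  have h := (cliffordModel φ).hasEvenType
  have h1 : tau φ * tau φ = ⟨0, φ, 0⟩ := by
    ext1
    · simp [tau]
    · simp [tau, zmod_two_val_one]
    · exact zmod_two_one_add_one
  rwa [H2Phi.mk_one, ← h1] at h

/-! ### Entrywise conjugation of vectors -/

open scoped Matrix

/-- The entrywise action of `𝕂^{φ(g)}` on vectors. -/
def conjVec (φ : G →* Multiplicative (ZMod 2)) (g : G) {n : Type} (v : n → ℂ) : n → ℂ :=
  fun i => conjPow φ g (v i)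

section conjVec

variable {m n : Type}

@[simp] lemma conjVec_conjVec (g : G) (v : n → ℂ) : conjVec φ g (conjVec φ g v) = v :=
  funext fun _ => conjPow_conjPow φ g _

lemma conjVec_mul (g h : G) (v : n → ℂ) :
    conjVec φ (g * h) v = conjVec φ g (conjVec φ h v) :=
  funext fun _ => conjPow_mul φ g h _

lemma conjVec_add (g : G) (v w : n → ℂ) :
    conjVec φ g (v + w) = conjVec φ g v + conjVec φ g w :=
  funext fun _ => map_add (conjPow φ g) _ _

lemma conjVec_smul (g : G) (z : ℂ) (v : n → ℂ) :
    conjVec φ g (z • v) = conjPow φ g z • conjVec φ g v :=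
  funext fun _ => map_mul (conjPow φ g) _ _

lemma conjVec_mulVec [Fintype n] (g : G) (X : Matrix m n ℂ) (v : n → ℂ) :
    conjVec φ g (X *ᵥ v) = X.map (conjPow φ g) *ᵥ conjVec φ g v := by
  ext i
  simp [conjVec, Matrix.mulVec, dotProduct]

end conjVec

/-! ### The matrix model of an endomorphism algebra -/

namespace MagProjRep

variable {c : G × G → CUnits φ} (V : MagProjRep φ c)

lemma parity_of_mem {j : ZMod 2} {v : V.carrier} (hv : v ∈ V.grading j) :
    V.parity v = (sgn j : ℂ) • v := by
  rcases zmod_two_eq j with rfl | rfl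
  · simpa using V.parity_zero hv
  · simpa using V.parity_one hv

lemma homogeneous_induction {P : V.carrier → Prop} (hadd : ∀ v w, P v → P w → P (v + w))
    (hom : ∀ i, ∀ v ∈ V.grading i, P v) (v : V.carrier) : P v := by
  obtain ⟨x, hx, y, hy, rfl⟩ := V.exists_add v
  exact hadd _ _ (hom _ _ hx) (hom _ _ hy)

lemma parity_parity (v : V.carrier) : V.parity (V.parity v) = v := by
  refine V.homogeneous_induction (P := fun v => V.parity (V.parity v) = v)
    (fun x y hx hy => ?_) (fun i v hv => ?_) v
  · rw [map_add, map_add, hx, hy]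
  · rw [V.parity_of_mem hv, map_smul, V.parity_of_mem hv, smul_smul, sgn_mul_self, one_smul]

lemma act_parity (g : G) (v : V.carrier) : V.act g (V.parity v) = V.parity (V.act g v) := by
  refine V.homogeneous_induction (P := fun v => V.act g (V.parity v) = V.parity (V.act g v))
    (fun x y hx hy => ?_) (fun i v hv => ?_) v
  · simp only [map_add, hx, hy]
  · rw [V.parity_of_mem hv, V.act_smul, V.parity_of_mem (V.act_mem g i v hv), conjPow_sgn]

/-- The underlying algebra of `End(V)`. -/
def toEnd : V.endAlg.carrier ≃ₐ[ℂ] Module.End ℂ V.carrier :=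
  (AlgEquiv.refl : Module.End ℂ V.carrier ≃ₐ[ℂ] _)

lemma toEnd_act_apply_act (g : G) (f : V.endAlg.carrier) (v : V.carrier) :
    V.toEnd (V.endAlg.act g f) (V.act g v) = V.act g (V.toEnd f v) :=
  (V.conjEnd_apply g (V.toEnd f) _).trans (by rw [AddEquiv.symm_apply_apply])

lemma toEnd_apply_mem {i j : ZMod 2} {f : V.endAlg.carrier} (hf : f ∈ V.endAlg.grading i)
    {v : V.carrier} (hv : v ∈ V.grading j) : V.toEnd f v ∈ V.grading (i + j) := hf j v hv

lemma toEnd_parity_mul (f : V.endAlg.carrier) :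
    V.toEnd (V.endAlg.parity f) * V.parity = V.parity * V.toEnd f := by
  refine V.endAlg.homogeneous_induction (P := fun f => V.toEnd (V.endAlg.parity f) * V.parity =
    V.parity * V.toEnd f) (fun x y hx hy => ?_) (fun i f hf => ?_) f
  · rw [map_add, map_add, map_add, add_mul, mul_add, hx, hy]
  · rw [V.endAlg.parity_of_mem hf, map_smul]
    refine LinearMap.ext fun v => ?_
    refine V.homogeneous_induction (P := fun v => ((sgn i : ℂ) • V.toEnd f * V.parity) v =
      (V.parity * V.toEnd f) v) (fun x y hx hy => ?_) (fun j v hv => ?_) v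
    · rw [map_add, map_add, hx, hy]
    · rw [Module.End.mul_apply, Module.End.mul_apply, LinearMap.smul_apply, V.parity_of_mem hv,
        map_smul, V.parity_of_mem (V.toEnd_apply_mem hf hv), smul_smul, sgn_add, Units.val_mul]

variable {n : Type} [Fintype n] (b : Module.Basis n ℂ V.carrier)

/-- The matrix of `ρ(g)` in a basis. -/
def actMatrix (g : G) : Matrix n n ℂ := Matrix.of fun i j => b.equivFun (V.act g (b j)) i

lemma actMatrix_mulVec (g : G) (v : V.carrier) :
    V.actMatrix b g *ᵥ conjVec φ g (b.equivFun v) = b.equivFun (V.act g v) := by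
  conv_rhs => rw [← b.sum_equivFun v]
  rw [map_sum, map_sum]
  ext i
  rw [Finset.sum_apply]
  simp only [V.act_smul, map_smul, Pi.smul_apply, smul_eq_mul]
  exact Finset.sum_congr rfl fun j _ => mul_comm _ _

/-- Conjugated coordinate vectors still exhaust all vectors, so semilinear maps can be compared on
`V`. -/
lemma matrix_ext [DecidableEq n] (g : G) {X Y : Matrix n n ℂ}
    (h : ∀ v, X *ᵥ conjVec φ g (b.equivFun v) = Y *ᵥ conjVec φ g (b.equivFun v)) : X = Y := by
  refine Matrix.ext_of_mulVec_single fun i => ?_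
  have := h (b.equivFun.symm (conjVec φ g (Pi.single i 1)))
  rwa [LinearEquiv.apply_symm_apply, conjVec_conjVec] at this

variable [DecidableEq n]

/-- The identification of `End(V)` with a matrix algebra given by a basis. -/
def endEquiv : V.endAlg.carrier ≃ₐ[ℂ] Matrix n n ℂ :=
  V.toEnd.trans (LinearMap.toMatrixAlgEquiv b)

lemma toMatrix_mulVec_equivFun (f : Module.End ℂ V.carrier) (v : V.carrier) :
    LinearMap.toMatrixAlgEquiv b f *ᵥ b.equivFun v = b.equivFun (f v) :=
  LinearMap.toMatrix_mulVec_repr b b f v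

/-- The matrix model of `End(V)`. -/
def endModel : MatrixModel V.endAlg (V.endEquiv b) c 1 where
  Γ := LinearMap.toMatrixAlgEquiv b V.parity
  M := V.actMatrix b
  isUnit g := by
    rw [← Matrix.mulVec_injective_iff_isUnit]
    intro u u' h
    obtain ⟨v, rfl⟩ : ∃ v, conjVec φ g (b.equivFun v) = u :=
      ⟨b.equivFun.symm (conjVec φ g u), by
        rw [LinearEquiv.apply_symm_apply, conjVec_conjVec]⟩
    obtain ⟨v', rfl⟩ : ∃ v, conjVec φ g (b.equivFun v) = u' :=
      ⟨b.equivFun.symm (conjVec φ g u'), by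
        rw [LinearEquiv.apply_symm_apply, conjVec_conjVec]⟩
    simp only [actMatrix_mulVec] at h
    rw [(V.act g).injective (b.equivFun.injective h)]
  Γ_mul_self := by
    rw [← map_mul, ← map_one (LinearMap.toMatrixAlgEquiv b)]
    congr 1
    exact LinearMap.ext V.parity_parity
  θ_parity f := by
    rw [endEquiv, AlgEquiv.trans_apply, AlgEquiv.trans_apply, ← map_mul, ← map_mul,
      V.toEnd_parity_mul]
  θ_act g f := by
    refine V.matrix_ext b g fun v => ?_
    rw [endEquiv, AlgEquiv.trans_apply, AlgEquiv.trans_apply, ← Matrix.mulVec_mulVec,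
      ← Matrix.mulVec_mulVec, actMatrix_mulVec, ← conjVec_mulVec, toMatrix_mulVec_equivFun,
      toMatrix_mulVec_equivFun, actMatrix_mulVec, toEnd_act_apply_act]
  M_mul g h := by
    refine V.matrix_ext b (g * h) fun v => ?_
    rw [← Matrix.mulVec_mulVec, conjVec_mul, ← conjVec_mulVec, ← conjVec_mul, actMatrix_mulVec,
      actMatrix_mulVec, V.act_act, Matrix.smul_mulVec, actMatrix_mulVec, map_smul]
  -- The maps `ρ(g)` preserve both components of `V`, hence commute with the parity; this is why `ψ`
  -- is trivial.
  M_Γ g := by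
    refine V.matrix_ext b g fun v => ?_
    rw [← Matrix.mulVec_mulVec, ← conjVec_mulVec, toMatrix_mulVec_equivFun,
      actMatrix_mulVec, Matrix.smul_mulVec, ← Matrix.mulVec_mulVec, actMatrix_mulVec,
      toMatrix_mulVec_equivFun, V.act_parity]
    simp

lemma hasEvenType_endAlg (hc : IsMulCocycle₂ c) :
    HasEvenType V.endAlg ⟨H2Phi.mk φ hc, 1, 0⟩ := by
  have := Module.finrank_pos (R := ℂ) (M := V.carrier)
  have : Nonempty (Fin (Module.finrank ℂ V.carrier)) := ⟨⟨0, this⟩⟩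
  exact (V.endModel (Module.finBasis ℂ V.carrier)).hasEvenType

end MagProjRep

/-! ### Algebras of trivial type -/

section trivialType

variable {n : Type} [Fintype n] [DecidableEq n] [Nonempty n]
  {A : MagAlg φ} {θ : A.carrier ≃ₐ[ℂ] Matrix n n ℂ}

/-- The semilinear map defined by an invertible matrix. -/
def semilinearEquiv (g : G) (u : (Matrix n n ℂ)ˣ) : (n → ℂ) ≃+ (n → ℂ) where
  toFun v := (u : Matrix n n ℂ) *ᵥ conjVec φ g v
  invFun v := conjVec φ g ((↑u⁻¹ : Matrix n n ℂ) *ᵥ v)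
  left_inv v := by
    beta_reduce
    rw [Matrix.mulVec_mulVec, Units.inv_mul, Matrix.one_mulVec, conjVec_conjVec]
  right_inv v := by
    beta_reduce
    rw [conjVec_conjVec, Matrix.mulVec_mulVec, Units.mul_inv, Matrix.one_mulVec]
  map_add' v w := by rw [conjVec_add, Matrix.mulVec_add]

/-- The magnetic representation defined by a matrix model with trivial factor set and trivial
`ψ`. -/
def MatrixModel.magRep (K : MatrixModel A θ (fun _ => 1) 1) : MagRep φ where
  carrier := n → ℂ
  -- The eigenspaces of `Γ` for `1` and `-1`; they are complementary because `Γ² = 1`.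
  grading i := LinearMap.ker (Matrix.toLin' K.Γ - (sgn i : ℂ) • LinearMap.id)
  isInternal := by
    rw [DirectSum.isInternal_submodule_iff_isCompl _ (i := 0) (j := 1) (by decide)
      (by ext s; simpa using zmod_two_eq s)]
    refine ⟨?_, ?_⟩
    · rw [Submodule.disjoint_def]
      intro v hv hv'
      have h1 : K.Γ *ᵥ v = v := by simpa [sub_eq_zero] using hv
      have h2 : K.Γ *ᵥ v + v = 0 := by simpa using hv'
      rw [h1, ← two_smul ℂ] at h2
      exact (smul_eq_zero.1 h2).resolve_left two_ne_zero
    · rw [codisjoint_iff, eq_top_iff]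
      intro v _
      have hΓ : K.Γ *ᵥ (K.Γ *ᵥ v) = v := by
        rw [Matrix.mulVec_mulVec, K.Γ_mul_self, Matrix.one_mulVec]
      refine Submodule.mem_sup.2 ⟨(1 / 2 : ℂ) • (v + K.Γ *ᵥ v), ?_, (1 / 2 : ℂ) • (v - K.Γ *ᵥ v),
        ?_, by module⟩
      · simp [Matrix.mulVec_add, Matrix.mulVec_smul, hΓ]
        abel
      · simp [Matrix.mulVec_sub, hΓ]
  act g := semilinearEquiv (φ := φ) g (K.isUnit g).unit
  act_smul g z v := by
    change K.M g *ᵥ conjVec φ g (z • v) = _ • (K.M g *ᵥ conjVec φ g v)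
    rw [conjVec_smul, Matrix.mulVec_smul]
  act_mem g i v hv := by
    change K.M g *ᵥ conjVec φ g v ∈ _
    have h1 : K.Γ *ᵥ v = (sgn i : ℂ) • v := by simpa [sub_eq_zero] using hv
    -- Triviality of `ψ` is used here: the semilinear map commutes with `Γ` and so preserves its
    -- eigenspaces.
    have h2 : K.Γ * K.M g = K.M g * K.Γ.map (conjPow φ g) := by simp [K.M_Γ]
    rw [LinearMap.mem_ker, LinearMap.sub_apply, sub_eq_zero, Matrix.toLin'_apply,
      Matrix.mulVec_mulVec, h2, ← Matrix.mulVec_mulVec, ← conjVec_mulVec, h1, conjVec_smul,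
      conjPow_sgn, Matrix.mulVec_smul]
    rfl
  act_act g h v := by
    change K.M g *ᵥ conjVec φ g (K.M h *ᵥ conjVec φ h v) =
      _ • (K.M (g * h) *ᵥ conjVec φ (g * h) v)
    rw [conjVec_mulVec, Matrix.mulVec_mulVec, K.M_mul, Matrix.smul_mulVec, conjVec_mul]

/-- An algebra with a matrix model with trivial factor set and trivial `ψ` is the endomorphism
algebra of a magnetic representation. -/
def MatrixModel.isoEndAlg (K : MatrixModel A θ (fun _ => 1) 1) : Iso A K.magRep.endAlg where
  toAlgEquiv := θ.trans Matrix.toLinAlgEquiv'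
  map_mem i a ha j v hv := by
    change (n → ℂ) at v
    change v ∈ LinearMap.ker (Matrix.toLin' K.Γ - (sgn j : ℂ) • LinearMap.id) at hv
    change θ a *ᵥ v ∈ LinearMap.ker (Matrix.toLin' K.Γ - (sgn (i + j) : ℂ) • LinearMap.id)
    have h1 : K.Γ *ᵥ v = (sgn j : ℂ) • v := by simpa [sub_eq_zero] using hv
    have h2 : K.Γ * θ a = (sgn i : ℂ) • (θ a * K.Γ) := by simpa using K.Γpow_mul_θ 1 ha
    rw [LinearMap.mem_ker, LinearMap.sub_apply, sub_eq_zero, Matrix.toLin'_apply,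
      Matrix.mulVec_mulVec, h2, Matrix.smul_mulVec, ← Matrix.mulVec_mulVec, h1,
      Matrix.mulVec_smul, smul_smul, ← Units.val_mul, ← sgn_add]
    rfl
  map_act g a := by
    apply K.magRep.toEnd.injective
    refine LinearMap.ext fun v => ?_
    obtain ⟨w, rfl⟩ := (K.magRep.act g).surjective v
    refine Eq.trans ?_ (K.magRep.toEnd_act_apply_act g _ w).symm
    change n → ℂ at w
    change θ (A.act g a) *ᵥ (K.M g *ᵥ conjVec φ g w) = K.M g *ᵥ conjVec φ g (θ a *ᵥ w)
    rw [conjVec_mulVec, Matrix.mulVec_mulVec, Matrix.mulVec_mulVec, K.θ_act]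

/-- The matrix model obtained by rescaling the action. -/
def MatrixModel.rescale {c d : G × G → CUnits φ} {ψ : G →* Multiplicative (ZMod 2)}
    (K : MatrixModel A θ c ψ) (x : G → CUnits φ)
    (hx : ∀ g h, d (g, h) * x (g * h) = c (g, h) * (g • x h * x g)) : MatrixModel A θ d ψ where
  Γ := K.Γ
  M g := (x g).val • K.M g
  isUnit g := by
    refine IsUnit.smul (Units.mk0 _ (x g).val_ne_zero) (K.isUnit g)
  Γ_mul_self := K.Γ_mul_self
  θ_parity := K.θ_parity
  θ_act g a := by rw [Matrix.mul_smul, Matrix.smul_mul, K.θ_act]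
  M_mul g h := by
    have h1 := congrArg CUnits.val (hx g h)
    simp only [CUnits.val_mul, CUnits.val_smul] at h1
    rw [map_conj_smul, Matrix.smul_mul, Matrix.mul_smul, K.M_mul, smul_smul, smul_smul, smul_smul,
      h1]
    congr 1
    ring
  M_Γ g := by rw [Matrix.mul_smul, Matrix.smul_mul, K.M_Γ, smul_comm]

end trivialType

/-- Trivial cohomology class means that the action matrices can be rescaled to have factor set `1`;
they then define a genuine representation, graded because `ψ` is trivial. -/
lemma HasEvenType.exists_iso_endAlg {A : MagAlg φ} (h : HasEvenType A 1) :
    ∃ V : MagRep φ, Nonempty (Iso A V.endAlg) := by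
  obtain ⟨-, c, hc, hl, n, _, _, _, θ, ⟨K⟩⟩ := h
  rw [TwistedProduct.one_lam, ← H2Phi.mk_one, eq_comm, H2Phi.mk_eq_mk_iff] at hl
  obtain ⟨x, hx⟩ := hl
  exact ⟨_, ⟨(K.rescale x hx).isoEndAlg⟩⟩

/-! ### The twisted regular representation -/

/-- The maps `e_k ↦ c(g, k) e_{gk}` define a magnetic projective representation with factor set
`c`. -/
def twistedRegular [Finite G] {c : G × G → CUnits φ} (hc : IsMulCocycle₂ c) : MagProjRep φ c where
  carrier := G → ℂ
  grading i := if i = 0 then ⊤ else ⊥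
  isInternal := by
    rw [DirectSum.isInternal_submodule_iff_isCompl _ (i := 0) (j := 1) (by decide)
      (by ext s; simpa using zmod_two_eq s)]
    simpa using isCompl_top_bot
  act g :=
    { toFun := fun f k => (c (g, g⁻¹ * k)).val * conjPow φ g (f (g⁻¹ * k))
      invFun := fun f k => conjPow φ g ((c (g, k)).val⁻¹ * f (g * k))
      left_inv := fun f => by
        ext k
        simp [CUnits.val_ne_zero]
      right_inv := fun f => by
        ext k
        simp [CUnits.val_ne_zero]
      map_add' := fun f f' => by
        ext k
        simp [mul_add] }
  act_smul g z f := by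
    ext k
    simp [mul_left_comm]
  act_mem g i f hf := by
    rcases zmod_two_eq i with rfl | rfl
    · simp
    · have : f = 0 := by simpa using hf
      rw [this, map_zero]
      exact zero_mem _
  act_act g h f := by
    ext k
    -- The composition rule at the coordinate `k` is the cocycle identity for `g`, `h`, `(gh)⁻¹k`.
    have h1 := isMulCocycle₂_iff_val.1 hc g h ((g * h)⁻¹ * k)
    have h2 : h * ((g * h)⁻¹ * k) = g⁻¹ * k := by group
    have h3 : (g * h)⁻¹ * k = h⁻¹ * (g⁻¹ * k) := by group
    rw [h2, h3] at h1
    change (c (g, g⁻¹ * k)).val * conjPow φ g ((c (h, h⁻¹ * (g⁻¹ * k))).val *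
      conjPow φ h (f (h⁻¹ * (g⁻¹ * k)))) = (c (g, h)).val * ((c (g * h, (g * h)⁻¹ * k)).val *
      conjPow φ (g * h) (f ((g * h)⁻¹ * k)))
    rw [h3, map_mul, conjPow_mul]
    linear_combination (-conjPow φ g (conjPow φ h (f (h⁻¹ * (g⁻¹ * k))))) * h1

lemma twistedRegular_isUngraded [Finite G] {c : G × G → CUnits φ} (hc : IsMulCocycle₂ c) :
    (twistedRegular hc).IsUngraded :=
  show (if (0 : ZMod 2) = 0 then (⊤ : Submodule ℂ (G → ℂ)) else ⊥) = ⊤ from if_pos rfl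

/-! ### The type of a central simple graded algebra -/

lemma HasEvenType.congr {A B : MagAlg φ} {x : TwistedProduct φ} (h : HasEvenType A x)
    (e : cls B = cls A) : HasEvenType B x :=
  h.of_iso (cls_eq_iff.1 e).some

/-- The element of the twisted product that classifies a central simple graded algebra `A`, where the
case in which `A` is not a matrix algebra is reduced to the matrix algebra `A ⊗̂ α(1)`. -/
def HasType (A : MagAlg φ) (x : TwistedProduct φ) : Prop :=
  HasEvenType A x ∨ HasEvenType (A.tensor (alphaOne φ)) (x * tau φ)

/-- Irrationality of `√2`: a nonzero square and its double cannot both be dimensions of full matrix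
algebras. -/
lemma not_two_mul_sq {k l : ℕ} (hl : l ≠ 0) : l * l * 2 ≠ k * k := by
  intro h
  apply irrational_sqrt_two
  refine ⟨(k : ℚ) / l, ?_⟩
  have hl' : (l : ℝ) ≠ 0 := Nat.cast_ne_zero.2 hl
  have h' : (l : ℝ) * l * 2 = k * k := by exact_mod_cast h
  have h2 : (2 : ℝ) = (k / l) ^ 2 := by
    field_simp
    linarith
  push_cast
  rw [h2, Real.sqrt_sq (by positivity)]

lemma HasEvenType.not_tensor_alphaOne {A : MagAlg φ} {x y : TwistedProduct φ}
    (h : HasEvenType A x) : ¬ HasEvenType (A.tensor (alphaOne φ)) y := by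
  intro h'
  obtain ⟨l, hl, hA⟩ := h.finrank_eq
  obtain ⟨k, -, hk⟩ := h'.finrank_eq
  rw [finrank_tensor, alphaOne.finrank_eq, hA] at hk
  exact not_two_mul_sq hl hk

/-- Either the ring is simple and Wedderburn applies directly, or the odd central involution makes
it simple after tensoring with `α(1)`; the type is then divided by `τ`. -/
lemma MagAlg.IsCentralSimple.exists_hasType {A : MagAlg φ} (hA : A.IsCentralSimple) :
    ∃ x, HasType A x := by
  by_cases h : IsSimpleRing A.carrier
  · obtain ⟨x, hx⟩ := HasEvenType.exists_of_isSimpleRing A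
    exact ⟨x, Or.inl hx⟩
  · obtain ⟨ω, hω, hωω, hcen⟩ := hA.exists_odd_central h
    have := hA.isSimpleRing_tensor_alphaOne hω hωω hcen
    obtain ⟨x, hx⟩ := HasEvenType.exists_of_isSimpleRing (A.tensor (alphaOne φ))
    exact ⟨x * (tau φ)⁻¹, Or.inr (by rwa [inv_mul_cancel_right])⟩

lemma HasEvenType.isCentralSimple_of_tensor {A C : MagAlg φ} [Nontrivial C.carrier]
    {x : TwistedProduct φ} (h : HasEvenType (A.tensor C) x) : A.IsCentralSimple :=
  IsCentralSimple.of_tensor h.isSimpleRing h.isCentralSimple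

/-! ### Uniqueness and multiplicativity of types -/

namespace HasType

variable {A B : MagAlg φ} {x y : TwistedProduct φ}

lemma isCentralSimple (h : HasType A x) : A.IsCentralSimple :=
  h.elim HasEvenType.isCentralSimple HasEvenType.isCentralSimple_of_tensor

lemma unique (h : HasType A x) (h' : HasType A y) : x = y := by
  rcases h with h | h <;> rcases h' with h' | h'
  · exact h.unique h'
  · exact (h.not_tensor_alphaOne h').elim
  · exact (h'.not_tensor_alphaOne h).elim
  · exact mul_right_cancel (h.unique h')

lemma of_iso (h : HasType A x) (e : Iso B A) : HasType B x :=
  h.imp (·.of_iso e) (·.of_iso (e.tensorCongr (Iso.refl _)))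

/-- The product of two algebras that are not matrix algebras. -/
lemma tensor_of_odd (h : HasEvenType (A.tensor (alphaOne φ)) (x * tau φ))
    (h' : HasEvenType (B.tensor (alphaOne φ)) (y * tau φ)) : HasType (A.tensor B) (x * y) := by
  -- `A ⊗̂ B` becomes a matrix algebra after tensoring with the Clifford algebra, so it is central
  -- simple and has some type. That type is determined by cancelling `τ²`, once the non-matrix case
  -- is excluded.
  have key : HasEvenType ((A.tensor B).tensor ((alphaOne φ).tensor (alphaOne φ)))
      (x * y * (tau φ * tau φ)) := by
    have h1 := h.tensor h'
    rw [mul_mul_mul_comm] at h1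
    refine h1.congr ?_
    simp only [cls_tensor]
    exact mul_mul_mul_comm _ _ _ _
  have : Nontrivial ((alphaOne φ).tensor (alphaOne φ)).carrier :=
    (hasEvenType_clifford φ).isCentralSimple.nontrivial
  obtain ⟨z, hz | hz⟩ := key.isCentralSimple_of_tensor.exists_hasType
  · have h1 := (hz.tensor (hasEvenType_clifford φ)).unique key
    rw [← mul_right_cancel h1]
    exact Or.inl hz
  -- If `A ⊗̂ B ⊗̂ α(1)` were a matrix algebra, its dimension `m²` would satisfy `2m² = (2 dim A)(2
  -- dim B) = (kl)²`.
  · exfalso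
    obtain ⟨k, hk0, hk⟩ := h.finrank_eq
    obtain ⟨l, hl0, hl⟩ := h'.finrank_eq
    obtain ⟨m, hm0, hm⟩ := hz.finrank_eq
    rw [finrank_tensor, alphaOne.finrank_eq] at hk hl hm
    rw [finrank_tensor] at hm
    refine not_two_mul_sq (l := m) (k := k * l) hm0 ?_
    rw [← hm]
    calc _ = (Module.finrank ℂ A.carrier * 2) * (Module.finrank ℂ B.carrier * 2) := by ring
      _ = k * l * (k * l) := by rw [hk, hl]; ring

/-- When at most one factor is odd, the single `α(1)` is moved to the end by reassociating and
commuting factors. -/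
lemma tensor (h : HasType A x) (h' : HasType B y) : HasType (A.tensor B) (x * y) := by
  rcases h with h | h <;> rcases h' with h' | h'
  · exact Or.inl (h.tensor h')
  · right
    have h1 := h.tensor h'
    rw [← mul_assoc] at h1
    refine h1.congr ?_
    simp only [cls_tensor]
    exact mul_assoc _ _ _
  · right
    have h1 := h.tensor h'
    rw [mul_right_comm] at h1
    refine h1.congr ?_
    simp only [cls_tensor]
    exact mul_right_comm _ _ _
  · exact tensor_of_odd h h'

end HasType

lemma MagRep.hasEvenType (V : MagRep φ) : HasEvenType V.endAlg 1 := by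
  have h := V.hasEvenType_endAlg isMulCocycle₂_one
  rwa [H2Phi.mk_one] at h

lemma hasType_alpha (φ : G →* Multiplicative (ZMod 2)) (a : ZMod 2) :
    HasType (alpha φ a) ⟨0, 1, a⟩ := by
  rcases zmod_two_eq a with rfl | rfl
  · exact Or.inl (hasEvenType_alphaZero φ)
  · exact Or.inr (hasEvenType_clifford φ)

/-- The type of `End(V_λ) ⊗̂ σ(ψ) ⊗̂ α(a)`. -/
lemma hasType_standard {c : G × G → CUnits φ} (hc : IsMulCocycle₂ c) (V : MagProjRep φ c)
    (ψ : G →* Multiplicative (ZMod 2)) (a : ZMod 2) :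
    HasType ((V.endAlg.tensor (sigma φ ψ)).tensor (alpha φ a)) ⟨H2Phi.mk φ hc, ψ, a⟩ := by
  have h : HasType (V.endAlg.tensor (sigma φ ψ)) _ :=
    Or.inl ((V.hasEvenType_endAlg hc).tensor (hasEvenType_sigma φ ψ))
  have h1 := h.tensor (hasType_alpha φ a)
  have h2 : (⟨H2Phi.mk φ hc, 1, 0⟩ * ⟨0, ψ, 0⟩ * ⟨0, 1, a⟩ : TwistedProduct φ) =
      ⟨H2Phi.mk φ hc, ψ, a⟩ := by
    ext1 <;> simp
  rwa [h2] at h1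

lemma exists_hasType [Finite G] (x : TwistedProduct φ) : ∃ A : MagAlg φ, HasType A x := by
  obtain ⟨l, ψ, a⟩ := x
  obtain ⟨c, hc, rfl⟩ := H2Phi.exists_mk_eq l
  exact ⟨_, hasType_standard hc (twistedRegular hc) ψ a⟩

/-- The last component of `1 * τ` is `1`, which rules out the case involving `α(1)`. -/
lemma HasType.exists_iso_endAlg {A : MagAlg φ} (h : HasType A 1) :
    ∃ V : MagRep φ, Nonempty (Iso A V.endAlg) := by
  refine HasEvenType.exists_iso_endAlg (h.resolve_right fun h' => ?_)
  have := h'.1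
  simp [tau] at this

/-- Two central simple graded algebras are similar if and only if they have the same type. -/
lemma similar_iff [Finite G] {A B : MECSGA φ} {x y : TwistedProduct φ} (hA : HasType A.1 x)
    (hB : HasType B.1 y) : Similar A B ↔ x = y := by
  constructor
  · rintro ⟨V, W, ⟨e⟩⟩
    have h1 := hA.tensor (Or.inl V.hasEvenType)
    have h2 := (hB.tensor (Or.inl W.hasEvenType)).of_iso e
    rw [mul_one] at h1 h2
    exact h1.unique h2
  · rintro rfl
    -- `N` serves as an inverse: both `A ⊗̂ N` and `N ⊗̂ B` are endomorphism algebras. The two sides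
    -- of the similarity are then the same threefold product of `A`, `N` and `B`, up to order.
    obtain ⟨N, hN⟩ := exists_hasType x⁻¹
    have h1 := hA.tensor hN
    have h2 := hN.tensor hB
    rw [mul_inv_cancel] at h1
    rw [inv_mul_cancel] at h2
    obtain ⟨V, hV⟩ := h1.exists_iso_endAlg
    obtain ⟨W, hW⟩ := h2.exists_iso_endAlg
    refine ⟨W, V, cls_eq_iff.1 ?_⟩
    rw [cls_tensor, cls_tensor, ← cls_eq_iff.2 hV, ← cls_eq_iff.2 hW, cls_tensor, cls_tensor,
      ← mul_assoc, mul_comm]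

/-! ### The Brauer group -/

namespace MECSGA

/-- The element of the twisted product that classifies a central simple graded algebra. -/
def type (A : MECSGA φ) : TwistedProduct φ := A.2.exists_hasType.choose

lemma hasType (A : MECSGA φ) : HasType A.1 A.type := A.2.exists_hasType.choose_spec

lemma similar_iff_type_eq [Finite G] {A B : MECSGA φ} : Similar A B ↔ A.type = B.type :=
  similar_iff A.hasType B.hasType

end MECSGA

lemma equivalence_similar [Finite G] : Equivalence (Similar (φ := φ)) where
  refl _ := MECSGA.similar_iff_type_eq.2 rfl
  symm h := MECSGA.similar_iff_type_eq.2 (MECSGA.similar_iff_type_eq.1 h).symm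
  trans h h' := MECSGA.similar_iff_type_eq.2
    ((MECSGA.similar_iff_type_eq.1 h).trans (MECSGA.similar_iff_type_eq.1 h'))

/-- The bijection between the similarity classes and the twisted product. -/
def GrBr.equivTwistedProduct (φ : G →* Multiplicative (ZMod 2)) [Finite G] :
    GrBr φ ≃ TwistedProduct φ :=
  Equiv.ofBijective
    (Quot.lift MECSGA.type fun _ _ h => MECSGA.similar_iff_type_eq.1 h) <| by
    constructor
    · rintro ⟨A⟩ ⟨B⟩ h
      exact Quot.sound (MECSGA.similar_iff_type_eq.2 h)
    · intro x
      obtain ⟨A, hA⟩ := exists_hasType x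
      exact ⟨GrBr.mk A hA.isCentralSimple,
        (MECSGA.hasType ⟨A, hA.isCentralSimple⟩).unique hA⟩

lemma GrBr.equivTwistedProduct_mk [Finite G] {A : MagAlg φ} (hA : A.IsCentralSimple)
    {x : TwistedProduct φ} (h : HasType A x) : equivTwistedProduct φ (GrBr.mk A hA) = x :=
  (MECSGA.hasType ⟨A, hA⟩).unique h

end MagneticBrauer

end

/-! ### The main theorem -/

theorem theorem2 (G : Type) [Group G] [Finite G] (φ : G →* Multiplicative (ZMod 2))
    (hφ : Function.Surjective φ) :
    -- similarity is an equivalence relation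
    Equivalence (Similar (φ := φ)) ∧
    -- its classes form an abelian group under the graded tensor product
    ∃ _ : CommGroup (GrBr φ),
      (∀ (A B : MagAlg φ) (hA : A.IsCentralSimple) (hB : B.IsCentralSimple),
        ∃ hAB : (A.tensor B).IsCentralSimple,
          GrBr.mk A hA * GrBr.mk B hB = GrBr.mk (A.tensor B) hAB) ∧
      -- which is isomorphic to the twisted product
      ∃ e : TwistedProduct φ ≃* GrBr φ,
        ∀ (c : G × G → CUnits φ) (hc : IsMulCocycle₂ c),
          -- every class `λ = [c]` is the class of some representation `V_λ`
          (∃ V : MagProjRep φ c, V.IsUngraded) ∧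
          -- and `(λ, ψ, a)` is sent to the class of `End(V_λ) ⊗̂ σ(ψ) ⊗̂ α(a)`
          ∀ V : MagProjRep φ c, V.IsUngraded →
            ∀ (ψ : G →* Multiplicative (ZMod 2)) (a : ZMod 2),
              ∃ h : ((V.endAlg.tensor (sigma φ ψ)).tensor (alpha φ a)).IsCentralSimple,
                e ⟨H2Phi.mk φ hc, ψ, a⟩ =
                  GrBr.mk ((V.endAlg.tensor (sigma φ ψ)).tensor (alpha φ a)) h := by
  -- The group structure is transported from the twisted product; multiplicativity of types shows
  -- that it is induced by `⊗̂`.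
  refine ⟨equivalence_similar, (GrBr.equivTwistedProduct φ).commGroup, ?_, ?_⟩
  · intro A B hA hB
    obtain ⟨x, hx⟩ := hA.exists_hasType
    obtain ⟨y, hy⟩ := hB.exists_hasType
    refine ⟨(hx.tensor hy).isCentralSimple, (GrBr.equivTwistedProduct φ).injective ?_⟩
    rw [GrBr.equivTwistedProduct_mk _ (hx.tensor hy), Equiv.mul_def, Equiv.apply_symm_apply,
      GrBr.equivTwistedProduct_mk hA hx, GrBr.equivTwistedProduct_mk hB hy]
  · let _ := (GrBr.equivTwistedProduct φ).commGroup
    refine ⟨(Equiv.mulEquiv (GrBr.equivTwistedProduct φ)).symm, fun c hc =>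
      ⟨⟨twistedRegular hc, twistedRegular_isUngraded hc⟩, fun V _ ψ a => ?_⟩⟩
    have h := hasType_standard hc V ψ a
    refine ⟨h.isCentralSimple, (GrBr.equivTwistedProduct φ).injective ?_⟩
    rw [GrBr.equivTwistedProduct_mk _ h]
    exact Equiv.apply_symm_apply _ _
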